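/- For $\epsilon\in\mathbb{R}$ and a Schwartz function $f:\mathbb{R}\to\mathbb{C}$ define $$\mathcal{C}^{even}_{\epsilon}f(x)=\sup_{A\in\mathbb{R}}\left|\mathrm{p.v.}\int_{\mathbb{R}}e^{iA|y|^{\epsilon}}f(x-y)\frac{dy}{y}\right|,\qquad \mathcal{C}^{odd}_{\epsilon}f(x)=\sup_{A\in\mathbb{R}}\left|\mathrm{p.v.}\int_{\mathbb{R}}e^{iA\,\mathrm{sgn}(y)|y|^{\epsilon}}f(x-y)\frac{dy}{y}\right|,$$ where $\mathrm{p.v.}\int_{\mathbb{R}}=\lim_{r\to0^+}\int_{|y|>r}$. For every $0<\delta<1$ there is a constant $C_\delta<\infty$, depending only on $\delta$, such that for all $\epsilon\in\mathbb{R}$ with $|\epsilon|>\delta$ and $|\epsilon-1|>\delta$ and all Schwartz functions $f:\mathbb{R}\to\mathbb{C}$, the principal values above exist for all $A,x\in\mathbb{R}$, and $$\|\mathcal{C}^{even}_{\epsilon}f\|_{L^2(\mathbb{R})}\le C_\delta\|f\|_{L^2(\mathbb{R})}\qquad\text{and}\qquad \|\mathcal{C}^{odd}_{\epsilon}f\|_{L^2(\mathbb{R})}\le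 C_\delta\|f\|_{L^2(\mathbb{R})}.$$ -/

import Mathlib

open MeasureTheory Filter Topology
open scoped ENNReal NNReal SchwartzMap

noncomputable section

/-- The truncated oscillatory integral `∫_{|y| > r} e^{i A φ(y)} f(x - y) dy / y`. -/
def truncatedIntegral (φ : ℝ → ℝ) (f : 𝓢(ℝ, ℂ)) (A x r : ℝ) : ℂ :=
  ∫ y in {y : ℝ | r < |y|},
    Complex.exp (Complex.I * ((A * φ y : ℝ) : ℂ)) * f (x - y) / (y : ℂ)

/-- The principal value integral exists: the truncated integrals converge in `ℂ` as `r → 0+`. -/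
def PVExists (φ : ℝ → ℝ) (f : 𝓢(ℝ, ℂ)) (A x : ℝ) : Prop :=
  ∃ l : ℂ, Tendsto (truncatedIntegral φ f A x) (𝓝[>] 0) (𝓝 l)

/-- The principal value integral `p.v. ∫ e^{i A φ(y)} f(x - y) dy / y`,
the limit of the truncated integrals as `r → 0+`. -/
def pvIntegral (φ : ℝ → ℝ) (f : 𝓢(ℝ, ℂ)) (A x : ℝ) : ℂ :=
  limUnder (𝓝[>] 0) (truncatedIntegral φ f A x)

/-- The maximal operator `sup_A |p.v. ∫ e^{i A φ(y)} f(x - y) dy / y|`, with values in `[0, ∞]`. -/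
def maximalOperator (φ : ℝ → ℝ) (f : 𝓢(ℝ, ℂ)) (x : ℝ) : ℝ≥0∞ :=
  ⨆ A : ℝ, ‖pvIntegral φ f A x‖ₑ

/-- The even phase `|y| ^ ε`. -/
def evenPhase (ε y : ℝ) : ℝ := |y| ^ ε

/-- The odd phase `sgn(y) |y| ^ ε`. -/
def oddPhase (ε y : ℝ) : ℝ := Real.sign y * |y| ^ ε

/-- The operator `C_ε^{even}`. -/
def carlesonEven (ε : ℝ) (f : 𝓢(ℝ, ℂ)) : ℝ → ℝ≥0∞ := maximalOperator (evenPhase ε) f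

/-- The operator `C_ε^{odd}`. -/
def carlesonOdd (ε : ℝ) (f : 𝓢(ℝ, ℂ)) : ℝ → ℝ≥0∞ := maximalOperator (oddPhase ε) f

end

/-- The Poisson kernel `a / (y² + a²)`, without the normalising factor `1 / π`. -/
noncomputable def poissonLine (a y : ℝ) : ℝ := a / (y ^ 2 + a ^ 2)

/-- The conjugate Poisson kernel `y / (y² + a²)`. -/
noncomputable def conjPoissonLine (a y : ℝ) : ℝ := y / (y ^ 2 + a ^ 2)

theorem poissonLine_pos {a : ℝ} (ha : 0 < a) (y : ℝ) : 0 < poissonLine a y := by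
  unfold poissonLine; positivity

theorem poissonLine_neg (a y : ℝ) : poissonLine a (-y) = poissonLine a y := by
  simp [poissonLine]

theorem poissonLine_le {a : ℝ} (ha : 0 < a) (y : ℝ) : poissonLine a y ≤ 1 / a := by
  unfold poissonLine
  rw [div_le_div_iff₀ (by positivity) ha]
  nlinarith [sq_nonneg y]

theorem poissonLine_add_le {a c : ℝ} (ha : 0 < a) (hc : 0 < c) (h : ℝ) :
    poissonLine (a + c) h ≤ poissonLine a h + poissonLine c h := by
  unfold poissonLine
  rw [add_div]
  gcongr <;> nlinarith

theorem measurable_poissonLine : Measurable (Function.uncurry poissonLine) := by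
  unfold poissonLine Function.uncurry; fun_prop

theorem continuous_poissonLine {a : ℝ} (ha : 0 < a) : Continuous (poissonLine a) := by
  unfold poissonLine
  exact continuous_const.div (by fun_prop) (fun y => by positivity)

theorem continuous_conjPoissonLine {a : ℝ} (ha : 0 < a) : Continuous (conjPoissonLine a) := by
  unfold conjPoissonLine
  exact continuous_id.div (by fun_prop) (fun y => by positivity)

theorem poissonLine_eq {a : ℝ} (ha : 0 < a) (y : ℝ) :
    poissonLine a y = a⁻¹ * (1 + (a⁻¹ * y) ^ 2)⁻¹ := by
  unfold poissonLine; field_simp; ring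

theorem integrable_poissonLine {a : ℝ} (ha : 0 < a) : Integrable (poissonLine a) := by
  have := (integrable_inv_one_add_sq.comp_mul_left' (inv_ne_zero ha.ne')).const_mul a⁻¹
  exact this.congr (Eventually.of_forall fun y => (poissonLine_eq ha y).symm)

theorem integral_poissonLine {a : ℝ} (ha : 0 < a) : ∫ y, poissonLine a y = Real.pi := by
  simp_rw [poissonLine_eq ha]
  rw [integral_const_mul, Measure.integral_comp_mul_left (fun y : ℝ => (1 + y ^ 2)⁻¹),
    integral_univ_inv_one_add_sq, inv_inv, abs_of_pos ha, smul_eq_mul]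
  field_simp

theorem conjPoissonLine_sq_le {a : ℝ} (ha : 0 < a) (y : ℝ) :
    conjPoissonLine a y ^ 2 ≤ a⁻¹ * poissonLine a y := by
  unfold conjPoissonLine poissonLine
  rw [div_pow, ← mul_div_assoc, inv_mul_cancel₀ ha.ne', div_le_div_iff₀ (by positivity) (by positivity)]
  nlinarith [sq_nonneg (a * y), sq_nonneg a, sq_nonneg (a ^ 2), sq_nonneg (y ^ 2)]

theorem abs_conjPoissonLine_le {a : ℝ} (ha : 0 < a) (y : ℝ) :
    |conjPoissonLine a y| ≤ 1 / a := by
  refine abs_le_of_sq_le_sq ?_ (by positivity)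
  refine (conjPoissonLine_sq_le ha y).trans ?_
  rw [sq, inv_eq_one_div]
  exact mul_le_mul_of_nonneg_left (poissonLine_le ha y) (by positivity)

section Correlation

variable {a c h : ℝ}

theorem integrable_conjPoissonLine_mul (ha : 0 < a) (hc : 0 < c) (h : ℝ) :
    Integrable fun y => conjPoissonLine a y * conjPoissonLine c (y + h) := by
  have hb : Integrable fun y => a⁻¹ * poissonLine a y + c⁻¹ * poissonLine c (y + h) :=
    ((integrable_poissonLine ha).const_mul _).add
      (((integrable_poissonLine hc).comp_add_right h).const_mul _)
  refine hb.mono' ?_ (Eventually.of_forall fun y => ?_)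
  · exact ((continuous_conjPoissonLine ha).mul
      ((continuous_conjPoissonLine hc).comp (by fun_prop))).aestronglyMeasurable
  · rw [Real.norm_eq_abs, abs_le]
    have h1 := conjPoissonLine_sq_le ha y
    have h2 := conjPoissonLine_sq_le hc (y + h)
    constructor <;> nlinarith [sq_nonneg (conjPoissonLine a y + conjPoissonLine c (y + h)),
      sq_nonneg (conjPoissonLine a y - conjPoissonLine c (y + h)),
      sq_nonneg (conjPoissonLine a y), sq_nonneg (conjPoissonLine c (y + h))]

theorem integrable_poissonLine_mul (ha : 0 < a) (hc : 0 < c) (h : ℝ) :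
    Integrable fun y => poissonLine a y * poissonLine c (y + h) := by
  refine ((integrable_poissonLine ha).mul_const (1 / c)).mono' ?_ (Eventually.of_forall fun y => ?_)
  · exact ((continuous_poissonLine ha).mul
      ((continuous_poissonLine hc).comp (by fun_prop))).aestronglyMeasurable
  · rw [Real.norm_eq_abs, abs_mul, abs_of_pos (poissonLine_pos ha _),
      abs_of_pos (poissonLine_pos hc _)]
    exact mul_le_mul_of_nonneg_left (poissonLine_le hc _) (poissonLine_pos ha _).le

theorem partialFractions_sum (ha : 0 < a) (hc : 0 < c) (y : ℝ) :
    conjPoissonLine a y * conjPoissonLine c (y + h)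
      + poissonLine a y * poissonLine c (y + h) =
    (h * (conjPoissonLine a y - conjPoissonLine c (y + h))
      + (a + c) * (poissonLine a y + poissonLine c (y + h))) / (h ^ 2 + (a + c) ^ 2) := by
  unfold conjPoissonLine poissonLine
  have h1 : y ^ 2 + a ^ 2 ≠ 0 := by positivity
  have h2 : (y + h) ^ 2 + c ^ 2 ≠ 0 := by positivity
  have h3 : h ^ 2 + (a + c) ^ 2 ≠ 0 := by positivity
  rw [eq_div_iff h3]
  field_simp
  ring

theorem partialFractions_sub (hh : h ≠ 0) (ha : 0 < a) (hc : 0 < c) (y : ℝ) :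
    conjPoissonLine a y * conjPoissonLine c (y + h)
      - poissonLine a y * poissonLine c (y + h) =
    (h * (conjPoissonLine a y - conjPoissonLine c (y + h))
      - (c - a) * (poissonLine a y - poissonLine c (y + h))) / (h ^ 2 + (c - a) ^ 2) := by
  unfold conjPoissonLine poissonLine
  have h1 : y ^ 2 + a ^ 2 ≠ 0 := by positivity
  have h2 : (y + h) ^ 2 + c ^ 2 ≠ 0 := by positivity
  have h3 : h ^ 2 + (c - a) ^ 2 ≠ 0 := by positivity
  rw [eq_div_iff h3]
  field_simp
  ring

theorem integrable_conjPoissonLine_sub (hh : h ≠ 0) (ha : 0 < a) (hc : 0 < c) :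
    Integrable fun y => conjPoissonLine a y - conjPoissonLine c (y + h) := by
  have h3 : h ^ 2 + (a + c) ^ 2 ≠ 0 := by positivity
  have hb := ((((integrable_conjPoissonLine_mul ha hc h).add
    (integrable_poissonLine_mul ha hc h)).const_mul (h ^ 2 + (a + c) ^ 2)).sub
    (((integrable_poissonLine ha).add
      ((integrable_poissonLine hc).comp_add_right h)).const_mul (a + c))).const_mul h⁻¹
  refine hb.congr (Eventually.of_forall fun y => ?_)
  have := partialFractions_sum (h := h) ha hc y
  simp only [Pi.add_apply, Pi.sub_apply]
  rw [this]
  field_simp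
  ring

theorem tendsto_log_ratio {l : Filter ℝ} (hl : Tendsto (fun y : ℝ => y⁻¹) l (𝓝 0))
    (hne : ∀ᶠ y in l, y ≠ 0) :
    Tendsto (fun y => 1 / 2 * Real.log ((y ^ 2 + a ^ 2) / ((y + h) ^ 2 + c ^ 2))) l (𝓝 0) := by
  have h0 : Tendsto (fun y : ℝ => (1 + (a * y⁻¹) ^ 2) / ((1 + h * y⁻¹) ^ 2 + (c * y⁻¹) ^ 2)) l
      (𝓝 ((1 + (a * 0) ^ 2) / ((1 + h * 0) ^ 2 + (c * 0) ^ 2))) := by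
    refine Tendsto.div ?_ ?_ (by simp)
    · exact tendsto_const_nhds.add ((hl.const_mul a).pow 2)
    · exact ((tendsto_const_nhds.add (hl.const_mul h)).pow 2).add ((hl.const_mul c).pow 2)
  have h1 := ((Real.continuousAt_log (x := (1 + (a * 0) ^ 2) / ((1 + h * 0) ^ 2 + (c * 0) ^ 2))
    (by simp)).tendsto.comp h0).const_mul (1 / 2)
  simp only [mul_zero, add_zero, one_pow, ne_eq, OfNat.ofNat_ne_zero, not_false_eq_true,
    zero_pow, div_one, Real.log_one] at h1
  refine h1.congr' ?_
  filter_upwards [hne] with y hy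
  simp only [Function.comp]
  congr 2
  rw [show y ^ 2 + a ^ 2 = y ^ 2 * (1 + (a * y⁻¹) ^ 2) by field_simp,
    show (y + h) ^ 2 + c ^ 2 = y ^ 2 * ((1 + h * y⁻¹) ^ 2 + (c * y⁻¹) ^ 2) by field_simp,
    mul_div_mul_left _ _ (pow_ne_zero 2 hy)]

theorem integral_conjPoissonLine_sub (hh : h ≠ 0) (ha : 0 < a) (hc : 0 < c) :
    ∫ y, (conjPoissonLine a y - conjPoissonLine c (y + h)) = 0 := by
  have := integral_of_hasDerivAt_of_tendsto
    (f := fun y => 1 / 2 * Real.log ((y ^ 2 + a ^ 2) / ((y + h) ^ 2 + c ^ 2)))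
    (f' := fun y => conjPoissonLine a y - conjPoissonLine c (y + h)) (m := 0) (n := 0)
    (fun y => ?_) (integrable_conjPoissonLine_sub hh ha hc)
    (tendsto_log_ratio tendsto_inv_atBot_zero (eventually_ne_atBot 0))
    (tendsto_log_ratio tendsto_inv_atTop_zero (eventually_ne_atTop 0))
  · simpa using this
  · have h1 : y ^ 2 + a ^ 2 ≠ 0 := by positivity
    have h2 : (y + h) ^ 2 + c ^ 2 ≠ 0 := by positivity
    have d1 : HasDerivAt (fun y => y ^ 2 + a ^ 2) (2 * y) y := by
      simpa using (hasDerivAt_pow 2 y).add_const (a ^ 2)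
    have d2 : HasDerivAt (fun y => (y + h) ^ 2 + c ^ 2) (2 * (y + h)) y := by
      simpa using (((hasDerivAt_id y).add_const h).pow 2).add_const (c ^ 2)
    have d3 := ((d1.div d2 h2).log (div_ne_zero h1 h2)).const_mul (1 / 2)
    refine d3.congr_deriv ?_
    unfold conjPoissonLine
    simp only [Pi.div_apply]
    field_simp

theorem integral_poissonLine_correlation (hh : h ≠ 0) (ha : 0 < a) (hc : 0 < c) :
    ∫ y, poissonLine a y * poissonLine c (y + h) = Real.pi * poissonLine (a + c) h ∧
    ∫ y, conjPoissonLine a y * conjPoissonLine c (y + h)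
      = Real.pi * poissonLine (a + c) h := by
  have iP := integrable_poissonLine ha
  have iP' := (integrable_poissonLine hc).comp_add_right h
  have iS := integrable_conjPoissonLine_sub hh ha hc
  have iPP := integrable_poissonLine_mul ha hc h
  have iQQ := integrable_conjPoissonLine_mul ha hc h
  have eP' : ∫ y, poissonLine c (y + h) = Real.pi := by
    rw [integral_add_right_eq_self (poissonLine c), integral_poissonLine hc]
  have iA : Integrable fun y => poissonLine a y + poissonLine c (y + h) := iP.add iP'
  have iD : Integrable fun y => poissonLine a y - poissonLine c (y + h) := iP.sub iP'
  have h1 : (∫ y, conjPoissonLine a y * conjPoissonLine c (y + h))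
      + ∫ y, poissonLine a y * poissonLine c (y + h) = 2 * Real.pi * poissonLine (a + c) h := by
    rw [← integral_add iQQ iPP]
    simp_rw [partialFractions_sum ha hc]
    rw [integral_div, integral_add (iS.const_mul h) (iA.const_mul _), integral_const_mul,
      integral_const_mul, integral_add iP iP', integral_conjPoissonLine_sub hh ha hc,
      integral_poissonLine ha, eP', poissonLine]
    ring
  have h2 : (∫ y, conjPoissonLine a y * conjPoissonLine c (y + h))
      - ∫ y, poissonLine a y * poissonLine c (y + h) = 0 := by
    rw [← integral_sub iQQ iPP]
    simp_rw [partialFractions_sub hh ha hc]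
    rw [integral_div, integral_sub (iS.const_mul h) (iD.const_mul _), integral_const_mul,
      integral_const_mul, integral_sub iP iP', integral_conjPoissonLine_sub hh ha hc,
      integral_poissonLine ha, eP']
    ring
  constructor <;> linarith

end Correlation

/-- The `L²(ℝ)` norm of a function with values in `[0, ∞]`. -/
noncomputable def l2Norm (g : ℝ → ℝ≥0∞) : ℝ≥0∞ := (∫⁻ x, g x ^ 2) ^ (1 / 2 : ℝ)

theorem l2Norm_sq (g : ℝ → ℝ≥0∞) : l2Norm g ^ 2 = ∫⁻ x, g x ^ 2 := by
  rw [l2Norm, ← ENNReal.rpow_natCast, ← ENNReal.rpow_mul]; norm_num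

theorem l2Norm_mono {g g' : ℝ → ℝ≥0∞} (h : ∀ x, g x ≤ g' x) : l2Norm g ≤ l2Norm g' := by
  unfold l2Norm; gcongr; exact h _

theorem lintegral_mul_le_l2Norm {g g' : ℝ → ℝ≥0∞} (hg : Measurable g) (hg' : Measurable g') :
    ∫⁻ x, g x * g' x ≤ l2Norm g * l2Norm g' := by
  have := ENNReal.lintegral_mul_le_Lp_mul_Lq volume Real.HolderConjugate.two_two
    hg.aemeasurable hg'.aemeasurable
  simpa [l2Norm, ENNReal.rpow_two] using this

theorem l2Norm_add_le {g g' : ℝ → ℝ≥0∞} (hg : Measurable g) (hg' : Measurable g') :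
    l2Norm (fun x => g x + g' x) ≤ l2Norm g + l2Norm g' := by
  have := ENNReal.lintegral_Lp_add_le (μ := volume) hg.aemeasurable hg'.aemeasurable
    (p := 2) (by norm_num)
  simpa [l2Norm, ENNReal.rpow_two] using this

theorem l2Norm_zero : l2Norm (fun _ => 0) = 0 := by simp [l2Norm]

theorem l2Norm_sum_le {ι : Type*} (s : Finset ι) {g : ι → ℝ → ℝ≥0∞} (hg : ∀ i, Measurable (g i)) :
    l2Norm (fun x => ∑ i ∈ s, g i x) ≤ ∑ i ∈ s, l2Norm (g i) := by
  classical
  induction s using Finset.induction_on with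
  | empty => simp [l2Norm_zero]
  | insert a s ha ih =>
    simp_rw [Finset.sum_insert ha]
    exact (l2Norm_add_le (hg a) (Finset.measurable_sum s fun i _ => hg i)).trans (by gcongr)

theorem l2Norm_iSup {g : ℕ → ℝ → ℝ≥0∞} (hg : ∀ n, Measurable (g n)) (hm : Monotone g)
    {B : ℝ≥0∞} (hB : ∀ n, l2Norm (g n) ≤ B) : l2Norm (fun x => ⨆ n, g n x) ≤ B := by
  have : l2Norm (fun x => ⨆ n, g n x) ^ 2 ≤ B ^ 2 := by
    rw [l2Norm_sq]
    have e : ∀ x, (⨆ n, g n x) ^ 2 = ⨆ n, g n x ^ 2 := fun x =>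
      (pow_left_mono 2).map_iSup_of_continuousAt (ENNReal.continuous_pow 2).continuousAt (by simp)
    simp_rw [e]
    rw [lintegral_iSup (fun n => (hg n).pow_const 2)
      (fun m n h x => by have := hm h x; simp only; gcongr)]
    exact iSup_le fun n => by rw [← l2Norm_sq]; gcongr; exact hB n
  exact (ENNReal.pow_le_pow_left_iff two_ne_zero).1 this

/-- An integral kernel whose bilinear form is bounded on `L² × L²`. -/
def FormBound (k : ℝ → ℝ → ℝ≥0∞) (B : ℝ≥0∞) : Prop :=
  ∀ g g' : ℝ → ℝ≥0∞, Measurable g → Measurable g' →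
    ∫⁻ x, ∫⁻ z, g x * (k x z * g' z) ≤ B * (l2Norm g * l2Norm g')

theorem FormBound.mono {k k' : ℝ → ℝ → ℝ≥0∞} {B B' : ℝ≥0∞} (h : FormBound k B)
    (hk : ∀ x z, x ≠ z → k' x z ≤ k x z) (hB : B ≤ B') : FormBound k' B' := by
  intro g g' hg hg'
  refine le_trans (lintegral_mono fun x => ?_) ((h g g' hg hg').trans (by gcongr))
  refine lintegral_mono_ae ?_
  filter_upwards [Measure.ae_ne volume x] with z hz
  have := hk x z hz.symm
  gcongr

theorem FormBound.tsum {ι : Type*} [Countable ι] {k : ι → ℝ → ℝ → ℝ≥0∞} {B : ι → ℝ≥0∞}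
    (hk : ∀ i, Measurable (Function.uncurry (k i))) (h : ∀ i, FormBound (k i) (B i)) :
    FormBound (fun x z => ∑' i, k i x z) (∑' i, B i) := by
  intro g g' hg hg'
  simp_rw [← ENNReal.tsum_mul_right, ← ENNReal.tsum_mul_left]
  have m : ∀ i, Measurable (Function.uncurry fun x z => g x * (k i x z * g' z)) := fun i =>
    (hg.comp measurable_fst).mul ((hk i).mul (hg'.comp measurable_snd))
  have e : ∀ x, ∫⁻ z, ∑' i, g x * (k i x z * g' z) = ∑' i, ∫⁻ z, g x * (k i x z * g' z) :=
    fun x => lintegral_tsum fun i => ((m i).comp measurable_prodMk_left).aemeasurable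
  simp_rw [e]
  rw [lintegral_tsum fun i => (m i).lintegral_prod_right.aemeasurable]
  exact ENNReal.tsum_le_tsum fun i => h i g g' hg hg'

theorem FormBound.const_mul {k : ℝ → ℝ → ℝ≥0∞} {B : ℝ≥0∞} (hk : Measurable (Function.uncurry k))
    (h : FormBound k B) (c : ℝ≥0∞) : FormBound (fun x z => c * k x z) (c * B) := by
  intro g g' hg hg'
  have m : Measurable (Function.uncurry fun x z => g x * (k x z * g' z)) :=
    (hg.comp measurable_fst).mul (hk.mul (hg'.comp measurable_snd))
  have e : ∀ x, ∫⁻ z, g x * (c * k x z * g' z) = c * ∫⁻ z, g x * (k x z * g' z) := fun x => by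
    rw [← lintegral_const_mul _ (m.of_uncurry_left (x := x))]
    exact lintegral_congr fun z => by ring
  simp_rw [e]
  rw [lintegral_const_mul _ m.lintegral_prod_right, mul_assoc]
  gcongr
  exact h g g' hg hg'

theorem FormBound.add {k k' : ℝ → ℝ → ℝ≥0∞} {B B' : ℝ≥0∞} (hk : Measurable (Function.uncurry k))
    (hk' : Measurable (Function.uncurry k')) (h : FormBound k B) (h' : FormBound k' B') :
    FormBound (fun x z => k x z + k' x z) (B + B') := by
  have := FormBound.tsum (k := fun i : Bool => bif i then k else k')
    (B := fun i => bif i then B else B') (by rintro (_ | _) <;> assumption)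
    (by rintro (_ | _) <;> assumption)
  simpa [tsum_bool, add_comm] using this

/-- The truncation of a function to height `n` and to the interval `[-n, n]`. -/
noncomputable def truncate (n : ℕ) (g : ℝ → ℝ≥0∞) (x : ℝ) : ℝ≥0∞ :=
  if |x| ≤ n then min (g x) n else 0

theorem truncate_le (n : ℕ) (g : ℝ → ℝ≥0∞) (x : ℝ) : truncate n g x ≤ g x := by
  unfold truncate; split_ifs <;> simp

theorem measurable_truncate (n : ℕ) {g : ℝ → ℝ≥0∞} (hg : Measurable g) :
    Measurable (truncate n g) :=
  Measurable.ite (measurableSet_le (by fun_prop) measurable_const) (hg.min measurable_const)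
    measurable_const

theorem monotone_truncate (g : ℝ → ℝ≥0∞) : Monotone fun n => truncate n g := by
  intro m n h x
  have h' : (m : ℝ) ≤ n := by exact_mod_cast h
  have h'' : (m : ℝ≥0∞) ≤ n := by exact_mod_cast h
  simp only [truncate]
  split_ifs with h1 h2
  · gcongr
  · exact absurd (h1.trans h') h2
  · simp
  · simp

theorem iSup_truncate (g : ℝ → ℝ≥0∞) (x : ℝ) : ⨆ n, truncate n g x = g x := by
  refine le_antisymm (iSup_le fun n => truncate_le n g x) ?_
  have h : g x = ⨆ n : ℕ, min (g x) n := by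
    rw [← inf_iSup_eq]; simp [ENNReal.iSup_natCast]
  rw [h]
  obtain ⟨N, hN⟩ := exists_nat_ge |x|
  refine iSup_le fun n => le_trans ?_ (le_iSup _ (max n N))
  have : |x| ≤ (max n N : ℕ) := hN.trans (by exact_mod_cast le_max_right n N)
  rw [truncate, if_pos this]
  gcongr
  exact le_max_left n N

theorem truncate_le_indicator (n : ℕ) (g : ℝ → ℝ≥0∞) (x : ℝ) :
    truncate n g x ≤ (Set.Icc (-n : ℝ) n).indicator (fun _ => (n : ℝ≥0∞)) x := by
  unfold truncate
  split_ifs with h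
  · rw [Set.indicator_of_mem (Set.mem_Icc.2 (abs_le.1 h))]; exact min_le_right _ _
  · simp

theorem lintegral_truncate_ne_top (n : ℕ) (g : ℝ → ℝ≥0∞) : ∫⁻ x, truncate n g x ≠ ⊤ := by
  refine ne_top_of_le_ne_top ?_ (lintegral_mono (truncate_le_indicator n g))
  rw [lintegral_indicator measurableSet_Icc]
  simp [ENNReal.mul_eq_top]

theorem l2Norm_truncate_ne_top (n : ℕ) (g : ℝ → ℝ≥0∞) : l2Norm (truncate n g) ≠ ⊤ := by
  have h : l2Norm (truncate n g) ^ 2 ≤ n * ∫⁻ x, truncate n g x := by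
    rw [l2Norm_sq, ← lintegral_const_mul' _ _ (by simp)]
    refine lintegral_mono fun x => ?_
    rw [sq]
    gcongr
    refine (truncate_le_indicator n g x).trans (Set.indicator_le_self _ _ _)
  have h' : l2Norm (truncate n g) ^ 2 ≠ ⊤ :=
    ne_top_of_le_ne_top (ENNReal.mul_ne_top (by simp) (lintegral_truncate_ne_top n g)) h
  exact fun h0 => h' (by simp [h0])

theorem le_of_sq_le_mul {N C : ℝ≥0∞} (hN : N ≠ ⊤) (h : N ^ 2 ≤ C * N) : N ≤ C := by
  rcases eq_or_ne N 0 with rfl | h0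
  · simp
  · rw [sq] at h
    exact (ENNReal.mul_le_mul_iff_left h0 hN).1 h

/-- The positive integral operator of a kernel with bounded form is bounded on `L²`. -/
theorem FormBound.l2Norm_le {k : ℝ → ℝ → ℝ≥0∞} {B : ℝ≥0∞} (hk : Measurable (Function.uncurry k))
    (h : FormBound k B) {g : ℝ → ℝ≥0∞} (hg : Measurable g) :
    l2Norm (fun x => ∫⁻ z, k x z * g z) ≤ B * l2Norm g := by
  set L : ℝ → ℝ≥0∞ := fun x => ∫⁻ z, k x z * g z
  have mk : Measurable (Function.uncurry fun x z => k x z * g z) :=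
    hk.mul (hg.comp measurable_snd)
  have mL : Measurable L := mk.lintegral_prod_right
  have key : ∀ n, l2Norm (truncate n L) ≤ B * l2Norm g := fun n => by
    refine le_of_sq_le_mul (l2Norm_truncate_ne_top n L) ?_
    calc l2Norm (truncate n L) ^ 2 = ∫⁻ x, truncate n L x ^ 2 := l2Norm_sq _
      _ ≤ ∫⁻ x, truncate n L x * L x := lintegral_mono fun x => by
          rw [sq]; gcongr; exact truncate_le n L x
      _ = ∫⁻ x, ∫⁻ z, truncate n L x * (k x z * g z) := lintegral_congr fun x =>
          (lintegral_const_mul _ mk.of_uncurry_left).symm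
      _ ≤ B * (l2Norm (truncate n L) * l2Norm g) := h _ _ (measurable_truncate n mL) hg
      _ = B * l2Norm g * l2Norm (truncate n L) := by ring
  have := l2Norm_iSup (fun n => measurable_truncate n mL) (monotone_truncate L) key
  simpa [iSup_truncate] using this

/-- If `k kᵀ` is dominated by `C (k + kᵀ)`, the form of `k` is bounded on a pair of functions as
soon as it is finite on the diagonal. -/
theorem form_le_of_finite {k : ℝ → ℝ → ℝ≥0∞} (hk : Measurable (Function.uncurry k)) {C : ℝ≥0∞}
    (hC : C ≠ ⊤) (hkk : ∀ x x', x ≠ x' → ∫⁻ z, k x z * k x' z ≤ C * (k x x' + k x' x))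
    {g g' : ℝ → ℝ≥0∞} (hg : Measurable g) (hg' : Measurable g')
    (hfin : ∫⁻ x, ∫⁻ z, g x * (k x z * g z) ≠ ⊤) :
    ∫⁻ x, ∫⁻ z, g x * (k x z * g' z) ≤ 2 * C * (l2Norm g * l2Norm g') := by
  set F := ∫⁻ x, ∫⁻ z, g x * (k x z * g z)
  set U : ℝ → ℝ≥0∞ := fun z => ∫⁻ x, g x * k x z
  have mgk : Measurable (Function.uncurry fun x z => g x * k x z) :=
    (hg.comp measurable_fst).mul hk
  have mU : Measurable U := mgk.lintegral_prod_left
  have eU : ∀ v : ℝ → ℝ≥0∞, Measurable v →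
      ∫⁻ x, ∫⁻ z, g x * (k x z * v z) = ∫⁻ z, U z * v z := fun v hv => by
    rw [lintegral_lintegral_swap]
    · refine lintegral_congr fun z => ?_
      rw [← lintegral_mul_const _ mgk.of_uncurry_right]
      exact lintegral_congr fun x => by ring
    · exact ((hg.comp measurable_fst).mul (hk.mul (hv.comp measurable_snd))).aemeasurable
  have hU : l2Norm U ^ 2 ≤ 2 * C * F := by
    rw [l2Norm_sq]
    have m3 : Measurable fun p : (ℝ × ℝ) × ℝ => g p.1.1 * k p.1.1 p.2 * (g p.1.2 * k p.1.2 p.2) :=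
      (mgk.comp (f := fun p : (ℝ × ℝ) × ℝ => (p.1.1, p.2)) (by fun_prop)).mul
        (mgk.comp (f := fun p : (ℝ × ℝ) × ℝ => (p.1.2, p.2)) (by fun_prop))
    calc ∫⁻ z, U z ^ 2 = ∫⁻ z, ∫⁻ x, g x * k x z * U z := lintegral_congr fun z => by
          rw [sq, lintegral_mul_const _ mgk.of_uncurry_right]
      _ = ∫⁻ z, ∫⁻ x, ∫⁻ x', g x * k x z * (g x' * k x' z) :=
          lintegral_congr fun z => lintegral_congr fun x =>
            (lintegral_const_mul _ mgk.of_uncurry_right).symm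
      _ = ∫⁻ x, ∫⁻ z, ∫⁻ x', g x * k x z * (g x' * k x' z) := by
          rw [lintegral_lintegral_swap]
          refine Measurable.aemeasurable ?_
          exact Measurable.lintegral_prod_right' (f := fun p : (ℝ × ℝ) × ℝ =>
            g p.1.2 * k p.1.2 p.1.1 * (g p.2 * k p.2 p.1.1))
            (m3.comp (g := fun p : (ℝ × ℝ) × ℝ => g p.1.1 * k p.1.1 p.2 * (g p.1.2 * k p.1.2 p.2))
              (f := fun p : (ℝ × ℝ) × ℝ => ((p.1.2, p.2), p.1.1)) (by fun_prop))
      _ = ∫⁻ x, ∫⁻ x', ∫⁻ z, g x * k x z * (g x' * k x' z) := lintegral_congr fun x => by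
          rw [lintegral_lintegral_swap]
          exact (m3.comp (f := fun p : ℝ × ℝ => ((x, p.2), p.1)) (by fun_prop)).aemeasurable
      _ ≤ ∫⁻ x, ∫⁻ x', (C * (g x * (k x x' * g x')) + C * (g x' * (k x' x * g x))) := by
          refine lintegral_mono fun x => lintegral_mono_ae ?_
          filter_upwards [Measure.ae_ne volume x] with x' hx'
          calc ∫⁻ z, g x * k x z * (g x' * k x' z) = g x * g x' * ∫⁻ z, k x z * k x' z := by
                rw [← lintegral_const_mul _ (by
                  exact hk.of_uncurry_left.mul hk.of_uncurry_left)]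
                exact lintegral_congr fun z => by ring
            _ ≤ g x * g x' * (C * (k x x' + k x' x)) := by gcongr; exact hkk x x' hx'.symm
            _ = _ := by ring
      _ = C * F + C * F := by
          have m1 : Measurable (Function.uncurry fun x x' => C * (g x * (k x x' * g x'))) :=
            ((hg.comp measurable_fst).mul (hk.mul (hg.comp measurable_snd))).const_mul C
          have m2 : Measurable (Function.uncurry fun x x' => C * (g x' * (k x' x * g x))) :=
            m1.comp measurable_swap
          have e1 : ∫⁻ x, ∫⁻ x', C * (g x * (k x x' * g x')) = C * F := by
            simp_rw [lintegral_const_mul' _ _ hC]; rfl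
          have e2 : ∫⁻ x, ∫⁻ x', C * (g x' * (k x' x * g x)) = C * F := by
            rw [lintegral_lintegral_swap m2.aemeasurable, e1]
          simp_rw [lintegral_add_left m1.of_uncurry_left]
          rw [lintegral_add_left m1.lintegral_prod_right, e1, e2]
      _ = 2 * C * F := by ring
  have hF : F ≤ 2 * C * l2Norm g ^ 2 := by
    refine le_of_sq_le_mul hfin ?_
    calc F ^ 2 = (∫⁻ z, U z * g z) ^ 2 := by rw [← eU g hg]
      _ ≤ (l2Norm U * l2Norm g) ^ 2 := by gcongr; exact lintegral_mul_le_l2Norm mU hg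
      _ = l2Norm U ^ 2 * l2Norm g ^ 2 := mul_pow _ _ _
      _ ≤ 2 * C * F * l2Norm g ^ 2 := by gcongr
      _ = 2 * C * l2Norm g ^ 2 * F := by ring
  have hU' : l2Norm U ≤ 2 * C * l2Norm g := by
    refine (ENNReal.pow_le_pow_left_iff two_ne_zero).1 (hU.trans ?_)
    calc 2 * C * F ≤ 2 * C * (2 * C * l2Norm g ^ 2) := by gcongr
      _ = _ := by ring
  rw [eU g' hg', ← mul_assoc]
  exact (lintegral_mul_le_l2Norm mU hg').trans (by gcongr)

theorem measurable_poissonLine_comp {a : ℝ → ℝ} (ha : Measurable a) :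
    Measurable (Function.uncurry fun x z => ENNReal.ofReal (poissonLine (a x) (x - z))) :=
  (measurable_poissonLine.comp (f := fun p : ℝ × ℝ => (a p.1, p.1 - p.2))
    (by fun_prop)).ennreal_ofReal

theorem poissonLine_sub_comm (a x z : ℝ) : poissonLine a (x - z) = poissonLine a (z - x) := by
  rw [← poissonLine_neg, neg_sub]

theorem lintegral_poissonLine_correlation {a c x x' : ℝ} (ha : 0 < a) (hc : 0 < c) (hx : x ≠ x') :
    ∫⁻ z, ENNReal.ofReal (poissonLine a (x - z)) * ENNReal.ofReal (poissonLine c (x' - z)) ≤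
      ENNReal.ofReal Real.pi * (ENNReal.ofReal (poissonLine a (x - x'))
        + ENNReal.ofReal (poissonLine c (x' - x))) := by
  have e : ∫⁻ z, ENNReal.ofReal (poissonLine a (x - z)) * ENNReal.ofReal (poissonLine c (x' - z))
      = ∫⁻ y, ENNReal.ofReal (poissonLine a y * poissonLine c (y + (x' - x))) := by
    rw [← lintegral_sub_left_eq_self _ x]
    refine lintegral_congr fun z => ?_
    rw [ENNReal.ofReal_mul (poissonLine_pos ha _).le]
    congr 3 <;> ring
  rw [e, ← ofReal_integral_eq_lintegral_ofReal (integrable_poissonLine_mul ha hc _)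
    (Eventually.of_forall fun y => (mul_pos (poissonLine_pos ha _) (poissonLine_pos hc _)).le),
    (integral_poissonLine_correlation (sub_ne_zero.2 hx.symm) ha hc).1,
    ENNReal.ofReal_mul Real.pi_pos.le, ← ENNReal.ofReal_add (poissonLine_pos ha _).le
      (poissonLine_pos hc _).le, poissonLine_sub_comm a x x']
  gcongr
  exact poissonLine_add_le ha hc _

/-- The linearised Poisson maximal operator is bounded on `L²`. -/
theorem formBound_poissonLine {a : ℝ → ℝ} (ha : Measurable a) (hpos : ∀ x, 0 < a x) :
    FormBound (fun x z => ENNReal.ofReal (poissonLine (a x) (x - z)))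
      (2 * ENNReal.ofReal Real.pi) := by
  intro g g' hg hg'
  set k : ℝ → ℝ → ℝ≥0∞ := fun x z => ENNReal.ofReal (poissonLine (a x) (x - z))
  have hk : Measurable (Function.uncurry k) := measurable_poissonLine_comp ha
  set G : ℕ → ℝ → ℝ≥0∞ := fun n x => if 1 / (n + 1 : ℝ) ≤ a x then truncate n g x else 0
  have mG : ∀ n, Measurable (G n) := fun n =>
    Measurable.ite (measurableSet_le measurable_const ha) (measurable_truncate n hg)
      measurable_const
  have hGt : ∀ n x, G n x ≤ truncate n g x := fun n x => by
    simp only [G]; split_ifs <;> simp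
  have hmono : Monotone G := by
    intro m n h x
    simp only [G]
    split_ifs with h1 h2
    · exact monotone_truncate g h x
    · refine absurd (le_trans ?_ h1) h2
      gcongr
    · simp
    · simp
  have hsup : ∀ x, ⨆ n, G n x = g x := fun x => by
    refine le_antisymm (iSup_le fun n => (hGt n x).trans (truncate_le n g x)) ?_
    rw [← iSup_truncate g x]
    obtain ⟨N, hN⟩ := exists_nat_one_div_lt (hpos x)
    refine iSup_le fun n => le_trans ?_ (le_iSup _ (max n N))
    have : 1 / ((max n N : ℕ) + 1 : ℝ) ≤ a x := by
      refine le_trans ?_ hN.le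
      gcongr
      exact le_max_right n N
    simp only [G, if_pos this]
    exact monotone_truncate g (le_max_left n N) x
  have key : ∀ n, ∫⁻ x, ∫⁻ z, G n x * (k x z * g' z) ≤
      2 * ENNReal.ofReal Real.pi * (l2Norm g * l2Norm g') := fun n => by
    have hle : l2Norm (G n) ≤ l2Norm g :=
      l2Norm_mono fun x => (hGt n x).trans (truncate_le n g x)
    refine (form_le_of_finite hk ENNReal.ofReal_ne_top (fun x x' hx =>
      lintegral_poissonLine_correlation (hpos x) (hpos x') hx) (mG n) hg' ?_).trans (by gcongr)
    refine ne_top_of_le_ne_top (b := (n + 1) * (∫⁻ x, truncate n g x) * ∫⁻ x, truncate n g x)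
      (ENNReal.mul_ne_top (ENNReal.mul_ne_top (by finiteness) (lintegral_truncate_ne_top n g))
        (lintegral_truncate_ne_top n g)) ?_
    have mt := measurable_truncate n hg
    calc ∫⁻ x, ∫⁻ z, G n x * (k x z * G n z)
        ≤ ∫⁻ x, ∫⁻ z, ((n + 1) * truncate n g x) * truncate n g z := by
          refine lintegral_mono fun x => lintegral_mono fun z => ?_
          by_cases hx : 1 / (n + 1 : ℝ) ≤ a x
          · have : k x z ≤ n + 1 := by
              rw [← Nat.cast_succ, ← ENNReal.ofReal_natCast, Nat.cast_succ]
              refine ENNReal.ofReal_le_ofReal ?_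
              refine (poissonLine_le (hpos x) _).trans ?_
              rw [one_div_le (hpos x) (by positivity)]
              exact hx
            calc G n x * (k x z * G n z) ≤ truncate n g x * ((n + 1) * truncate n g z) := by
                  gcongr <;> exact hGt n _
              _ = _ := by ring
          · have : G n x = 0 := if_neg hx
            simp [this]
      _ = _ := by
          simp_rw [lintegral_const_mul _ mt]
          rw [lintegral_mul_const _ (by fun_prop), lintegral_const_mul _ mt]
  have mk : ∀ n, Measurable (Function.uncurry fun x z => G n x * (k x z * g' z)) := fun n =>
    ((mG n).comp measurable_fst).mul (hk.mul (hg'.comp measurable_snd))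
  have e : ∫⁻ x, ∫⁻ z, g x * (k x z * g' z) = ⨆ n, ∫⁻ x, ∫⁻ z, G n x * (k x z * g' z) := by
    rw [← lintegral_iSup (fun n => (mk n).lintegral_prod_right)]
    · refine lintegral_congr fun x => ?_
      rw [← lintegral_iSup (fun n => (mk n).of_uncurry_left)]
      · exact lintegral_congr fun z => by rw [← ENNReal.iSup_mul, hsup]
      · intro m n h z
        have := hmono h x
        simp only
        gcongr
    · intro m n h x
      refine lintegral_mono fun z => ?_
      have := hmono h x
      simp only
      gcongr
  rw [e]
  exact iSup_le key

/-- The kernel `(|y| / b) ^ σ / |y|` on `|y| ≤ b`. -/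
noncomputable def nearKernel (σ b y : ℝ) : ℝ := if |y| ≤ b then (|y| / b) ^ σ / |y| else 0

/-- The kernel `(a / |y|) ^ σ / |y|` on `a ≤ |y|`. -/
noncomputable def farKernel (σ a y : ℝ) : ℝ := if a ≤ |y| then (a / |y|) ^ σ / |y| else 0

theorem nearKernel_neg (σ b y : ℝ) : nearKernel σ b (-y) = nearKernel σ b y := by
  simp [nearKernel]

theorem measurable_nearKernel (σ : ℝ) : Measurable (Function.uncurry (nearKernel σ)) := by
  unfold nearKernel Function.uncurry
  exact Measurable.ite (measurableSet_le (by fun_prop) (by fun_prop)) (by fun_prop) (by fun_prop)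

theorem measurable_farKernel (σ : ℝ) : Measurable (Function.uncurry (farKernel σ)) := by
  unfold farKernel Function.uncurry
  exact Measurable.ite (measurableSet_le (by fun_prop) (by fun_prop)) (by fun_prop) (by fun_prop)

theorem inv_abs_le_poissonLine {c y : ℝ} (hc : 0 < c) (h1 : c ≤ 2 * |y|) (h2 : |y| ≤ 2 * c) :
    1 / |y| ≤ 10 * poissonLine c y := by
  have hy : 0 < |y| := by linarith
  unfold poissonLine
  rw [← mul_div_assoc, div_le_div_iff₀ hy (by positivity), ← sq_abs y]
  nlinarith

/-- The bound for the form of a kernel decaying like `2 ^ (-σ j)` at dyadic distance `j`. -/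
noncomputable def dyadicConst (σ : ℝ) : ℝ≥0∞ :=
  ∑' j : ℕ, ENNReal.ofReal (10 * ((2 : ℝ) ^ (-σ)) ^ j) * (2 * ENNReal.ofReal Real.pi)

theorem dyadicConst_ne_top {σ : ℝ} (hσ : 0 < σ) : dyadicConst σ ≠ ⊤ := by
  unfold dyadicConst
  have h1 : (2 : ℝ) ^ (-σ) < 1 := Real.rpow_lt_one_of_one_lt_of_neg (by norm_num) (by linarith)
  rw [ENNReal.tsum_mul_right]
  refine ENNReal.mul_ne_top ?_ (by finiteness)
  rw [← ENNReal.ofReal_tsum_of_nonneg (fun n => by positivity)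
    ((summable_geometric_of_lt_one (by positivity) h1).mul_left _)]
  exact ENNReal.ofReal_ne_top

theorem exists_dyadic {t : ℝ} (h0 : 0 < t) (h1 : t ≤ 1) :
    ∃ j : ℕ, (1 / 2 : ℝ) ^ (j + 1) < t ∧ t ≤ (1 / 2) ^ j :=
  exists_nat_pow_near_of_lt_one h0 h1 (by norm_num) (by norm_num)

theorem rpow_le_of_le_half_pow {t σ : ℝ} (hσ : 0 < σ) (h0 : 0 < t) {j : ℕ}
    (h : t ≤ (1 / 2 : ℝ) ^ j) : t ^ σ ≤ ((2 : ℝ) ^ (-σ)) ^ j := by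
  refine (Real.rpow_le_rpow h0.le h hσ.le).trans_eq ?_
  rw [← Real.rpow_natCast, ← Real.rpow_natCast, ← Real.rpow_mul (by norm_num),
    ← Real.rpow_mul (by norm_num), one_div, Real.inv_rpow (by norm_num), ← Real.rpow_neg (by norm_num)]
  congr 1; ring

theorem nearKernel_le {σ b y : ℝ} (hσ : 0 < σ) (hb : 0 < b) (hy : y ≠ 0) :
    ENNReal.ofReal (nearKernel σ b y) ≤ ∑' j : ℕ, ENNReal.ofReal (10 * ((2 : ℝ) ^ (-σ)) ^ j) *
      ENNReal.ofReal (poissonLine ((1 / 2) ^ j * b) y) := by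
  unfold nearKernel
  split_ifs with h
  · have hy' : 0 < |y| := abs_pos.2 hy
    obtain ⟨j, hj1, hj2⟩ := exists_dyadic (div_pos hy' hb) ((div_le_one hb).2 h)
    refine le_trans ?_ (ENNReal.le_tsum j)
    rw [← ENNReal.ofReal_mul (by positivity)]
    refine ENNReal.ofReal_le_ofReal ?_
    rw [lt_div_iff₀ hb, pow_succ] at hj1
    have := inv_abs_le_poissonLine (c := (1 / 2) ^ j * b) (y := y) (by positivity) (by linarith)
      (by rw [div_le_iff₀ hb] at hj2; nlinarith [hj2, hy'])
    calc (|y| / b) ^ σ / |y| = (|y| / b) ^ σ * (1 / |y|) := by ring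
      _ ≤ ((2 : ℝ) ^ (-σ)) ^ j * (10 * poissonLine ((1 / 2) ^ j * b) y) := by
          gcongr
          exact rpow_le_of_le_half_pow hσ (by positivity) hj2
      _ = _ := by ring
  · simp

theorem farKernel_le {σ a y : ℝ} (hσ : 0 < σ) (ha : 0 < a) :
    ENNReal.ofReal (farKernel σ a y) ≤ ∑' j : ℕ, ENNReal.ofReal (10 * ((2 : ℝ) ^ (-σ)) ^ j) *
      ENNReal.ofReal (poissonLine (2 ^ j * a) y) := by
  unfold farKernel
  split_ifs with h
  · have hy' : 0 < |y| := ha.trans_le h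
    obtain ⟨j, hj1, hj2⟩ := exists_dyadic (div_pos ha hy') ((div_le_one hy').2 h)
    refine le_trans ?_ (ENNReal.le_tsum j)
    rw [← ENNReal.ofReal_mul (by positivity)]
    refine ENNReal.ofReal_le_ofReal ?_
    have e : (2 : ℝ) ^ j * (1 / 2) ^ j = 1 := by rw [← mul_pow]; norm_num
    have h2 : (0 : ℝ) < 2 ^ j := by positivity
    rw [lt_div_iff₀ hy', pow_succ] at hj1
    rw [div_le_iff₀ hy'] at hj2
    have k1 := mul_lt_mul_of_pos_left hj1 h2
    have k2 := mul_le_mul_of_nonneg_left hj2 h2.le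
    have e1 : (2 : ℝ) ^ j * ((1 / 2) ^ j * (1 / 2) * |y|) = |y| / 2 := by
      linear_combination (|y| / 2) * e
    have e2 : (2 : ℝ) ^ j * ((1 / 2) ^ j * |y|) = |y| := by linear_combination |y| * e
    rw [e1] at k1
    rw [e2] at k2
    have := inv_abs_le_poissonLine (c := 2 ^ j * a) (y := y) (by positivity) (by linarith)
      (by linarith)
    rw [← div_le_iff₀ hy'] at hj2
    calc (a / |y|) ^ σ / |y| = (a / |y|) ^ σ * (1 / |y|) := by ring
      _ ≤ ((2 : ℝ) ^ (-σ)) ^ j * (10 * poissonLine (2 ^ j * a) y) := by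
          gcongr
          exact rpow_le_of_le_half_pow hσ (by positivity) hj2
      _ = _ := by ring
  · simp

theorem formBound_dyadic {σ : ℝ} {k : ℝ → ℝ → ℝ≥0∞} {a : ℕ → ℝ → ℝ} (ha : ∀ j, Measurable (a j))
    (hpos : ∀ j x, 0 < a j x)
    (hk : ∀ x z, x ≠ z → k x z ≤ ∑' j : ℕ, ENNReal.ofReal (10 * ((2 : ℝ) ^ (-σ)) ^ j) *
      ENNReal.ofReal (poissonLine (a j x) (x - z))) :
    FormBound k (dyadicConst σ) :=
  (FormBound.tsum (fun j => (measurable_poissonLine_comp (ha j)).const_mul _) fun j =>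
    (formBound_poissonLine (ha j) (hpos j)).const_mul
      (measurable_poissonLine_comp (ha j)) _).mono hk le_rfl

theorem formBound_nearKernel {σ : ℝ} (hσ : 0 < σ) {b : ℝ → ℝ} (hb : Measurable b)
    (hpos : ∀ x, 0 < b x) :
    FormBound (fun x z => ENNReal.ofReal (nearKernel σ (b x) (x - z))) (dyadicConst σ) :=
  formBound_dyadic (a := fun j x => (1 / 2) ^ j * b x) (fun j => hb.const_mul _)
    (fun j x => mul_pos (by positivity) (hpos x))
    fun x _ h => nearKernel_le hσ (hpos x) (sub_ne_zero.2 h)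

theorem formBound_farKernel {σ : ℝ} (hσ : 0 < σ) {a : ℝ → ℝ} (ha : Measurable a)
    (hpos : ∀ x, 0 < a x) :
    FormBound (fun x z => ENNReal.ofReal (farKernel σ (a x) (x - z))) (dyadicConst σ) :=
  formBound_dyadic (a := fun j x => 2 ^ j * a x) (fun j => ha.const_mul _)
    (fun j x => mul_pos (by positivity) (hpos x)) fun x _ _ => farKernel_le hσ (hpos x)

theorem l2Norm_enorm_sq {U : ℝ → ℂ} (hU : Integrable fun x => ‖U x‖ ^ 2) :
    l2Norm (fun x => ‖U x‖ₑ) ^ 2 = ‖∫ x, ((‖U x‖ ^ 2 : ℝ) : ℂ)‖ₑ := by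
  rw [integral_complex_ofReal, l2Norm_sq, ← ofReal_norm, Complex.norm_real,
    Real.norm_of_nonneg (integral_nonneg fun _ => by positivity),
    ofReal_integral_eq_lintegral_ofReal hU (Eventually.of_forall fun _ => by positivity)]
  exact lintegral_congr fun w => by
    rw [← ofReal_norm, ENNReal.ofReal_pow (norm_nonneg _)]

section TTStar

variable {ι : Type*} [Finite ι] [MeasurableSpace ι] [MeasurableSingletonClass ι]

theorem measurable_kernel_comp {κ : ι → ℝ → ℂ} (hm : ∀ n, Measurable (κ n)) {i : ℝ → ι}
    (hi : Measurable i) : Measurable fun p : ℝ × ℝ => κ (i p.1) (p.1 - p.2) :=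
  (measurable_from_prod_countable_right (f := fun q : ι × ℝ => κ q.1 q.2) hm).comp
    (f := fun p : ℝ × ℝ => (i p.1, p.1 - p.2))
    ((hi.comp measurable_fst).prodMk (by fun_prop))

theorem measurable_linearised {κ : ι → ℝ → ℂ} (hm : ∀ n, Measurable (κ n)) {i : ℝ → ι}
    (hi : Measurable i) {f : ℝ → ℂ} (hf : Measurable f) :
    Measurable fun x => ∫ w, κ (i x) (x - w) * f w :=
  (StronglyMeasurable.integral_prod_right' (f := fun p : ℝ × ℝ => κ (i p.1) (p.1 - p.2) * f p.2)
    ((measurable_kernel_comp hm hi).mul (hf.comp measurable_snd)).stronglyMeasurable).measurable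

/-- The dual half of the `TT*` argument: the adjoint of a linearised maximal operator. -/
theorem l2Norm_adjoint_sq_le {κ : ι → ℝ → ℂ} (hm : ∀ n, Measurable (κ n))
    (hint : ∀ n, Integrable (κ n)) {M : ℝ} (hbd : ∀ n y, ‖κ n y‖ ≤ M)
    {L : ι → ℝ → ℝ≥0∞} (hLm : ∀ n, Measurable (L n)) (hLe : ∀ n h, L n (-h) = L n h)
    (hL : ∀ m n h, h ≠ 0 → ‖∫ y, κ m y * (starRingEnd ℂ) (κ n (y + h))‖ₑ ≤ L m h + L n h)
    {i : ℝ → ι} (hi : Measurable i) {B : ℝ≥0∞} (hB : FormBound (fun x z => L (i x) (x - z)) B)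
    {g : ℝ → ℂ} (hg : Measurable g) (hgi : Integrable g) :
    l2Norm (fun w => ‖∫ x, g x * κ (i x) (x - w)‖ₑ) ^ 2 ≤ 2 * B * l2Norm (fun x => ‖g x‖ₑ) ^ 2 := by
  set a : ℝ → ℝ → ℂ := fun x w => g x * κ (i x) (x - w)
  set U : ℝ → ℂ := fun w => ∫ x, a x w
  have ma : Measurable (Function.uncurry a) :=
    (hg.comp measurable_fst).mul (measurable_kernel_comp hm hi)
  have mU : Measurable U := (StronglyMeasurable.integral_prod_left'
    (f := Function.uncurry a) ma.stronglyMeasurable).measurable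
  obtain ⟨K, hK⟩ : ∃ K, ∀ n, ∫ y, ‖κ n y‖ ≤ K := by
    cases nonempty_fintype ι
    exact ⟨∑ n, ∫ y, ‖κ n y‖, fun n => Finset.single_le_sum
      (f := fun n => ∫ y, ‖κ n y‖) (fun _ _ => integral_nonneg fun _ => norm_nonneg _)
      (Finset.mem_univ n)⟩
  have hκi : ∀ x, Integrable fun w => κ (i x) (x - w) := fun x => (hint (i x)).comp_sub_left x
  have ia : Integrable (Function.uncurry a) (volume.prod volume) := by
    rw [integrable_prod_iff ma.aestronglyMeasurable]
    refine ⟨Eventually.of_forall fun x => (hκi x).const_mul (g x), ?_⟩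
    refine (hgi.norm.mul_const K).mono' ?_ (Eventually.of_forall fun x => ?_)
    · exact ma.norm.stronglyMeasurable.integral_prod_right'.aestronglyMeasurable
    · rw [Real.norm_of_nonneg (integral_nonneg fun _ => norm_nonneg _)]
      simp only [Function.uncurry, a, norm_mul]
      rw [integral_const_mul, integral_sub_left_eq_self (fun y => ‖κ (i x) y‖)]
      gcongr
      exact hK _
  have hab : ∀ x w, ‖a x w‖ ≤ ‖g x‖ * M := fun x w => by
    simp only [a, norm_mul]; gcongr; exact hbd _ _
  have hUb : ∀ w, ‖U w‖ ≤ ∫ x, ‖g x‖ * M := fun w =>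
    norm_integral_le_of_norm_le (hgi.norm.mul_const M) (Eventually.of_forall fun x => hab x w)
  have iU : Integrable U := ia.integral_prod_right
  have iUU : Integrable fun w => U w * (starRingEnd ℂ) (U w) :=
    iU.mul_bdd (c := ∫ x, ‖g x‖ * M) (Complex.continuous_conj.measurable.comp mU).aestronglyMeasurable
      (Eventually.of_forall fun w => by simpa using hUb w)
  have e1 : l2Norm (fun w => ‖U w‖ₑ) ^ 2 = ‖∫ w, U w * (starRingEnd ℂ) (U w)‖ₑ := by
    have : ∀ w, U w * (starRingEnd ℂ) (U w) = ((‖U w‖ ^ 2 : ℝ) : ℂ) := fun w => by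
      rw [Complex.mul_conj, Complex.normSq_eq_norm_sq]
    simp_rw [this] at iUU ⊢
    exact l2Norm_enorm_sq iUU.re
  have e2 : ∫ w, U w * (starRingEnd ℂ) (U w)
      = ∫ x, ∫ z, ∫ w, a x w * (starRingEnd ℂ) (a z w) := by
    calc ∫ w, U w * (starRingEnd ℂ) (U w) = ∫ w, ∫ x, a x w * (starRingEnd ℂ) (U w) :=
          integral_congr_ae (Eventually.of_forall fun w => (integral_mul_const _ _).symm)
      _ = ∫ x, ∫ w, a x w * (starRingEnd ℂ) (U w) := by
          refine (integral_integral_swap ?_).symm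
          exact ia.mul_bdd (c := ∫ x, ‖g x‖ * M)
            (Complex.continuous_conj.measurable.comp (mU.comp measurable_snd)).aestronglyMeasurable
            (Eventually.of_forall fun p => by simpa using hUb p.2)
      _ = ∫ x, ∫ w, ∫ z, a x w * (starRingEnd ℂ) (a z w) := by
          congr 1; ext x; congr 1; ext w
          rw [integral_const_mul, integral_conj]
      _ = _ := by
          congr 1; ext x
          refine (integral_integral_swap (f := fun z w => a x w * (starRingEnd ℂ) (a z w)) ?_).symm
          have : Integrable (fun p : ℝ × ℝ => (starRingEnd ℂ) (Function.uncurry a p))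
            (volume.prod volume) := by
            refine ia.norm.mono' (Complex.continuous_conj.measurable.comp ma).aestronglyMeasurable ?_
            exact Eventually.of_forall fun p => by simp
          exact this.bdd_mul (c := ‖g x‖ * M)
            (ma.comp (measurable_const.prodMk measurable_snd) :
              Measurable fun p : ℝ × ℝ => Function.uncurry a (x, p.2)).aestronglyMeasurable
            (Eventually.of_forall fun p => hab x p.2)
  have e3 : ∀ x z, x ≠ z → ‖∫ w, a x w * (starRingEnd ℂ) (a z w)‖ₑ ≤
      ‖g x‖ₑ * (L (i x) (x - z) * ‖g z‖ₑ) + ‖g z‖ₑ * (L (i z) (z - x) * ‖g x‖ₑ) := by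
    intro x z hxz
    have : ∫ w, a x w * (starRingEnd ℂ) (a z w) = g x * (starRingEnd ℂ) (g z) *
        ∫ y, κ (i x) y * (starRingEnd ℂ) (κ (i z) (y + (z - x))) := by
      rw [← integral_const_mul, ← integral_sub_left_eq_self _ volume x]
      congr 1; ext w
      simp only [a, map_mul]
      rw [show x - (x - w) = w by ring, show z - (x - w) = w + (z - x) by ring]
      ring
    rw [this, enorm_mul, enorm_mul, RCLike.enorm_conj]
    calc _ ≤ ‖g x‖ₑ * ‖g z‖ₑ * (L (i x) (z - x) + L (i z) (z - x)) := by
          gcongr; exact hL _ _ _ (sub_ne_zero.2 hxz.symm)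
      _ = _ := by rw [← neg_sub x z, hLe, ← neg_sub z x, hLe, hLe]; ring
  have mg : Measurable fun x => ‖g x‖ₑ := hg.enorm
  have mL : Measurable (Function.uncurry fun x z => L (i x) (x - z)) :=
    (measurable_from_prod_countable_right (f := fun q : ι × ℝ => L q.1 q.2) hLm).comp
      (f := fun p : ℝ × ℝ => (i p.1, p.1 - p.2)) ((hi.comp measurable_fst).prodMk (by fun_prop))
  have m1 : Measurable (Function.uncurry fun x z => ‖g x‖ₑ * (L (i x) (x - z) * ‖g z‖ₑ)) :=
    (mg.comp measurable_fst).mul (mL.mul (mg.comp measurable_snd))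
  have m2 : Measurable (Function.uncurry fun x z => ‖g z‖ₑ * (L (i z) (z - x) * ‖g x‖ₑ)) :=
    m1.comp measurable_swap
  rw [e1, e2]
  calc _ ≤ ∫⁻ x, ∫⁻ z, ‖∫ w, a x w * (starRingEnd ℂ) (a z w)‖ₑ :=
        (enorm_integral_le_lintegral_enorm _).trans
          (lintegral_mono fun x => enorm_integral_le_lintegral_enorm _)
    _ ≤ ∫⁻ x, ∫⁻ z, (‖g x‖ₑ * (L (i x) (x - z) * ‖g z‖ₑ)
          + ‖g z‖ₑ * (L (i z) (z - x) * ‖g x‖ₑ)) := by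
        refine lintegral_mono fun x => lintegral_mono_ae ?_
        filter_upwards [Measure.ae_ne volume x] with z hz using e3 x z hz.symm
    _ = (∫⁻ x, ∫⁻ z, ‖g x‖ₑ * (L (i x) (x - z) * ‖g z‖ₑ))
          + ∫⁻ x, ∫⁻ z, ‖g x‖ₑ * (L (i x) (x - z) * ‖g z‖ₑ) := by
        simp_rw [lintegral_add_left (m1.of_uncurry_left (x := _))]
        rw [lintegral_add_left m1.lintegral_prod_right]
        congr 1
        rw [lintegral_lintegral_swap m2.aemeasurable]
    _ ≤ B * (l2Norm (fun x => ‖g x‖ₑ) * l2Norm (fun x => ‖g x‖ₑ))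
          + B * (l2Norm (fun x => ‖g x‖ₑ) * l2Norm (fun x => ‖g x‖ₑ)) :=
        add_le_add (hB _ _ mg mg) (hB _ _ mg mg)
    _ = _ := by ring

/-- The `TT*` bound for a maximal operator linearised by a measurable choice `i` of the kernel. -/
theorem l2Norm_linearised_sq_le {κ : ι → ℝ → ℂ} (hm : ∀ n, Measurable (κ n))
    (hint : ∀ n, Integrable (κ n)) (hbd : ∀ n, ∃ M, ∀ y, ‖κ n y‖ ≤ M)
    {L : ι → ℝ → ℝ≥0∞} (hLm : ∀ n, Measurable (L n)) (hLe : ∀ n h, L n (-h) = L n h)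
    (hL : ∀ m n h, h ≠ 0 → ‖∫ y, κ m y * (starRingEnd ℂ) (κ n (y + h))‖ₑ ≤ L m h + L n h)
    {i : ℝ → ι} (hi : Measurable i) {B : ℝ≥0∞} (hB : FormBound (fun x z => L (i x) (x - z)) B)
    {f : ℝ → ℂ} (hf : Measurable f) (hfi : Integrable f) :
    l2Norm (fun x => ‖∫ w, κ (i x) (x - w) * f w‖ₑ) ^ 2 ≤
      2 * B * l2Norm (fun x => ‖f x‖ₑ) ^ 2 := by
  obtain ⟨M, hM⟩ : ∃ M, ∀ n y, ‖κ n y‖ ≤ M := by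
    cases nonempty_fintype ι
    choose M hM using hbd
    exact ⟨∑ n, |M n|, fun n y => (hM n y).trans ((le_abs_self _).trans
      (Finset.single_le_sum (f := fun n => |M n|) (fun _ _ => abs_nonneg _) (Finset.mem_univ n)))⟩
  set F : ℝ → ℂ := fun x => ∫ w, κ (i x) (x - w) * f w
  have mF : Measurable F := measurable_linearised hm hi hf
  have hFb : ∀ x, ‖F x‖ ≤ ∫ w, M * ‖f w‖ := fun x =>
    norm_integral_le_of_norm_le (hfi.norm.const_mul M) (Eventually.of_forall fun w => by
      rw [norm_mul]; gcongr; exact hM _ _)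
  have key : ∀ n : ℕ, l2Norm ((Set.Icc (-n : ℝ) n).indicator fun x => ‖F x‖ₑ) ^ 2 ≤
      2 * B * l2Norm (fun x => ‖f x‖ₑ) ^ 2 := by
    intro n
    set g : ℝ → ℂ := (Set.Icc (-n : ℝ) n).indicator fun x => (starRingEnd ℂ) (F x)
    have eg : ((Set.Icc (-n : ℝ) n).indicator fun x => ‖F x‖ₑ) = fun x => ‖g x‖ₑ := by
      ext x
      simp only [g, enorm_indicator_eq_indicator_enorm, RCLike.enorm_conj]
    have mg : Measurable g :=
      (Complex.continuous_conj.measurable.comp mF).indicator measurableSet_Icc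
    have hgb : ∀ x, ‖g x‖ ≤ ∫ w, M * ‖f w‖ := fun x =>
      (norm_indicator_le_norm_self _ _).trans (by simpa using hFb x)
    have ig : Integrable g := by
      refine IntegrableOn.integrable_indicator ?_ measurableSet_Icc
      exact Measure.integrableOn_of_bounded (M := ∫ w, M * ‖f w‖) (by simp)
        (Complex.continuous_conj.measurable.comp mF).aestronglyMeasurable
        (Eventually.of_forall fun x => by simpa using hFb x)
    rw [eg]
    set N := l2Norm fun x => ‖g x‖ₑ
    set U : ℝ → ℂ := fun w => ∫ x, g x * κ (i x) (x - w)
    have mU : Measurable U := (StronglyMeasurable.integral_prod_left'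
      (f := fun p : ℝ × ℝ => g p.1 * κ (i p.1) (p.1 - p.2))
      ((mg.comp measurable_fst).mul (measurable_kernel_comp hm hi)).stronglyMeasurable).measurable
    have hU : l2Norm (fun w => ‖U w‖ₑ) ^ 2 ≤ 2 * B * N ^ 2 :=
      l2Norm_adjoint_sq_le hm hint hM hLm hLe hL hi hB mg ig
    have hN : N ≠ ⊤ := by
      have h2 : N ^ 2 ≠ ⊤ := by
        rw [l2Norm_sq]
        have := ig.norm.bdd_mul (c := ∫ w, M * ‖f w‖) mg.norm.aestronglyMeasurable
          (Eventually.of_forall fun x => by simpa using hgb x)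
        refine ne_top_of_le_ne_top this.2.ne (lintegral_mono fun x => ?_)
        simp [sq]
      exact fun h => h2 (by simp [h])
    have e : N ^ 2 = ‖∫ x, g x * F x‖ₑ := by
      have e0 : ∀ x, g x * F x = ((‖g x‖ ^ 2 : ℝ) : ℂ) := fun x => by
        simp only [g, Set.indicator]
        split_ifs
        · rw [mul_comm, Complex.mul_conj, Complex.normSq_eq_norm_sq, RCLike.norm_conj]
        · simp
      have iR : Integrable fun w => ‖g w‖ ^ 2 := by
        have := ig.norm.bdd_mul (c := ∫ w, M * ‖f w‖) mg.norm.aestronglyMeasurable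
          (Eventually.of_forall fun x => by simpa using hgb x)
        simpa [sq] using this
      simp_rw [e0]
      exact l2Norm_enorm_sq iR
    have e' : ∫ x, g x * F x = ∫ w, U w * f w := by
      calc ∫ x, g x * F x = ∫ x, ∫ w, g x * κ (i x) (x - w) * f w := by
            congr 1; ext x
            rw [← integral_const_mul]
            congr 1; ext w; ring
        _ = ∫ w, ∫ x, g x * κ (i x) (x - w) * f w := by
            refine integral_integral_swap ?_
            have := (ig.mul_prod hfi).norm.const_mul M
            refine this.mono' ?_ (Eventually.of_forall fun p => ?_)
            · exact (((mg.comp measurable_fst).mul (measurable_kernel_comp hm hi)).mul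
                (hf.comp measurable_snd)).aestronglyMeasurable
            · simp only [Function.uncurry, norm_mul]
              calc _ ≤ ‖g p.1‖ * M * ‖f p.2‖ := by gcongr; exact hM _ _
                _ = _ := by ring
        _ = _ := by
            congr 1; ext w
            rw [integral_mul_const]
    have h1 : N ^ 2 ≤ l2Norm (fun w => ‖U w‖ₑ) * l2Norm (fun x => ‖f x‖ₑ) := by
      rw [e, e']
      refine (enorm_integral_le_lintegral_enorm _).trans ?_
      simp_rw [enorm_mul]
      exact lintegral_mul_le_l2Norm mU.enorm hf.enorm
    refine le_of_sq_le_mul (ENNReal.pow_ne_top hN) ?_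
    calc (N ^ 2) ^ 2 ≤ (l2Norm (fun w => ‖U w‖ₑ) * l2Norm (fun x => ‖f x‖ₑ)) ^ 2 := by gcongr
      _ = l2Norm (fun w => ‖U w‖ₑ) ^ 2 * l2Norm (fun x => ‖f x‖ₑ) ^ 2 := mul_pow _ _ _
      _ ≤ 2 * B * N ^ 2 * l2Norm (fun x => ‖f x‖ₑ) ^ 2 := by gcongr
      _ = _ := by ring
  have hs : ∀ x, (⨆ n : ℕ, (Set.Icc (-n : ℝ) n).indicator (fun x => ‖F x‖ₑ) x) = ‖F x‖ₑ := by
    intro x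
    refine le_antisymm (iSup_le fun n => Set.indicator_le_self _ _ _) ?_
    obtain ⟨n, hn⟩ := exists_nat_ge |x|
    refine le_trans ?_ (le_iSup _ n)
    rw [Set.indicator_of_mem (Set.mem_Icc.2 (abs_le.1 hn))]
  have hmono : Monotone fun (n : ℕ) => (Set.Icc (-n : ℝ) n).indicator fun x => ‖F x‖ₑ := by
    intro m n h x
    have h' : (m : ℝ) ≤ n := by exact_mod_cast h
    exact Set.indicator_le_indicator_of_subset (Set.Icc_subset_Icc (by linarith) h')
      (fun _ => zero_le) x
  have := l2Norm_iSup (B := (2 * B * l2Norm (fun x => ‖f x‖ₑ) ^ 2) ^ (1 / 2 : ℝ))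
    (fun n => mF.enorm.indicator measurableSet_Icc) hmono (fun n => by
      have h := ENNReal.rpow_le_rpow (key n) (z := 1 / 2) (by norm_num)
      rw [← ENNReal.rpow_natCast, ← ENNReal.rpow_mul] at h
      norm_num at h ⊢
      exact h)
  simp_rw [hs] at this
  calc _ ≤ ((2 * B * l2Norm (fun x => ‖f x‖ₑ) ^ 2) ^ (1 / 2 : ℝ)) ^ 2 := by gcongr
    _ = _ := by
      rw [← ENNReal.rpow_natCast, ← ENNReal.rpow_mul]
      norm_num

end TTStar

section VanDerCorput

variable {c d : ℝ} {φ G G' α α' w : ℝ → ℝ}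

/-- First derivative test, for a phase with derivative `w G` and an amplitude `α w`, where `G` is
monotone and bounded away from zero. -/
theorem norm_integral_exp_le_of_le_abs {l M M' M₁ : ℝ} (hcd : c ≤ d)
    (hφ : ∀ p ∈ Set.Icc c d, HasDerivAt φ (w p * G p) p)
    (hG : ∀ p ∈ Set.Icc c d, HasDerivAt G (G' p) p)
    (hα : ∀ p ∈ Set.Icc c d, HasDerivAt α (α' p) p)
    (cG : ContinuousOn G' (Set.Icc c d)) (cα : ContinuousOn α' (Set.Icc c d))
    (cw : ContinuousOn w (Set.Icc c d)) (hG0 : ∀ p ∈ Set.Icc c d, 0 ≤ G' p) (hl : 0 < l)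
    (hGl : (∀ p ∈ Set.Icc c d, l ≤ G p) ∨ ∀ p ∈ Set.Icc c d, G p ≤ -l)
    (hM : ∀ p ∈ Set.Icc c d, |α p| ≤ M) (hM' : ∀ p ∈ Set.Icc c d, |α' p| ≤ M')
    (hM₁ : M' * (d - c) ≤ M₁) :
    ‖∫ p in c..d, Complex.exp (Complex.I * (φ p : ℂ)) * ((α p * w p : ℝ) : ℂ)‖
      ≤ (3 * M + M₁) / l := by
  have hu : Set.uIcc c d = Set.Icc c d := Set.uIcc_of_le hcd
  have hGa : ∀ p ∈ Set.Icc c d, l ≤ |G p| := fun p hp => by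
    rcases hGl with h | h
    · exact (h p hp).trans (le_abs_self _)
    · exact (le_neg.1 (h p hp)).trans (neg_le_abs _)
  have hGne : ∀ p ∈ Set.Icc c d, G p ≠ 0 := fun p hp => abs_pos.1 (hl.trans_le (hGa p hp))
  have mc : c ∈ Set.Icc c d := Set.left_mem_Icc.2 hcd
  have md : d ∈ Set.Icc c d := Set.right_mem_Icc.2 hcd
  have hM0 : 0 ≤ M := (abs_nonneg _).trans (hM c mc)
  have cGc : ContinuousOn G (Set.Icc c d) := fun p hp => (hG p hp).continuousAt.continuousWithinAt
  have cαc : ContinuousOn α (Set.Icc c d) := fun p hp => (hα p hp).continuousAt.continuousWithinAt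
  have cφ : ContinuousOn φ (Set.Icc c d) := fun p hp => (hφ p hp).continuousAt.continuousWithinAt
  set E : ℝ → ℂ := fun p => Complex.exp (Complex.I * (φ p : ℂ))
  have nE : ∀ p, ‖E p‖ = 1 := fun p => by
    simp only [E]; rw [mul_comm]; exact Complex.norm_exp_ofReal_mul_I _
  have cE : ContinuousOn E (Set.Icc c d) :=
    Complex.continuous_exp.comp_continuousOn
      (continuousOn_const.mul (Complex.continuous_ofReal.comp_continuousOn cφ))
  set V : ℝ → ℝ := fun p => α p / G p
  set V' : ℝ → ℝ := fun p => (α' p * G p - α p * G' p) / G p ^ 2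
  have dV : ∀ p ∈ Set.Icc c d, HasDerivAt V (V' p) p := fun p hp =>
    (hα p hp).div (hG p hp) (hGne p hp)
  have cV' : ContinuousOn V' (Set.Icc c d) :=
    ((cα.mul cGc).sub (cαc.mul cG)).div (cGc.pow 2) fun p hp => pow_ne_zero 2 (hGne p hp)
  have dE : ∀ p ∈ Set.Icc c d, HasDerivAt E (Complex.I * (w p * G p : ℝ) * E p) p := fun p hp => by
    have := ((hφ p hp).ofReal_comp.const_mul Complex.I).cexp
    refine this.congr_deriv ?_
    simp only [E]; ring
  have i1 : IntervalIntegrable (fun p => E p * ((α p * w p : ℝ) : ℂ)) volume c d :=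
    ContinuousOn.intervalIntegrable (by
      rw [hu]; exact cE.mul (Complex.continuous_ofReal.comp_continuousOn (cαc.mul cw)))
  have i2 : IntervalIntegrable (fun p => E p * (V' p : ℂ)) volume c d :=
    ContinuousOn.intervalIntegrable (by
      rw [hu]; exact cE.mul (Complex.continuous_ofReal.comp_continuousOn cV'))
  have ftc : ∫ p in c..d, (Complex.I * (E p * ((α p * w p : ℝ) : ℂ)) + E p * (V' p : ℂ))
      = E d * V d - E c * V c := by
    refine intervalIntegral.integral_eq_sub_of_hasDerivAt (f := fun p => E p * (V p : ℂ)) ?_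
      ((i1.const_mul _).add i2)
    intro p hp
    rw [hu] at hp
    refine ((dE p hp).mul (dV p hp).ofReal_comp).congr_deriv ?_
    have : (G p : ℂ) ≠ 0 := by exact_mod_cast hGne p hp
    simp only [V]
    push_cast
    field_simp
  rw [intervalIntegral.integral_add (i1.const_mul _) i2, intervalIntegral.integral_const_mul] at ftc
  have nV : ∀ p ∈ Set.Icc c d, ‖E p * (V p : ℂ)‖ ≤ M / l := fun p hp => by
    rw [norm_mul, nE, one_mul, Complex.norm_real, Real.norm_eq_abs, abs_div]
    exact div_le_div₀ hM0 (hM p hp) hl (hGa p hp)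
  have nV' : ‖∫ p in c..d, E p * (V' p : ℂ)‖ ≤ (M + M₁) / l := by
    have cq : ContinuousOn (fun p => G' p / G p ^ 2) (Set.Icc c d) :=
      cG.div (cGc.pow 2) fun p hp => pow_ne_zero 2 (hGne p hp)
    have iq : IntervalIntegrable (fun p => G' p / G p ^ 2) volume c d :=
      ContinuousOn.intervalIntegrable (by rwa [hu])
    have eq : ∫ p in c..d, G' p / G p ^ 2 = -(G d)⁻¹ - -(G c)⁻¹ := by
      refine intervalIntegral.integral_eq_sub_of_hasDerivAt (f := fun p => -(G p)⁻¹) ?_ iq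
      intro p hp
      rw [hu] at hp
      refine ((hG p hp).inv (hGne p hp)).neg.congr_deriv ?_
      ring
    have le : -(G d)⁻¹ - -(G c)⁻¹ ≤ 1 / l := by
      have h1 : ∀ p, l ≤ G p → 0 < (G p)⁻¹ ∧ (G p)⁻¹ ≤ 1 / l := fun p hp =>
        ⟨inv_pos.2 (hl.trans_le hp), by rw [one_div]; gcongr⟩
      have h2 : ∀ p, G p ≤ -l → 0 < -(G p)⁻¹ ∧ -(G p)⁻¹ ≤ 1 / l := fun p hp => by
        rw [← inv_neg]
        exact ⟨inv_pos.2 (by linarith), by rw [one_div]; gcongr; linarith⟩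
      rcases hGl with h | h
      · linarith [(h1 c (h c mc)).2, (h1 d (h d md)).1]
      · linarith [(h2 c (h c mc)).1, (h2 d (h d md)).2]
    calc ‖∫ p in c..d, E p * (V' p : ℂ)‖ ≤ ∫ p in c..d, (M' / l + M * (G' p / G p ^ 2)) := by
          refine intervalIntegral.norm_integral_le_of_norm_le hcd ?_
            (intervalIntegrable_const.add (iq.const_mul M))
          refine Eventually.of_forall fun p hp => ?_
          have hp := Set.Ioc_subset_Icc_self hp
          rw [norm_mul, nE, one_mul, Complex.norm_real, Real.norm_eq_abs]
          have : V' p = α' p / G p - α p * (G' p / G p ^ 2) := by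
            simp only [V']
            have := hGne p hp
            field_simp
          rw [this]
          refine (abs_sub _ _).trans (add_le_add ?_ ?_)
          · rw [abs_div]
            exact div_le_div₀ ((abs_nonneg _).trans (hM' p hp)) (hM' p hp) hl (hGa p hp)
          · rw [abs_mul, abs_of_nonneg (div_nonneg (hG0 p hp) (sq_nonneg (G p)))]
            exact mul_le_mul_of_nonneg_right (hM p hp) (div_nonneg (hG0 p hp) (sq_nonneg _))
      _ = M' * (d - c) / l + M * (-(G d)⁻¹ - -(G c)⁻¹) := by
          rw [intervalIntegral.integral_add intervalIntegrable_const (iq.const_mul M),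
            intervalIntegral.integral_const, intervalIntegral.integral_const_mul, eq, smul_eq_mul]
          ring
      _ ≤ M₁ / l + M * (1 / l) := by gcongr
      _ = _ := by ring
  have e : Complex.I * ∫ p in c..d, E p * ((α p * w p : ℝ) : ℂ)
      = E d * V d - E c * V c - ∫ p in c..d, E p * (V' p : ℂ) := by
    rw [← ftc]; ring
  calc ‖∫ p in c..d, E p * ((α p * w p : ℝ) : ℂ)‖
      = ‖Complex.I * ∫ p in c..d, E p * ((α p * w p : ℝ) : ℂ)‖ := by simp
    _ ≤ M / l + M / l + (M + M₁) / l := by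
        rw [e]
        exact (norm_sub_le _ _).trans (add_le_add ((norm_sub_le _ _).trans
          (add_le_add (nV d md) (nV c mc))) nV')
    _ = _ := by ring

theorem exists_sign_change (hcd : c ≤ d) (hG : ContinuousOn G (Set.Icc c d))
    (hmono : MonotoneOn G (Set.Icc c d)) :
    ∃ p₀ ∈ Set.Icc c d, (∀ p ∈ Set.Icc c d, p < p₀ → G p ≤ 0 ∧ G p₀ ≤ 0) ∧
      ∀ p ∈ Set.Icc c d, p₀ < p → 0 ≤ G p ∧ 0 ≤ G p₀ := by
  have mc : c ∈ Set.Icc c d := Set.left_mem_Icc.2 hcd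
  have md : d ∈ Set.Icc c d := Set.right_mem_Icc.2 hcd
  by_cases h1 : 0 ≤ G c
  · exact ⟨c, mc, fun p hp h => absurd hp.1 (not_le.2 h), fun p hp _ =>
      ⟨h1.trans (hmono mc hp hp.1), h1⟩⟩
  by_cases h2 : G d ≤ 0
  · exact ⟨d, md, fun p hp _ => ⟨(hmono hp md hp.2).trans h2, h2⟩,
      fun p hp h => absurd hp.2 (not_le.2 h)⟩
  obtain ⟨p₀, hp₀, h0⟩ := intermediate_value_Icc hcd hG
    (Set.mem_Icc.2 ⟨(not_le.1 h1).le, (not_le.1 h2).le⟩)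
  exact ⟨p₀, hp₀, fun p hp h => ⟨h0 ▸ hmono hp hp₀ h.le, h0.le⟩,
    fun p hp h => ⟨h0 ▸ hmono hp₀ hp h.le, h0.ge⟩⟩

/-- Second derivative test, for a phase with derivative `w G` and an amplitude `α w`, where the
derivative of `G` is bounded below. -/
theorem norm_integral_exp_le_of_le_deriv {μ η M M' M₁ Ψ : ℝ} (hcd : c ≤ d)
    (hφ : ∀ p ∈ Set.Icc c d, HasDerivAt φ (w p * G p) p)
    (hG : ∀ p ∈ Set.Icc c d, HasDerivAt G (G' p) p)
    (hα : ∀ p ∈ Set.Icc c d, HasDerivAt α (α' p) p)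
    (cG : ContinuousOn G' (Set.Icc c d)) (cα : ContinuousOn α' (Set.Icc c d))
    (cw : ContinuousOn w (Set.Icc c d)) (hμ : 0 < μ) (hη : 0 < η)
    (hG0 : ∀ p ∈ Set.Icc c d, μ ≤ G' p)
    (hM : ∀ p ∈ Set.Icc c d, |α p| ≤ M) (hM' : ∀ p ∈ Set.Icc c d, |α' p| ≤ M')
    (hM₁ : M' * (d - c) ≤ M₁) (hΨ : ∀ p ∈ Set.Icc c d, |α p * w p| ≤ Ψ) :
    ‖∫ p in c..d, Complex.exp (Complex.I * (φ p : ℂ)) * ((α p * w p : ℝ) : ℂ)‖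
      ≤ 2 * η * Ψ + 2 * ((3 * M + M₁) / (μ * η)) := by
  have mc : c ∈ Set.Icc c d := Set.left_mem_Icc.2 hcd
  have cGc : ContinuousOn G (Set.Icc c d) := fun p hp => (hG p hp).continuousAt.continuousWithinAt
  have cαc : ContinuousOn α (Set.Icc c d) := fun p hp => (hα p hp).continuousAt.continuousWithinAt
  have cφ : ContinuousOn φ (Set.Icc c d) := fun p hp => (hφ p hp).continuousAt.continuousWithinAt
  have growth : ∀ p ∈ Set.Icc c d, ∀ q ∈ Set.Icc c d, p ≤ q → μ * (q - p) ≤ G q - G p := by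
    refine (convex_Icc c d).mul_sub_le_image_sub_of_le_deriv cGc ?_ ?_
    · exact fun p hp => (hG p (interior_subset hp)).differentiableAt.differentiableWithinAt
    · intro p hp
      rw [(hG p (interior_subset hp)).deriv]
      exact hG0 p (interior_subset hp)
  have hmono : MonotoneOn G (Set.Icc c d) := fun p hp q hq h => by
    have := growth p hp q hq h
    nlinarith [mul_nonneg hμ.le (sub_nonneg.2 h)]
  obtain ⟨p₀, hp₀, hneg, hpos⟩ := exists_sign_change hcd cGc hmono
  have hM0 : 0 ≤ M := (abs_nonneg _).trans (hM c mc)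
  have hM'0 : 0 ≤ M' := (abs_nonneg _).trans (hM' c mc)
  have hΨ0 : 0 ≤ Ψ := (abs_nonneg _).trans (hΨ c mc)
  have hM₁0 : 0 ≤ M₁ := (mul_nonneg hM'0 (sub_nonneg.2 hcd)).trans hM₁
  set F : ℝ → ℂ := fun p => Complex.exp (Complex.I * (φ p : ℂ)) * ((α p * w p : ℝ) : ℂ)
  have cF : ContinuousOn F (Set.Icc c d) :=
    (Complex.continuous_exp.comp_continuousOn
      (continuousOn_const.mul (Complex.continuous_ofReal.comp_continuousOn cφ))).mul
      (Complex.continuous_ofReal.comp_continuousOn (cαc.mul cw))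
  have iF : ∀ a ∈ Set.Icc c d, ∀ b ∈ Set.Icc c d, IntervalIntegrable F volume a b :=
    fun a ha b hb => (cF.mono (Set.uIcc_subset_Icc ha hb)).intervalIntegrable
  set a := max c (p₀ - η)
  set b := min d (p₀ + η)
  have hap : a ≤ p₀ := max_le hp₀.1 (by linarith)
  have hpb : p₀ ≤ b := le_min hp₀.2 (by linarith)
  have ha : a ∈ Set.Icc c d := ⟨le_max_left _ _, hap.trans hp₀.2⟩
  have hb : b ∈ Set.Icc c d := ⟨hp₀.1.trans hpb, min_le_left _ _⟩
  have md : d ∈ Set.Icc c d := Set.right_mem_Icc.2 hcd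
  have hR : 0 ≤ (3 * M + M₁) / (μ * η) := by positivity
  have part : ∀ a' b', a' ∈ Set.Icc c d → b' ∈ Set.Icc c d → a' ≤ b' →
      ((∀ p ∈ Set.Icc a' b', μ * η ≤ G p) ∨ ∀ p ∈ Set.Icc a' b', G p ≤ -(μ * η)) →
      ‖∫ p in a'..b', F p‖ ≤ (3 * M + M₁) / (μ * η) := by
    intro a' b' ha' hb' hab h
    have hs : Set.Icc a' b' ⊆ Set.Icc c d := Set.Icc_subset_Icc ha'.1 hb'.2
    refine norm_integral_exp_le_of_le_abs hab (fun p hp => hφ p (hs hp)) (fun p hp => hG p (hs hp))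
      (fun p hp => hα p (hs hp)) (cG.mono hs) (cα.mono hs) (cw.mono hs)
      (fun p hp => hμ.le.trans (hG0 p (hs hp))) (by positivity) h (fun p hp => hM p (hs hp))
      (fun p hp => hM' p (hs hp)) (le_trans ?_ hM₁)
    gcongr
    · exact hb'.2
    · exact ha'.1
  have h1 : ‖∫ p in c..a, F p‖ ≤ (3 * M + M₁) / (μ * η) := by
    rcases eq_or_lt_of_le ha.1 with h | h
    · rw [← h]; simpa using hR
    · refine part c a mc ha ha.1 (Or.inr fun p hp => ?_)
      have ea : a = p₀ - η := max_eq_right (by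
        by_contra hc
        exact h.ne (max_eq_left (not_le.1 hc).le).symm)
      have hp' : p ∈ Set.Icc c d := ⟨hp.1, hp.2.trans ha.2⟩
      have hlt : p < p₀ := by linarith [hp.2]
      have := growth p hp' p₀ hp₀ hlt.le
      have h3 := (hneg p hp' hlt).2
      have : μ * η ≤ μ * (p₀ - p) := by
        gcongr; linarith [hp.2]
      linarith
  have h3 : ‖∫ p in b..d, F p‖ ≤ (3 * M + M₁) / (μ * η) := by
    rcases eq_or_lt_of_le hb.2 with h | h
    · rw [h]; simpa using hR
    · refine part b d hb md hb.2 (Or.inl fun p hp => ?_)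
      have eb : b = p₀ + η := min_eq_right (by
        by_contra hc
        exact h.ne (min_eq_left (not_le.1 hc).le))
      have hp' : p ∈ Set.Icc c d := ⟨hb.1.trans hp.1, hp.2⟩
      have hlt : p₀ < p := by linarith [hp.1]
      have := growth p₀ hp₀ p hp' hlt.le
      have h3 := (hpos p hp' hlt).2
      have : μ * η ≤ μ * (p - p₀) := by
        gcongr; linarith [hp.1]
      linarith
  have h2 : ‖∫ p in a..b, F p‖ ≤ 2 * η * Ψ := by
    have := intervalIntegral.norm_integral_le_of_norm_le_const (f := F) (a := a) (b := b) (C := Ψ) ?_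
    · refine this.trans ?_
      rw [abs_of_nonneg (by linarith), mul_comm]
      gcongr
      linarith [le_max_right c (p₀ - η), min_le_right d (p₀ + η)]
    · intro p hp
      rw [Set.uIoc_of_le (hap.trans hpb)] at hp
      have hp' : p ∈ Set.Icc c d := ⟨ha.1.trans hp.1.le, hp.2.trans hb.2⟩
      simp only [F]
      rw [norm_mul, mul_comm Complex.I, Complex.norm_exp_ofReal_mul_I, one_mul, Complex.norm_real]
      exact hΨ p hp'
  rw [← intervalIntegral.integral_add_adjacent_intervals (iF c mc a ha) (iF a ha d md),
    ← intervalIntegral.integral_add_adjacent_intervals (iF a ha b hb) (iF b hb d md)]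
  calc _ ≤ (3 * M + M₁) / (μ * η) + (2 * η * Ψ + (3 * M + M₁) / (μ * η)) :=
        (norm_add_le _ _).trans (add_le_add h1 ((norm_add_le _ _).trans (add_le_add h2 h3)))
    _ = _ := by ring

theorem norm_integral_exp_neg (ψ : ℝ → ℝ) :
    ‖∫ p in c..d, Complex.exp (Complex.I * ((-φ p : ℝ) : ℂ)) * (ψ p : ℂ)‖ =
      ‖∫ p in c..d, Complex.exp (Complex.I * (φ p : ℂ)) * (ψ p : ℂ)‖ := by
  rw [← RCLike.norm_conj (∫ p in c..d, Complex.exp (Complex.I * (φ p : ℂ)) * (ψ p : ℂ)),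
    ← intervalIntegral.intervalIntegral_conj]
  congr 2
  ext p
  rw [map_mul, ← Complex.exp_conj]
  simp

end VanDerCorput

/-- The constant in the correlation bound for two dyadic pieces. -/
noncomputable def corrConst (ε ρ : ℝ) : ℝ :=
  2 + 4 * ρ ^ 2 * (3 + (|ε| + 1) * (ρ - 1)) / |ε * (ε - 1)|

theorem norm_correlation_interval_aux {ε A B h R W S T ρ c d : ℝ} (hh : 0 < h) (hR : 0 < R)
    (hW : 0 < W) (hS : 0 < S) (hT : 0 < T) (hρ : 1 ≤ ρ) (hcd : c ≤ d)
    (hp : ∀ p ∈ Set.Icc c d, W ≤ p ∧ p ≤ ρ * W) (hq : ∀ p ∈ Set.Icc c d, R ≤ p - h ∧ p - h ≤ ρ * R)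
    (hA : ∀ p ∈ Set.Icc c d, T ≤ |A| * (p - h) ^ ε)
    (hB : ∀ p ∈ Set.Icc c d, S ≤ p ^ ε ∧ p ^ ε ≤ 2 * S) (hpos : 0 < ε * (ε - 1) * A) :
    ‖∫ p in c..d, Complex.exp (Complex.I * ((A * (p - h) ^ ε - B * p ^ ε : ℝ) : ℂ)) *
        (((p * (p - h))⁻¹ : ℝ) : ℂ)‖ ≤ corrConst ε ρ / √(T * h * W) := by
  have mc : c ∈ Set.Icc c d := Set.left_mem_Icc.2 hcd
  have md : d ∈ Set.Icc c d := Set.right_mem_Icc.2 hcd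
  have p0 : ∀ p ∈ Set.Icc c d, 0 < p := fun p h' => hW.trans_le (hp p h').1
  have q0 : ∀ p ∈ Set.Icc c d, 0 < p - h := fun p h' => hR.trans_le (hq p h').1
  set w : ℝ → ℝ := fun p => p ^ (ε - 1)
  set G : ℝ → ℝ := fun p => ε * (A * ((p - h) ^ (ε - 1) * p ^ (1 - ε)) - B)
  set G' : ℝ → ℝ := fun p => ε * (ε - 1) * A * h * ((p - h) ^ (ε - 2) * p ^ (-ε))
  set α : ℝ → ℝ := fun p => p ^ (-ε) * (p - h)⁻¹
  set α' : ℝ → ℝ := fun p => -(p ^ (-ε) * (p - h)⁻¹) * (ε * p⁻¹ + (p - h)⁻¹)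
  have E0 : 0 < |ε * (ε - 1)| := abs_pos.2 fun h0 => by simp [h0] at hpos
  have X0 : 0 < √(T * h * W) := by positivity
  have dsub : ∀ p, HasDerivAt (fun p => p - h) 1 p := fun p => (hasDerivAt_id p).sub_const h
  have dpow : ∀ (s : ℝ) (p : ℝ), 0 < p → HasDerivAt (fun p => p ^ s) (s * p ^ (s - 1)) p :=
    fun s p h' => by simpa using Real.hasDerivAt_rpow_const (p := s) (Or.inl h'.ne')
  have dpow' : ∀ (s : ℝ) (p : ℝ), 0 < p - h →
      HasDerivAt (fun p => (p - h) ^ s) (s * (p - h) ^ (s - 1)) p := fun s p h' => by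
    simpa using (dsub p).rpow_const (p := s) (Or.inl h'.ne')
  have cpow : ∀ s : ℝ, ContinuousOn (fun p : ℝ => p ^ s) (Set.Icc c d) := fun s p h' =>
    (dpow s p (p0 p h')).continuousAt.continuousWithinAt
  have cpow' : ∀ s : ℝ, ContinuousOn (fun p : ℝ => (p - h) ^ s) (Set.Icc c d) := fun s p h' =>
    (dpow' s p (q0 p h')).continuousAt.continuousWithinAt
  have cinv : ContinuousOn (fun p : ℝ => p⁻¹) (Set.Icc c d) :=
    continuousOn_id.inv₀ fun p h' => (p0 p h').ne'
  have cinv' : ContinuousOn (fun p : ℝ => (p - h)⁻¹) (Set.Icc c d) :=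
    (continuousOn_id.sub continuousOn_const).inv₀ fun p h' => (q0 p h').ne'
  have αpos : ∀ p ∈ Set.Icc c d, 0 < α p := fun p h' => by
    have := p0 p h'; have := q0 p h'; simp only [α]; positivity
  have αle : ∀ p ∈ Set.Icc c d, α p ≤ 1 / (S * R) := fun p h' => by
    have h1 := p0 p h'; have h2 := q0 p h'
    simp only [α]
    rw [Real.rpow_neg h1.le, one_div, mul_inv]
    gcongr
    · exact (hB p h').1
    · exact (hq p h').1
  have hα'M : ∀ p ∈ Set.Icc c d, |α' p| ≤ 1 / (S * R) * (|ε| * W⁻¹ + R⁻¹) := fun p h' => by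
    have h1 := p0 p h'; have h2 := q0 p h'
    have e : α' p = -(α p * (ε * p⁻¹ + (p - h)⁻¹)) := by simp only [α', α]; ring
    rw [e, abs_neg, abs_mul, abs_of_pos (αpos p h')]
    gcongr
    · exact αle p h'
    · refine (abs_add_le _ _).trans ?_
      rw [abs_mul, abs_of_pos (inv_pos.2 h1), abs_of_pos (inv_pos.2 h2)]
      gcongr
      · exact (hp p h').1
      · exact (hq p h').1
  have hlen : 1 / (S * R) * (|ε| * W⁻¹ + R⁻¹) * (d - c)
      ≤ 1 / (S * R) * ((|ε| + 1) * (ρ - 1)) := by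
    rw [mul_assoc]
    refine mul_le_mul_of_nonneg_left ?_ (by positivity)
    have l1 : d - c ≤ (ρ - 1) * W := by linarith [(hp d md).2, (hp c mc).1]
    have l2 : d - c ≤ (ρ - 1) * R := by linarith [(hq d md).2, (hq c mc).1]
    calc (|ε| * W⁻¹ + R⁻¹) * (d - c) = |ε| * (W⁻¹ * (d - c)) + R⁻¹ * (d - c) := by ring
      _ ≤ |ε| * (W⁻¹ * ((ρ - 1) * W)) + R⁻¹ * ((ρ - 1) * R) := by gcongr
      _ = _ := by field_simp
  have eαw : ∀ p ∈ Set.Icc c d, α p * w p = (p * (p - h))⁻¹ := fun p h' => by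
    have h1 := p0 p h'
    simp only [α, w]
    rw [mul_right_comm, ← Real.rpow_add h1, show -ε + (ε - 1) = -1 by ring, Real.rpow_neg_one,
      mul_inv]
  set μ := |ε * (ε - 1)| * h * T / (ρ ^ 2 * R ^ 2 * (2 * S))
  have hμ : 0 < μ := by positivity
  have hG'μ : ∀ p ∈ Set.Icc c d, μ ≤ G' p := fun p h' => by
    have h1 := p0 p h'; have h2 := q0 p h'
    have e : G' p = |ε * (ε - 1)| * h * (|A| * (p - h) ^ ε) / ((p - h) ^ 2 * p ^ ε) := by
      have : |ε * (ε - 1)| * |A| = ε * (ε - 1) * A := by rw [← abs_mul, abs_of_pos hpos]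
      simp only [G']
      rw [← this, Real.rpow_neg h1.le, Real.rpow_sub h2]
      norm_num
      field_simp
    rw [e]
    simp only [μ]
    have h3 := hA p h'
    have h4 := (hB p h').2
    have h5 : (p - h) ^ 2 ≤ ρ ^ 2 * R ^ 2 := by rw [← mul_pow]; gcongr; exact (hq p h').2
    gcongr
  have main := norm_integral_exp_le_of_le_deriv (φ := fun p => A * (p - h) ^ ε - B * p ^ ε) (G := G)
    (G' := G') (α := α) (α' := α') (w := w) (μ := μ) (η := R * W / √(T * h * W))
    (M := 1 / (S * R)) (M' := 1 / (S * R) * (|ε| * W⁻¹ + R⁻¹))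
    (M₁ := 1 / (S * R) * ((|ε| + 1) * (ρ - 1))) (Ψ := 1 / (R * W)) hcd ?_ ?_ ?_ ?_ ?_ (cpow _) hμ
    (by positivity) hG'μ (fun p h' => by rw [abs_of_pos (αpos p h')]; exact αle p h') hα'M hlen ?_
  · have eI : ∫ p in c..d, Complex.exp (Complex.I * ((A * (p - h) ^ ε - B * p ^ ε : ℝ) : ℂ)) *
        (((p * (p - h))⁻¹ : ℝ) : ℂ) = ∫ p in c..d, Complex.exp (Complex.I *
        ((A * (p - h) ^ ε - B * p ^ ε : ℝ) : ℂ)) * ((α p * w p : ℝ) : ℂ) := by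
      refine intervalIntegral.integral_congr fun p h' => ?_
      rw [Set.uIcc_of_le hcd] at h'
      simp only [eαw p h']
    rw [eI]
    refine main.trans_eq ?_
    simp only [μ, corrConst]
    have hX : √(T * h * W) ^ 2 = T * h * W := Real.sq_sqrt (by positivity)
    set X := √(T * h * W)
    have hE := E0.ne'
    set E := |ε * (ε - 1)|
    rw [show E * h * T / (ρ ^ 2 * R ^ 2 * (2 * S)) * (R * W / X)
      = E * (T * h * W) / (ρ ^ 2 * R * (2 * S) * X) by field_simp, ← hX]
    field_simp
    ring
  · intro p h'
    have h1 := p0 p h'; have h2 := q0 p h'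
    refine (((dpow' ε p h2).const_mul A).sub ((dpow ε p h1).const_mul B)).congr_deriv ?_
    simp only [w, G]
    have : p ^ (ε - 1) * p ^ (1 - ε) = 1 := by
      rw [← Real.rpow_add h1]; simp
    linear_combination (-(ε * A * (p - h) ^ (ε - 1))) * this
  · intro p h'
    have h1 := p0 p h'; have h2 := q0 p h'
    refine (((((dpow' (ε - 1) p h2).mul (dpow (1 - ε) p h1)).const_mul A).sub_const B).const_mul
      ε).congr_deriv ?_
    simp only [G']
    have e1 : (p - h) ^ (ε - 1) = (p - h) ^ (ε - 2) * (p - h) := by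
      rw [← Real.rpow_add_one h2.ne']; ring_nf
    have e2 : p ^ (1 - ε) = p ^ (-ε) * p := by
      rw [← Real.rpow_add_one h1.ne']; ring_nf
    rw [show ε - 1 - 1 = ε - 2 by ring, show 1 - ε - 1 = -ε by ring, e1, e2]
    ring
  · intro p h'
    have h1 := p0 p h'; have h2 := q0 p h'
    refine ((dpow (-ε) p h1).mul ((dsub p).inv h2.ne')).congr_deriv ?_
    simp only [α', Pi.inv_apply]
    rw [Real.rpow_sub h1, Real.rpow_one]
    field_simp
    ring
  · exact continuousOn_const.mul ((cpow' _).mul (cpow _))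
  · exact ((cpow _).mul cinv').neg.mul ((continuousOn_const.mul cinv).add cinv')
  · intro p h'
    have h1 := p0 p h'; have h2 := q0 p h'
    rw [eαw p h', abs_of_pos (by positivity), one_div, mul_comm R W]
    gcongr
    · exact (hp p h').1
    · exact (hq p h').1

theorem norm_correlation_interval {ε A B h R W S T ρ c d : ℝ} (hε : ε ≠ 0) (hε' : ε ≠ 1)
    (hh : 0 < h) (hR : 0 < R)
    (hW : 0 < W) (hS : 0 < S) (hT : 0 < T) (hρ : 1 ≤ ρ) (hcd : c ≤ d)
    (hp : ∀ p ∈ Set.Icc c d, W ≤ p ∧ p ≤ ρ * W) (hq : ∀ p ∈ Set.Icc c d, R ≤ p - h ∧ p - h ≤ ρ * R)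
    (hA : ∀ p ∈ Set.Icc c d, T ≤ |A| * (p - h) ^ ε)
    (hB : ∀ p ∈ Set.Icc c d, S ≤ p ^ ε ∧ p ^ ε ≤ 2 * S) :
    ‖∫ p in c..d, Complex.exp (Complex.I * ((A * (p - h) ^ ε - B * p ^ ε : ℝ) : ℂ)) *
        (((p * (p - h))⁻¹ : ℝ) : ℂ)‖ ≤ corrConst ε ρ / √(T * h * W) := by
  have hA0 : A ≠ 0 := fun h0 => by
    have := hA c (Set.left_mem_Icc.2 hcd)
    simp [h0] at this
    linarith
  have hne : ε * (ε - 1) * A ≠ 0 := mul_ne_zero (mul_ne_zero hε (sub_ne_zero.2 hε')) hA0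
  rcases hne.lt_or_gt with h' | h'
  · rw [← norm_integral_exp_neg]
    have := norm_correlation_interval_aux (A := -A) (B := -B) hh hR hW hS hT hρ hcd hp hq
      (by simpa using hA) hB (by linarith)
    refine le_trans (le_of_eq ?_) this
    congr 3; ext p; congr 4; ring
  · exact norm_correlation_interval_aux hh hR hW hS hT hρ hcd hp hq hA hB h'

theorem exists_ae_eq_Ioc {s : Set ℝ} (hs : s.OrdConnected) (hne : s.Nonempty) {m n : ℝ}
    (hb : s ⊆ Set.Icc m n) :
    ∃ c d, c ≤ d ∧ c ∈ closure s ∧ d ∈ closure s ∧ s =ᵐ[volume] Set.Ioc c d := by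
  have hbb : BddBelow s := ⟨m, fun x hx => (hb hx).1⟩
  have hba : BddAbove s := ⟨n, fun x hx => (hb hx).2⟩
  have hsub : s ⊆ Set.Icc (sInf s) (sSup s) := fun x hx => ⟨csInf_le hbb hx, le_csSup hba hx⟩
  have hsup : Set.Ioo (sInf s) (sSup s) ⊆ s := fun x hx => by
    obtain ⟨u, hu, hux⟩ := exists_lt_of_csInf_lt hne hx.1
    obtain ⟨v, hv, hvx⟩ := exists_lt_of_lt_csSup hne hx.2
    exact hs.out hu hv ⟨hux.le, hvx.le⟩
  refine ⟨sInf s, sSup s, Real.sInf_le_sSup s hbb hba, csInf_mem_closure hne hbb,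
    csSup_mem_closure hne hba, ?_⟩
  refine EventuallyLE.antisymm ?_ ?_
  · exact hsub.eventuallyLE.trans Ioc_ae_eq_Icc.symm.le
  · exact Ioo_ae_eq_Ioc.symm.le.trans hsup.eventuallyLE

/-- A piece of the kernel `e^{i A y ^ ε} / y`. -/
noncomputable def pieceKernel (ε A : ℝ) (s : Set ℝ) : ℝ → ℂ :=
  s.indicator fun y => Complex.exp (Complex.I * ((A * y ^ ε : ℝ) : ℂ)) / (y : ℂ)

theorem pieceKernel_mul_conj {ε A B h : ℝ} {s t : Set ℝ} (y : ℝ) :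
    pieceKernel ε A s (y - h) * (starRingEnd ℂ) (pieceKernel ε B t y) =
      {p | p ∈ t ∧ p - h ∈ s}.indicator (fun p => Complex.exp (Complex.I *
        ((A * (p - h) ^ ε - B * p ^ ε : ℝ) : ℂ)) * (((p * (p - h))⁻¹ : ℝ) : ℂ)) y := by
  unfold pieceKernel
  by_cases h1 : y - h ∈ s <;> by_cases h2 : y ∈ t
  · rw [Set.indicator_of_mem h1, Set.indicator_of_mem h2, Set.indicator_of_mem
      (show y ∈ {p | p ∈ t ∧ p - h ∈ s} from ⟨h2, h1⟩)]
    rw [map_div₀, ← Complex.exp_conj]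
    simp only [map_mul, Complex.conj_I, Complex.conj_ofReal]
    rw [show Complex.I * ((A * (y - h) ^ ε - B * y ^ ε : ℝ) : ℂ) =
      Complex.I * ((A * (y - h) ^ ε : ℝ) : ℂ) + -Complex.I * ((B * y ^ ε : ℝ) : ℂ) by
        push_cast; ring, Complex.exp_add]
    push_cast
    rw [mul_inv]
    ring
  · simp [h2]
  · simp [h1]
  · simp [h1]

/-- The set on which the phase `|A| y ^ ε` lies in `[T, 2 T]` is an interval of bounded ratio. -/
theorem exists_shell {ε A T : ℝ} (hε : ε ≠ 0) (hA : A ≠ 0) (hT : 0 < T) :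
    ∃ W, 0 < W ∧ ∀ y, 0 < y → ((T ≤ |A| * y ^ ε ∧ |A| * y ^ ε ≤ 2 * T) ↔
      (W ≤ y ∧ y ≤ (2 : ℝ) ^ |ε|⁻¹ * W)) := by
  have hA' : 0 < |A| := abs_pos.2 hA
  have hρ : (0 : ℝ) < 2 ^ |ε|⁻¹ := by positivity
  have key : ∀ σ : ℝ, 0 < σ → ∀ y, 0 < y → ((T ≤ |A| * y ^ σ ∧ |A| * y ^ σ ≤ 2 * T) ↔
      ((T / |A|) ^ σ⁻¹ ≤ y ∧ y ≤ (2 : ℝ) ^ σ⁻¹ * (T / |A|) ^ σ⁻¹)) := fun σ hσ y hy => by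
    rw [← Real.mul_rpow (by norm_num) (by positivity),
      Real.rpow_inv_le_iff_of_pos (by positivity) hy.le hσ,
      Real.le_rpow_inv_iff_of_pos hy.le (by positivity) hσ, div_le_iff₀ hA', ← mul_div_assoc,
      le_div_iff₀ hA', mul_comm (y ^ σ)]
  rcases hε.lt_or_gt with h | h
  · have h' : 0 < |ε| := abs_pos.2 hε
    refine ⟨((2 : ℝ) ^ |ε|⁻¹ * (T / |A|) ^ |ε|⁻¹)⁻¹, by positivity, fun y hy => ?_⟩
    have := key |ε| h' y⁻¹ (inv_pos.2 hy)
    rw [Real.inv_rpow hy.le, ← Real.rpow_neg hy.le, abs_of_neg h, neg_neg] at this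
    rw [this, abs_of_neg h, and_comm]
    have hV : 0 < (T / |A|) ^ (-ε)⁻¹ := by positivity
    rw [abs_of_neg h] at hρ
    rw [inv_le_comm₀ hy (by positivity), le_inv_comm₀ hV hy]
    rw [mul_inv, ← mul_assoc, mul_inv_cancel₀ hρ.ne', one_mul]
  · refine ⟨(T / |A|) ^ |ε|⁻¹, by positivity, fun y hy => ?_⟩
    rw [abs_of_pos h]
    exact key ε h y hy

theorem one_div_sqrt_eq {h b : ℝ} (hh : 0 < h) (hb : 0 < b) (hle : h ≤ b) :
    nearKernel (1 / 2) b h = 1 / √(h * b) := by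
  rw [nearKernel, abs_of_pos hh, if_pos hle, ← Real.sqrt_eq_rpow, Real.sqrt_div hh.le,
    Real.sqrt_mul hh.le, div_div, div_eq_div_iff (by positivity) (by positivity), one_mul]
  nth_rewrite 3 [← Real.mul_self_sqrt hh.le]
  ring

theorem corrConst_nonneg {ε ρ : ℝ} (hρ : 1 ≤ ρ) : 0 ≤ corrConst ε ρ := by
  have : 0 ≤ ρ - 1 := by linarith
  unfold corrConst; positivity

theorem norm_correlation_le {ε A B h T R W : ℝ} (hε : ε ≠ 0) (hε' : ε ≠ 1) (hh : 0 < h)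
    (hT : 0 < T) (hR : 0 < R) (hW : 0 < W) {s t : Set ℝ} (hs : s.OrdConnected)
    (ht : t.OrdConnected)
    (hsA : ∀ y, 0 < y → ((T ≤ |A| * y ^ ε ∧ |A| * y ^ ε ≤ 2 * T) ↔
      (R ≤ y ∧ y ≤ (2 : ℝ) ^ |ε|⁻¹ * R)))
    (htB : ∀ y, 0 < y → ((T ≤ |B| * y ^ ε ∧ |B| * y ^ ε ≤ 2 * T) ↔
      (W ≤ y ∧ y ≤ (2 : ℝ) ^ |ε|⁻¹ * W)))
    (hsI : s ⊆ Set.Icc R ((2 : ℝ) ^ |ε|⁻¹ * R)) (htI : t ⊆ Set.Icc W ((2 : ℝ) ^ |ε|⁻¹ * W)) :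
    ‖∫ y, pieceKernel ε A s y * (starRingEnd ℂ) (pieceKernel ε B t (y + h))‖ ≤
      √((2 : ℝ) ^ |ε|⁻¹) * corrConst ε ((2 : ℝ) ^ |ε|⁻¹) / √T *
        nearKernel (1 / 2) ((2 : ℝ) ^ |ε|⁻¹ * W) h := by
  set ρ : ℝ := (2 : ℝ) ^ |ε|⁻¹
  have hρ : 1 ≤ ρ := Real.one_le_rpow (by norm_num) (by positivity)
  have hC := corrConst_nonneg (ε := ε) hρ
  have hnear : 0 ≤ nearKernel (1 / 2) (ρ * W) h := by
    unfold nearKernel; split_ifs <;> positivity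
  rw [← integral_sub_right_eq_self _ h]
  simp_rw [sub_add_cancel, pieceKernel_mul_conj]
  set K : Set ℝ := {p | p ∈ t ∧ p - h ∈ s}
  have hK : K.OrdConnected := by
    refine ⟨fun p hp q hq z hz => ⟨ht.out hp.1 hq.1 hz, hs.out hp.2 hq.2 ⟨?_, ?_⟩⟩⟩
    · linarith [hz.1]
    · linarith [hz.2]
  rcases K.eq_empty_or_nonempty with h0 | hne
  · rw [h0]; simp only [Set.indicator_empty, integral_zero, norm_zero]; positivity
  have hKW : K ⊆ Set.Icc W (ρ * W) := fun p hp => htI hp.1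
  have hKR : K ⊆ Set.Icc (R + h) (ρ * R + h) := fun p hp => by
    have := hsI hp.2
    exact ⟨by linarith [this.1], by linarith [this.2]⟩
  obtain ⟨c, d, hcd, hc, hd, hae⟩ := exists_ae_eq_Ioc hK hne hKW
  have hW' : Set.Icc c d ⊆ Set.Icc W (ρ * W) :=
    Set.Icc_subset_Icc (closure_minimal hKW isClosed_Icc hc).1
      (closure_minimal hKW isClosed_Icc hd).2
  have hR' : Set.Icc c d ⊆ Set.Icc (R + h) (ρ * R + h) :=
    Set.Icc_subset_Icc (closure_minimal hKR isClosed_Icc hc).1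
      (closure_minimal hKR isClosed_Icc hd).2
  obtain ⟨p₁, hp₁⟩ := hne
  have hhW : h ≤ ρ * W := by linarith [(hKW hp₁).2, (hsI hp₁.2).1]
  have hq : ∀ p ∈ Set.Icc c d, R ≤ p - h ∧ p - h ≤ ρ * R := fun p hp =>
    ⟨by linarith [(hR' hp).1], by linarith [(hR' hp).2]⟩
  have hB0 : 0 < |B| := by
    rw [abs_pos]
    rintro rfl
    have := ((htB W hW).2 ⟨le_rfl, by nlinarith⟩).1
    simp at this
    linarith
  have hmeas : MeasurableSet K := hK.measurableSet
  have main := norm_correlation_interval (A := A) (B := B) (S := T / |B|) hε hε' hh hR hW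
    (by positivity) hT hρ hcd hW' hq
    (fun p hp => ((hsA _ (hR.trans_le (hq p hp).1)).2 (hq p hp)).1) (fun p hp => by
      have := (htB p (hW.trans_le (hW' hp).1)).2 (hW' hp)
      exact ⟨by rw [div_le_iff₀ hB0]; linarith [this.1],
        by rw [← mul_div_assoc, le_div_iff₀ hB0]; linarith [this.2]⟩)
  rw [integral_indicator hmeas, setIntegral_congr_set hae, ← intervalIntegral.integral_of_le hcd]
  refine main.trans_eq ?_
  rw [one_div_sqrt_eq hh (by positivity) hhW, mul_assoc T, Real.sqrt_mul hT.le,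
    show h * (ρ * W) = ρ * (h * W) by ring, Real.sqrt_mul (by positivity) (h * W)]
  field_simp

/-- The constant in the `TT*` bound for the oscillatory pieces. -/
noncomputable def oscConst (δ : ℝ) : ℝ :=
  √((2 : ℝ) ^ δ⁻¹) * (2 + 4 * ((2 : ℝ) ^ δ⁻¹) ^ 2 * (3 + (1 + δ⁻¹) * (2 : ℝ) ^ δ⁻¹) / (δ * δ))

theorem two_rpow_sub_one_le {x : ℝ} (h : 0 ≤ x) : (2 : ℝ) ^ x - 1 ≤ x * 2 ^ x := by
  have h1 : 1 - x * Real.log 2 ≤ (2 : ℝ) ^ (-x) := by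
    rw [Real.rpow_def_of_pos (by norm_num)]
    have := Real.add_one_le_exp (Real.log 2 * -x)
    linarith
  have h2 : Real.log 2 ≤ 1 := by linarith [Real.log_two_lt_d9]
  have h3 : (2 : ℝ) ^ (-x) * 2 ^ x = 1 := by rw [← Real.rpow_add (by norm_num)]; simp
  have h4 : (0 : ℝ) < 2 ^ x := by positivity
  have h5 : x * Real.log 2 ≤ x := by nlinarith
  nlinarith [mul_le_mul_of_nonneg_right (h1.trans' (by linarith : 1 - x ≤ _)) h4.le]

theorem sqrt_mul_corrConst_le {δ ε : ℝ} (hδ : 0 < δ) (h0 : δ < |ε|) (h1 : δ < |ε - 1|) :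
    √((2 : ℝ) ^ |ε|⁻¹) * corrConst ε ((2 : ℝ) ^ |ε|⁻¹) ≤ oscConst δ := by
  have hε : 0 < |ε| := hδ.trans h0
  have hinv : |ε|⁻¹ ≤ δ⁻¹ := by gcongr
  have hρ : (2 : ℝ) ^ |ε|⁻¹ ≤ 2 ^ δ⁻¹ := Real.rpow_le_rpow_of_exponent_le (by norm_num) hinv
  have hρ1 : (1 : ℝ) ≤ 2 ^ |ε|⁻¹ := Real.one_le_rpow (by norm_num) (by positivity)
  have hD : (|ε| + 1) * ((2 : ℝ) ^ |ε|⁻¹ - 1) ≤ (1 + δ⁻¹) * 2 ^ δ⁻¹ := by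
    have h2 : (2 : ℝ) ^ |ε|⁻¹ - 1 ≤ |ε|⁻¹ * 2 ^ |ε|⁻¹ :=
      two_rpow_sub_one_le (by positivity)
    calc (|ε| + 1) * ((2 : ℝ) ^ |ε|⁻¹ - 1) ≤ (|ε| + 1) * (|ε|⁻¹ * 2 ^ |ε|⁻¹) := by gcongr
      _ = (1 + |ε|⁻¹) * 2 ^ |ε|⁻¹ := by field_simp
      _ ≤ _ := by gcongr
  have hC := corrConst_nonneg (ε := ε) hρ1
  unfold oscConst
  refine mul_le_mul (Real.sqrt_le_sqrt hρ) ?_ hC (by positivity)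
  unfold corrConst
  rw [abs_mul]
  have h3 : 0 ≤ (|ε| + 1) * ((2 : ℝ) ^ |ε|⁻¹ - 1) := mul_nonneg (by positivity) (by linarith)
  gcongr

theorem oscConst_nonneg {δ : ℝ} (hδ : 0 < δ) : 0 ≤ oscConst δ := by
  unfold oscConst; positivity

theorem measurable_pieceKernel {ε A : ℝ} {s : Set ℝ} (hs : s.OrdConnected) :
    Measurable (pieceKernel ε A s) := by
  unfold pieceKernel
  exact Measurable.indicator (by fun_prop) hs.measurableSet

theorem norm_pieceKernel_le {ε A W b : ℝ} {s : Set ℝ} (hW : 0 < W) (hs : s ⊆ Set.Icc W b) (y : ℝ) :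
    ‖pieceKernel ε A s y‖ ≤ 1 / W := by
  classical
  unfold pieceKernel
  rw [Set.indicator_apply]
  split_ifs with h
  · have h1 := (hs h).1
    rw [norm_div, mul_comm Complex.I, Complex.norm_exp_ofReal_mul_I, Complex.norm_real,
      Real.norm_of_nonneg (hW.le.trans h1)]
    gcongr
  · simp only [norm_zero]; positivity

theorem integrable_pieceKernel {ε A W b : ℝ} {s : Set ℝ} (ho : s.OrdConnected) (hW : 0 < W)
    (hs : s ⊆ Set.Icc W b) : Integrable (pieceKernel ε A s) := by
  have : pieceKernel ε A s = (Set.Icc W b).indicator (pieceKernel ε A s) := by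
    rw [pieceKernel, Set.indicator_indicator, Set.inter_eq_self_of_subset_right hs]
  rw [this, integrable_indicator_iff measurableSet_Icc]
  exact Measure.integrableOn_of_bounded (M := 1 / W) (by simp)
    (measurable_pieceKernel ho).aestronglyMeasurable
    (Eventually.of_forall fun y => norm_pieceKernel_le hW hs y)

section Pieces

variable {ι : Type*} [Finite ι] [MeasurableSpace ι] [MeasurableSingletonClass ι]

theorem exists_scale {ε A T : ℝ} (hε : ε ≠ 0) (hT : 0 < T) {s : Set ℝ}
    (hsT : ∀ y ∈ s, 0 < y ∧ T ≤ |A| * y ^ ε ∧ |A| * y ^ ε ≤ 2 * T) :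
    ∃ W, 0 < W ∧ s ⊆ Set.Icc W ((2 : ℝ) ^ |ε|⁻¹ * W) ∧ (s = ∅ ∨
      ∀ y, 0 < y → ((T ≤ |A| * y ^ ε ∧ |A| * y ^ ε ≤ 2 * T) ↔
        (W ≤ y ∧ y ≤ (2 : ℝ) ^ |ε|⁻¹ * W))) := by
  rcases s.eq_empty_or_nonempty with rfl | ⟨y, hy⟩
  · exact ⟨1, one_pos, by simp, Or.inl rfl⟩
  have hA : A ≠ 0 := by
    rintro rfl
    have := (hsT y hy).2.1
    simp at this
    linarith
  obtain ⟨W, hW, h⟩ := exists_shell hε hA hT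
  exact ⟨W, hW, fun z hz => (h z (hsT z hz).1).1 (hsT z hz).2, Or.inr h⟩

/-- The maximal bound for a dyadic piece of the oscillatory kernel, and for its reflection. -/
theorem l2Norm_piece_sq_le {δ ε T : ℝ} (hδ : 0 < δ) (h0 : δ < |ε|) (h1 : δ < |ε - 1|) (hT : 0 < T)
    {A : ι → ℝ} {s : ι → Set ℝ} (hs : ∀ n, (s n).OrdConnected)
    (hsT : ∀ n, ∀ y ∈ s n, 0 < y ∧ T ≤ |A n| * y ^ ε ∧ |A n| * y ^ ε ≤ 2 * T)
    {i : ℝ → ι} (hi : Measurable i) {f : ℝ → ℂ} (hf : Measurable f) (hfi : Integrable f) :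
    l2Norm (fun x => ‖∫ w, pieceKernel ε (A (i x)) (s (i x)) (x - w) * f w‖ₑ) ^ 2 ≤
      2 * (ENNReal.ofReal (oscConst δ / √T) * dyadicConst (1 / 2)) * l2Norm (fun x => ‖f x‖ₑ) ^ 2 ∧
    l2Norm (fun x => ‖∫ w, pieceKernel ε (A (i x)) (s (i x)) (-(x - w)) * f w‖ₑ) ^ 2 ≤
      2 * (ENNReal.ofReal (oscConst δ / √T) * dyadicConst (1 / 2)) *
        l2Norm (fun x => ‖f x‖ₑ) ^ 2 := by
  have hε : ε ≠ 0 := abs_pos.1 (hδ.trans h0)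
  have hε' : ε ≠ 1 := sub_ne_zero.1 (abs_pos.1 (hδ.trans h1))
  choose W hW hsW hshell using fun n => exists_scale hε hT (hsT n)
  set ρ : ℝ := (2 : ℝ) ^ |ε|⁻¹
  have hρ : 0 < ρ := by positivity
  set L : ι → ℝ → ℝ≥0∞ := fun n h =>
    ENNReal.ofReal (oscConst δ / √T) * ENNReal.ofReal (nearKernel (1 / 2) (ρ * W n) h)
  have hO : 0 ≤ oscConst δ / √T := div_nonneg (oscConst_nonneg hδ) (Real.sqrt_nonneg _)
  have hLm : ∀ n, Measurable (L n) := fun n =>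
    ((measurable_nearKernel _).of_uncurry_left.ennreal_ofReal).const_mul _
  have hLe : ∀ n h, L n (-h) = L n h := fun n h => by simp only [L, nearKernel_neg]
  have hpos : ∀ m n h, 0 < h → ‖∫ y, pieceKernel ε (A m) (s m) y *
      (starRingEnd ℂ) (pieceKernel ε (A n) (s n) (y + h))‖ₑ ≤ L n h := by
    intro m n h hh
    rcases hshell m with h' | hm
    · simp [h', pieceKernel]
    rcases hshell n with h' | hn
    · simp [h', pieceKernel]
    rw [← ofReal_norm]
    simp only [L]
    rw [← ENNReal.ofReal_mul hO]
    refine ENNReal.ofReal_le_ofReal ?_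
    refine (norm_correlation_le hε hε' hh hT (hW m) (hW n) (hs m) (hs n) hm hn (hsW m)
      (hsW n)).trans ?_
    have hnear : 0 ≤ nearKernel (1 / 2) (ρ * W n) h := by
      have := hW n
      unfold nearKernel; split_ifs <;> positivity
    gcongr
    exact sqrt_mul_corrConst_le hδ h0 h1
  have hL : ∀ m n h, h ≠ 0 → ‖∫ y, pieceKernel ε (A m) (s m) y *
      (starRingEnd ℂ) (pieceKernel ε (A n) (s n) (y + h))‖ₑ ≤ L m h + L n h := by
    intro m n h hh
    rcases hh.lt_or_gt with h' | h'
    · have e : ∫ y, pieceKernel ε (A m) (s m) y *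
          (starRingEnd ℂ) (pieceKernel ε (A n) (s n) (y + h)) =
          (starRingEnd ℂ) (∫ y, pieceKernel ε (A n) (s n) y *
            (starRingEnd ℂ) (pieceKernel ε (A m) (s m) (y + -h))) := by
        rw [← integral_conj, ← integral_add_right_eq_self (fun y => (starRingEnd ℂ)
          (pieceKernel ε (A n) (s n) y * (starRingEnd ℂ) (pieceKernel ε (A m) (s m) (y + -h)))) h]
        congr 1; ext y
        simp [mul_comm]
      rw [e, RCLike.enorm_conj, ← hLe m]
      exact (hpos n m (-h) (by linarith)).trans le_self_add
    · exact (hpos m n h h').trans le_add_self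
  have hL' : ∀ m n h, h ≠ 0 → ‖∫ y, pieceKernel ε (A m) (s m) (-y) *
      (starRingEnd ℂ) (pieceKernel ε (A n) (s n) (-(y + h)))‖ₑ ≤ L m h + L n h := by
    intro m n h hh
    rw [← hLe m, ← hLe n]
    refine le_trans (le_of_eq ?_) (hL m n (-h) (neg_ne_zero.2 hh))
    rw [← integral_neg_eq_self]
    congr 2; ext y
    congr 3
    · ring
    · ring
  have hB : FormBound (fun x z => L (i x) (x - z))
      (ENNReal.ofReal (oscConst δ / √T) * dyadicConst (1 / 2)) := by
    have hb : Measurable fun x => ρ * W (i x) := (measurable_of_finite fun n => ρ * W n).comp hi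
    refine (formBound_nearKernel (by norm_num) hb fun x => mul_pos hρ (hW _)).const_mul ?_ _
    exact ((measurable_nearKernel _).comp (f := fun p : ℝ × ℝ => (ρ * W (i p.1), p.1 - p.2))
      ((hb.comp measurable_fst).prodMk (by fun_prop))).ennreal_ofReal
  refine ⟨l2Norm_linearised_sq_le (κ := fun n => pieceKernel ε (A n) (s n))
    (fun n => measurable_pieceKernel (hs n))
    (fun n => integrable_pieceKernel (hs n) (hW n) (hsW n))
    (fun n => ⟨_, norm_pieceKernel_le (hW n) (hsW n)⟩) hLm hLe hL hi hB hf hfi, ?_⟩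
  exact l2Norm_linearised_sq_le (κ := fun n y => pieceKernel ε (A n) (s n) (-y))
    (fun n => (measurable_pieceKernel (hs n)).comp measurable_neg)
    (fun n => (integrable_pieceKernel (hs n) (hW n) (hsW n)).comp_neg)
    (fun n => ⟨_, fun y => norm_pieceKernel_le (hW n) (hsW n) (-y)⟩) hLm hLe hL' hi hB hf hfi

end Pieces

section ConjPoisson

theorem abs_indicator_sub_conjPoissonLine_le {a : ℝ} (ha : 0 < a) (y : ℝ) :
    |(if a < |y| then y⁻¹ else 0) - conjPoissonLine a y| ≤ poissonLine a y := by
  unfold conjPoissonLine poissonLine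
  split_ifs with h
  · have hy : y ≠ 0 := by rintro rfl; simp at h; linarith
    have e : y⁻¹ - y / (y ^ 2 + a ^ 2) = a ^ 2 / (y * (y ^ 2 + a ^ 2)) := by field_simp; ring
    have h2 : 0 < |y| := abs_pos.2 hy
    rw [e, abs_div, abs_mul, abs_of_pos (by positivity : 0 < a ^ 2),
      abs_of_pos (by positivity : 0 < y ^ 2 + a ^ 2), div_le_div_iff₀ (by positivity)
      (by positivity)]
    have : a * a * (y ^ 2 + a ^ 2) ≤ a * |y| * (y ^ 2 + a ^ 2) := by gcongr
    linarith
  · rw [zero_sub, abs_neg, abs_div, abs_of_pos (by positivity : 0 < y ^ 2 + a ^ 2)]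
    gcongr
    exact not_lt.1 h

/-- The difference of two conjugate Poisson kernels, a smooth truncation of `1 / y`. -/
noncomputable def smoothHilbert (a b y : ℝ) : ℝ := conjPoissonLine a y - conjPoissonLine b y

theorem abs_truncated_sub_smoothHilbert_le {a b : ℝ} (ha : 0 < a) (hab : a ≤ b) (y : ℝ) :
    |(if a < |y| ∧ |y| ≤ b then y⁻¹ else 0) - smoothHilbert a b y| ≤
      poissonLine a y + poissonLine b y := by
  have e : (if a < |y| ∧ |y| ≤ b then y⁻¹ else 0) - smoothHilbert a b y =
      ((if a < |y| then y⁻¹ else 0) - conjPoissonLine a y) -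
        ((if b < |y| then y⁻¹ else 0) - conjPoissonLine b y) := by
    unfold smoothHilbert
    by_cases h1 : a < |y| <;> by_cases h2 : |y| ≤ b
    · simp [h1, h2, not_lt.2 h2]; ring
    · simp [h1, h2, not_le.1 h2]
    · simp [h1, not_lt.2 h2]; ring
    · exact absurd (hab.trans_lt (not_le.1 h2)) h1
  rw [e]
  exact (abs_sub _ _).trans (add_le_add (abs_indicator_sub_conjPoissonLine_le ha y)
    (abs_indicator_sub_conjPoissonLine_le (ha.trans_le hab) y))

theorem integrable_truncated_inv {a b : ℝ} (ha : 0 < a) :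
    Integrable fun y : ℝ => if a < |y| ∧ |y| ≤ b then y⁻¹ else 0 := by
  have hm : MeasurableSet {y : ℝ | a < |y| ∧ |y| ≤ b} :=
    (measurableSet_lt measurable_const continuous_abs.measurable).inter
      (measurableSet_le continuous_abs.measurable measurable_const)
  have : Integrable ({y : ℝ | a < |y| ∧ |y| ≤ b}.indicator fun y => y⁻¹) := by
    rw [integrable_indicator_iff hm]
    refine Measure.integrableOn_of_bounded (M := a⁻¹) ?_ (by fun_prop) ?_
    · refine ne_top_of_le_ne_top (b := volume (Set.Icc (-b) b)) (by simp) (measure_mono ?_)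
      exact fun y hy => abs_le.1 hy.2
    · refine (ae_restrict_mem hm).mono fun y hy => ?_
      rw [norm_inv, Real.norm_eq_abs]
      gcongr
      exact hy.1.le
  exact this.congr (Eventually.of_forall fun y => by simp [Set.indicator_apply])

theorem integrable_smoothHilbert {a b : ℝ} (ha : 0 < a) (hab : a ≤ b) :
    Integrable (smoothHilbert a b) := by
  have hc : Continuous (smoothHilbert a b) :=
    (continuous_conjPoissonLine ha).sub (continuous_conjPoissonLine (ha.trans_le hab))
  refine ((integrable_truncated_inv ha (b := b)).norm.add ((integrable_poissonLine ha).add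
    (integrable_poissonLine (ha.trans_le hab)))).mono' hc.aestronglyMeasurable
    (Eventually.of_forall fun y => ?_)
  have := abs_truncated_sub_smoothHilbert_le ha hab y
  rw [Real.norm_eq_abs]
  simp only [Pi.add_apply, Real.norm_eq_abs]
  have h2 := abs_sub_abs_le_abs_sub (smoothHilbert a b y) (if a < |y| ∧ |y| ≤ b then y⁻¹ else 0)
  rw [abs_sub_comm] at h2
  linarith

theorem abs_smoothHilbert_correlation_le {a b c d h : ℝ} (hh : h ≠ 0) (ha : 0 < a) (hb : 0 < b)
    (hc : 0 < c) (hd : 0 < d) :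
    |∫ y, smoothHilbert a b y * smoothHilbert c d (y + h)| ≤
      2 * Real.pi * (poissonLine a h + poissonLine b h) +
        2 * Real.pi * (poissonLine c h + poissonLine d h) := by
  have i1 := integrable_conjPoissonLine_mul ha hc h
  have i2 := integrable_conjPoissonLine_mul ha hd h
  have i3 := integrable_conjPoissonLine_mul hb hc h
  have i4 := integrable_conjPoissonLine_mul hb hd h
  have e : ∫ y, smoothHilbert a b y * smoothHilbert c d (y + h) =
      Real.pi * poissonLine (a + c) h - Real.pi * poissonLine (a + d) h
        - (Real.pi * poissonLine (b + c) h - Real.pi * poissonLine (b + d) h) := by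
    rw [← (integral_poissonLine_correlation hh ha hc).2,
      ← (integral_poissonLine_correlation hh ha hd).2,
      ← (integral_poissonLine_correlation hh hb hc).2,
      ← (integral_poissonLine_correlation hh hb hd).2, ← integral_sub i1 i2, ← integral_sub i3 i4,
      ← integral_sub (by exact i1.sub i2) (by exact i3.sub i4)]
    congr 1; ext y
    unfold smoothHilbert; ring
  rw [e]
  have hπ := Real.pi_pos
  have p1 := mul_pos hπ (poissonLine_pos (add_pos ha hc) h)
  have p2 := mul_pos hπ (poissonLine_pos (add_pos ha hd) h)
  have p3 := mul_pos hπ (poissonLine_pos (add_pos hb hc) h)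
  have p4 := mul_pos hπ (poissonLine_pos (add_pos hb hd) h)
  have q1 := mul_le_mul_of_nonneg_left (poissonLine_add_le ha hc h) hπ.le
  have q2 := mul_le_mul_of_nonneg_left (poissonLine_add_le ha hd h) hπ.le
  have q3 := mul_le_mul_of_nonneg_left (poissonLine_add_le hb hc h) hπ.le
  have q4 := mul_le_mul_of_nonneg_left (poissonLine_add_le hb hd h) hπ.le
  rw [abs_le]
  constructor <;> linarith

variable {ι : Type*} [Finite ι] [MeasurableSpace ι] [MeasurableSingletonClass ι]

/-- The square of the norm bound for the maximal smoothly truncated Hilbert transform. -/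
noncomputable def hilbertConst : ℝ≥0∞ :=
  2 * (ENNReal.ofReal (2 * Real.pi) * (2 * ENNReal.ofReal Real.pi + 2 * ENNReal.ofReal Real.pi))

theorem l2Norm_smoothHilbert_sq_le {a b : ι → ℝ} (ha : ∀ n, 0 < a n) (hab : ∀ n, a n ≤ b n)
    {i : ℝ → ι} (hi : Measurable i) {f : ℝ → ℂ} (hf : Measurable f) (hfi : Integrable f) :
    l2Norm (fun x => ‖∫ w, (smoothHilbert (a (i x)) (b (i x)) (x - w) : ℂ) * f w‖ₑ) ^ 2 ≤
      hilbertConst * l2Norm (fun x => ‖f x‖ₑ) ^ 2 := by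
  have hb : ∀ n, 0 < b n := fun n => (ha n).trans_le (hab n)
  have ma : Measurable fun x => a (i x) := (measurable_of_finite a).comp hi
  have mb : Measurable fun x => b (i x) := (measurable_of_finite b).comp hi
  have hc : ∀ n, Continuous (smoothHilbert (a n) (b n)) := fun n =>
    (continuous_conjPoissonLine (ha n)).sub (continuous_conjPoissonLine (hb n))
  refine l2Norm_linearised_sq_le (κ := fun n y => (smoothHilbert (a n) (b n) y : ℂ))
    (L := fun n h => ENNReal.ofReal (2 * Real.pi) *
      (ENNReal.ofReal (poissonLine (a n) h) + ENNReal.ofReal (poissonLine (b n) h)))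
    (fun n => (Complex.continuous_ofReal.comp (hc n)).measurable)
    (fun n => (integrable_smoothHilbert (ha n) (hab n)).ofReal)
    (fun n => ⟨1 / a n + 1 / b n, fun y => ?_⟩) (fun n => ?_) (fun n h => ?_)
    (fun m n h hh => ?_) hi ?_ hf hfi
  · rw [Complex.norm_real]
    exact (abs_sub _ _).trans (add_le_add (abs_conjPoissonLine_le (ha n) y)
      (abs_conjPoissonLine_le (hb n) y))
  · have h1 := (continuous_poissonLine (ha n)).measurable
    have h2 := (continuous_poissonLine (hb n)).measurable
    fun_prop
  · simp only [poissonLine_neg]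
  · have e : ∫ y, (smoothHilbert (a m) (b m) y : ℂ) *
        (starRingEnd ℂ) (smoothHilbert (a n) (b n) (y + h) : ℂ) =
        ((∫ y, smoothHilbert (a m) (b m) y * smoothHilbert (a n) (b n) (y + h) : ℝ) : ℂ) := by
      rw [← integral_complex_ofReal]
      congr 1; ext y
      rw [Complex.conj_ofReal]; push_cast; rfl
    rw [e, ← ofReal_norm, Complex.norm_real, Real.norm_eq_abs]
    refine (ENNReal.ofReal_le_ofReal (abs_smoothHilbert_correlation_le hh (ha m) (hb m) (ha n)
      (hb n))).trans_eq ?_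
    have p1 := (poissonLine_pos (ha m) h).le
    have p2 := (poissonLine_pos (hb m) h).le
    have p3 := (poissonLine_pos (ha n) h).le
    have p4 := (poissonLine_pos (hb n) h).le
    rw [ENNReal.ofReal_add (by positivity) (by positivity), ENNReal.ofReal_mul (p := 2 * Real.pi)
      (by positivity), ENNReal.ofReal_mul (p := 2 * Real.pi) (by positivity), ENNReal.ofReal_add p1 p2, ENNReal.ofReal_add p3 p4]
  · have m1 := measurable_poissonLine_comp ma
    have m2 := measurable_poissonLine_comp mb
    exact ((formBound_poissonLine ma fun x => ha _).add m1 m2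
      (formBound_poissonLine mb fun x => hb _)).const_mul
      (by exact m1.add m2) _

end ConjPoisson

theorem exists_low_interval {δ ε r N A : ℝ} (hδ : 0 < δ) (h0 : δ < |ε|) (hr : 0 < r)
    (hrN : r ≤ N) :
    ∃ a b, 0 < a ∧ a ≤ b ∧
      (∀ᵐ y : ℝ, (r < |y| ∧ |y| ≤ N ∧ |A| * |y| ^ ε ≤ 1) ↔ (a < |y| ∧ |y| ≤ b)) ∧
      ∀ y, a < |y| → |y| ≤ b → |A| * |y| ^ ε / |y| ≤ nearKernel δ b y + farKernel δ a y := by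
  have hnear : ∀ b y, 0 < b → 0 ≤ nearKernel δ b y := fun b y hb => by
    unfold nearKernel; split_ifs <;> positivity
  have hfar : ∀ a y, 0 < a → 0 ≤ farKernel δ a y := fun b y hb => by
    unfold farKernel; split_ifs <;> positivity
  have hε : ε ≠ 0 := abs_pos.1 (hδ.trans h0)
  have hN : 0 < N := hr.trans_le hrN
  rcases eq_or_ne A 0 with rfl | hA
  · refine ⟨r, N, hr, hrN, Eventually.of_forall fun y => by simp, fun y _ _ => ?_⟩
    simpa using add_nonneg (hnear N y hN) (hfar r y hr)
  have hA' : 0 < |A| := abs_pos.2 hA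
  rcases hε.lt_or_gt with h | h
  · rw [abs_of_neg h] at h0
    set t := |A| ^ (-ε)⁻¹
    have ht : 0 < t := by positivity
    have iff : ∀ y : ℝ, 0 < |y| → (|A| * |y| ^ ε ≤ 1 ↔ t ≤ |y|) := fun y hy => by
      rw [Real.rpow_inv_le_iff_of_pos hA'.le hy.le (by linarith), Real.rpow_neg hy.le,
        le_inv_comm₀ hA' (by positivity), ← le_div_iff₀' hA', one_div]
    refine ⟨max r t, max N (max r t), by positivity, le_max_right _ _, ?_, fun y h1 _ => ?_⟩
    · filter_upwards [Measure.ae_ne volume t, Measure.ae_ne volume (-t)] with y h1 h2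
      have hyt : |y| ≠ t := fun h3 => by
        rcases abs_eq ht.le |>.1 h3 with h4 | h4
        · exact h1 h4
        · exact h2 h4
      constructor
      · rintro ⟨h3, h4, h5⟩
        rw [iff y (hr.trans h3)] at h5
        exact ⟨max_lt h3 (lt_of_le_of_ne h5 hyt.symm), h4.trans (le_max_left _ _)⟩
      · rintro ⟨h3, h4⟩
        have h5 := max_lt_iff.1 h3
        refine ⟨h5.1, (le_max_iff.1 h4).resolve_right (not_le.2 h3), ?_⟩
        rw [iff y (hr.trans h5.1)]
        exact h5.2.le
    · set a := max r t
      have ha : 0 < a := by positivity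
      have hy : 0 < |y| := ha.trans h1
      have h2 : |A| * a ^ ε ≤ 1 := by
        have := (iff a (by rw [abs_of_pos ha]; exact ha)).2
          (by rw [abs_of_pos ha]; exact le_max_right _ _)
        rwa [abs_of_pos ha] at this
      have h3 : |A| * |y| ^ ε ≤ (a / |y|) ^ δ := by
        calc |A| * |y| ^ ε = |A| * a ^ ε * (a / |y|) ^ (-ε) := by
              rw [Real.div_rpow ha.le hy.le, Real.rpow_neg ha.le, Real.rpow_neg hy.le]
              field_simp
          _ ≤ 1 * (a / |y|) ^ (-ε) := by gcongr
          _ ≤ (a / |y|) ^ δ := by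
              rw [one_mul]
              exact Real.rpow_le_rpow_of_exponent_ge (by positivity)
                ((div_le_one hy).2 h1.le) h0.le
      refine le_trans ?_ (le_add_of_nonneg_left (hnear _ y (by positivity)))
      rw [farKernel, if_pos h1.le]
      gcongr
  · rw [abs_of_pos h] at h0
    set t := |A|⁻¹ ^ ε⁻¹
    have ht : 0 < t := by positivity
    have iff : ∀ y : ℝ, 0 < |y| → (|A| * |y| ^ ε ≤ 1 ↔ |y| ≤ t) := fun y hy => by
      rw [Real.le_rpow_inv_iff_of_pos hy.le (by positivity) h, ← le_div_iff₀' hA', one_div]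
    have hb : 0 < min N t := lt_min hN ht
    refine ⟨min r (min N t), min N t, lt_min hr hb, min_le_right _ _,
      Eventually.of_forall fun y => ?_, fun y h1 h2 => ?_⟩
    · constructor
      · rintro ⟨h3, h4, h5⟩
        rw [iff y (hr.trans h3)] at h5
        exact ⟨(min_le_left _ _).trans_lt h3, le_min h4 h5⟩
      · rintro ⟨h3, h4⟩
        have h5 := le_min_iff.1 h4
        have h6 : r < |y| := (min_lt_iff.1 h3).resolve_right (not_lt.2 h4)
        exact ⟨h6, h5.1, (iff y (hr.trans h6)).2 h5.2⟩
    · set b := min N t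
      have hy : 0 < |y| := (lt_min hr hb).trans h1
      have h3 : |A| * b ^ ε ≤ 1 := by
        have := (iff b (by rw [abs_of_pos hb]; exact hb)).2
          (by rw [abs_of_pos hb]; exact min_le_right _ _)
        rwa [abs_of_pos hb] at this
      have h4 : |A| * |y| ^ ε ≤ (|y| / b) ^ δ := by
        calc |A| * |y| ^ ε = |A| * b ^ ε * (|y| / b) ^ ε := by
              rw [Real.div_rpow hy.le hb.le]
              field_simp
          _ ≤ 1 * (|y| / b) ^ ε := by gcongr
          _ ≤ (|y| / b) ^ δ := by
              rw [one_mul]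
              exact Real.rpow_le_rpow_of_exponent_ge (by positivity)
                ((div_le_one hb).2 h2) h0.le
      refine le_trans ?_ (le_add_of_nonneg_right (hfar _ y (lt_min hr hb)))
      rw [nearKernel, if_pos h2]
      gcongr

/-- The restriction of the kernel `e^{i A φ(y)} / y` to a set. -/
noncomputable def restrictedKernel (φ : ℝ → ℝ) (A : ℝ) (s : Set ℝ) : ℝ → ℂ :=
  s.indicator fun y => Complex.exp (Complex.I * ((A * φ y : ℝ) : ℂ)) / (y : ℂ)

/-- The annulus `r < |y| ≤ N`. -/
def annulus (r N : ℝ) : Set ℝ := {y | r < |y| ∧ |y| ≤ N}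

/-- The part of the annulus where the phase `A |y| ^ ε` is at most one. -/
def lowAnnulus (ε A r N : ℝ) : Set ℝ := {y | r < |y| ∧ |y| ≤ N ∧ |A| * |y| ^ ε ≤ 1}

/-- The part of the interval `(r, N]` where the phase `A y ^ ε` is comparable to `2 ^ k`. -/
def dyadicShell (ε A r N : ℝ) (k : ℕ) : Set ℝ :=
  {y | r < y ∧ y ≤ N ∧ 2 ^ k < |A| * y ^ ε ∧ |A| * y ^ ε ≤ 2 * 2 ^ k}

theorem measurableSet_annulus (r N : ℝ) : MeasurableSet (annulus r N) :=
  (measurableSet_lt measurable_const continuous_abs.measurable).inter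
    (measurableSet_le continuous_abs.measurable measurable_const)

theorem measurableSet_lowAnnulus (ε A r N : ℝ) : MeasurableSet (lowAnnulus ε A r N) :=
  (measurableSet_lt measurable_const continuous_abs.measurable).inter
    ((measurableSet_le continuous_abs.measurable measurable_const).inter
      (measurableSet_le ((continuous_abs.measurable.pow_const ε).const_mul |A|) measurable_const))

theorem ordConnected_dyadicShell {ε A r N : ℝ} (hr : 0 < r) (k : ℕ) :
    (dyadicShell ε A r N k).OrdConnected := by
  refine ⟨fun p hp q hq z hz => ?_⟩
  have p0 : 0 < p := hr.trans hp.1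
  have z0 : 0 < z := p0.trans_le hz.1
  refine ⟨hp.1.trans_le hz.1, hz.2.trans hq.2.1, ?_⟩
  rcases le_total 0 ε with h | h
  · have h1 : |A| * p ^ ε ≤ |A| * z ^ ε := by gcongr; exact hz.1
    have h2 : |A| * z ^ ε ≤ |A| * q ^ ε := by gcongr; exact hz.2
    exact ⟨hp.2.2.1.trans_le h1, h2.trans hq.2.2.2⟩
  · have h1 : |A| * z ^ ε ≤ |A| * p ^ ε :=
      mul_le_mul_of_nonneg_left (Real.rpow_le_rpow_of_nonpos p0 hz.1 h) (abs_nonneg A)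
    have h2 : |A| * q ^ ε ≤ |A| * z ^ ε :=
      mul_le_mul_of_nonneg_left (Real.rpow_le_rpow_of_nonpos z0 hz.2 h) (abs_nonneg A)
    exact ⟨hq.2.2.1.trans_le h2, h1.trans hp.2.2.2⟩

theorem measurable_restrictedKernel {φ : ℝ → ℝ} (hφ : Measurable φ) (A : ℝ) {s : Set ℝ}
    (hs : MeasurableSet s) : Measurable (restrictedKernel φ A s) :=
  Measurable.indicator (by fun_prop) hs

theorem norm_restrictedKernel_le {φ : ℝ → ℝ} {A r : ℝ} {s : Set ℝ} (hr : 0 < r)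
    (hs : ∀ y ∈ s, r < |y|) (y : ℝ) : ‖restrictedKernel φ A s y‖ ≤ 1 / r := by
  classical
  unfold restrictedKernel
  rw [Set.indicator_apply]
  split_ifs with h
  · have h1 := (hs y h).le
    rw [norm_div, mul_comm Complex.I, Complex.norm_exp_ofReal_mul_I, Complex.norm_real,
      Real.norm_eq_abs]
    gcongr
  · simp only [norm_zero]; positivity

theorem integrable_bdd_conv {κ : ℝ → ℂ} (hm : Measurable κ) {M : ℝ} (hM : ∀ y, ‖κ y‖ ≤ M)
    {f : ℝ → ℂ} (hfi : Integrable f) (x : ℝ) : Integrable fun w => κ (x - w) * f w :=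
  hfi.bdd_mul (c := M) (hm.comp (by fun_prop)).aestronglyMeasurable
    (Eventually.of_forall fun w => hM (x - w))

theorem le_rpow_half_mul {x c n : ℝ≥0∞} (h : x ^ 2 ≤ c * n ^ 2) : x ≤ c ^ (1 / 2 : ℝ) * n := by
  have := ENNReal.rpow_le_rpow h (z := 1 / 2) (by norm_num)
  rw [ENNReal.mul_rpow_of_nonneg _ _ (by norm_num), ← ENNReal.rpow_natCast,
    ← ENNReal.rpow_natCast, ← ENNReal.rpow_mul, ← ENNReal.rpow_mul] at this
  norm_num at this ⊢
  exact this

theorem norm_restrictedKernel_sub_le {φ : ℝ → ℝ} {δ ε A r N a b : ℝ}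
    (hφ : ∀ y, |φ y| ≤ |y| ^ ε) (ha : 0 < a) (hab : a ≤ b)
    (hbd : ∀ y, a < |y| → |y| ≤ b → |A| * |y| ^ ε / |y| ≤ nearKernel δ b y + farKernel δ a y)
    {y : ℝ} (hy : (r < |y| ∧ |y| ≤ N ∧ |A| * |y| ^ ε ≤ 1) ↔ (a < |y| ∧ |y| ≤ b)) :
    ‖restrictedKernel φ A (lowAnnulus ε A r N) y - (smoothHilbert a b y : ℂ)‖ ≤
      poissonLine a y + poissonLine b y + (nearKernel δ b y + farKernel δ a y) := by
  have hb : 0 < b := ha.trans_le hab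
  have hnear : 0 ≤ nearKernel δ b y := by unfold nearKernel; split_ifs <;> positivity
  have hfar : 0 ≤ farKernel δ a y := by unfold farKernel; split_ifs <;> positivity
  have h1 := abs_truncated_sub_smoothHilbert_le ha hab y
  by_cases h : a < |y| ∧ |y| ≤ b
  · have hmem : y ∈ lowAnnulus ε A r N := hy.2 h
    rw [if_pos h] at h1
    rw [restrictedKernel, Set.indicator_of_mem hmem]
    have hy0 : 0 < |y| := ha.trans h.1
    have h2 : ‖Complex.exp (Complex.I * ((A * φ y : ℝ) : ℂ)) / (y : ℂ) - ((y⁻¹ : ℝ) : ℂ)‖ ≤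
        nearKernel δ b y + farKernel δ a y := by
      refine le_trans ?_ (hbd y h.1 h.2)
      rw [Complex.ofReal_inv, ← one_div, ← sub_div, norm_div, Complex.norm_real, Real.norm_eq_abs]
      gcongr
      refine (Real.norm_exp_I_mul_ofReal_sub_one_le).trans ?_
      rw [Real.norm_eq_abs, abs_mul]
      gcongr
      exact hφ y
    rw [← Real.norm_eq_abs, ← Complex.norm_real, Complex.ofReal_sub] at h1
    calc _ ≤ _ := norm_sub_le_norm_sub_add_norm_sub _ ((y⁻¹ : ℝ) : ℂ) _
      _ ≤ _ := add_le_add h2 h1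
      _ = _ := add_comm _ _
  · rw [if_neg h] at h1
    have hmem : y ∉ lowAnnulus ε A r N := fun hm => h (hy.1 hm)
    rw [restrictedKernel, Set.indicator_of_notMem hmem, zero_sub, norm_neg,
      Complex.norm_real, Real.norm_eq_abs]
    rw [zero_sub, abs_neg] at h1
    linarith

/-- The norm bound for the part of the maximal operator without oscillation. -/
noncomputable def lowConst (δ : ℝ) : ℝ≥0∞ :=
  hilbertConst ^ (1 / 2 : ℝ) + (2 * ENNReal.ofReal Real.pi + 2 * ENNReal.ofReal Real.pi
    + (dyadicConst δ + dyadicConst δ))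

section Low

variable {ι : Type*} [Finite ι] [MeasurableSpace ι] [MeasurableSingletonClass ι]

theorem l2Norm_low_le {φ : ℝ → ℝ} {δ ε : ℝ} (hδ : 0 < δ) (h0 : δ < |ε|) (mφ : Measurable φ)
    (hφ : ∀ y, |φ y| ≤ |y| ^ ε) {A r N : ι → ℝ} (hr : ∀ n, 0 < r n) (hrN : ∀ n, r n ≤ N n)
    {i : ℝ → ι} (hi : Measurable i) {f : ℝ → ℂ} (hf : Measurable f) (hfi : Integrable f) :
    l2Norm (fun x => ‖∫ w, restrictedKernel φ (A (i x))
      (lowAnnulus ε (A (i x)) (r (i x)) (N (i x))) (x - w) * f w‖ₑ) ≤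
      lowConst δ * l2Norm (fun x => ‖f x‖ₑ) := by
  choose a b ha hab hae hbd using fun n => exists_low_interval (A := A n) hδ h0 (hr n) (hrN n)
  have hb : ∀ n, 0 < b n := fun n => (ha n).trans_le (hab n)
  have ma : Measurable fun x => a (i x) := (measurable_of_finite a).comp hi
  have mb : Measurable fun x => b (i x) := (measurable_of_finite b).comp hi
  have m1 := measurable_poissonLine_comp ma
  have m2 := measurable_poissonLine_comp mb
  have m3 : Measurable (Function.uncurry fun x z =>
      ENNReal.ofReal (nearKernel δ (b (i x)) (x - z))) :=
    ((measurable_nearKernel δ).comp (f := fun p : ℝ × ℝ => (b (i p.1), p.1 - p.2))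
      ((mb.comp measurable_fst).prodMk (by fun_prop))).ennreal_ofReal
  have m4 : Measurable (Function.uncurry fun x z =>
      ENNReal.ofReal (farKernel δ (a (i x)) (x - z))) :=
    ((measurable_farKernel δ).comp (f := fun p : ℝ × ℝ => (a (i p.1), p.1 - p.2))
      ((ma.comp measurable_fst).prodMk (by fun_prop))).ennreal_ofReal
  have hform := ((formBound_poissonLine ma fun x => ha _).add m1 m2
    (formBound_poissonLine mb fun x => hb _)).add (by exact m1.add m2) (by exact m3.add m4)
    ((formBound_nearKernel hδ mb fun x => hb _).add m3 m4 (formBound_farKernel hδ ma fun x => ha _))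
  set k : ℝ → ℝ → ℝ≥0∞ := fun x z => ENNReal.ofReal (poissonLine (a (i x)) (x - z)) +
    ENNReal.ofReal (poissonLine (b (i x)) (x - z)) +
      (ENNReal.ofReal (nearKernel δ (b (i x)) (x - z)) +
        ENNReal.ofReal (farKernel δ (a (i x)) (x - z)))
  have mform : Measurable (Function.uncurry k) := (m1.add m2).add (m3.add m4)
  have hE := hform.l2Norm_le mform hf.enorm
  have hH := le_rpow_half_mul (l2Norm_smoothHilbert_sq_le ha hab hi hf hfi)
  have mS : ∀ n, Measurable fun y => (smoothHilbert (a n) (b n) y : ℂ) := fun n =>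
    (Complex.continuous_ofReal.comp ((continuous_conjPoissonLine (ha n)).sub
      (continuous_conjPoissonLine (hb n)))).measurable
  have mk' : Measurable fun x => ∫⁻ z, k x z * ‖f z‖ₑ :=
    Measurable.lintegral_prod_right (f := fun x z => k x z * ‖f z‖ₑ)
      (mform.mul (hf.enorm.comp measurable_snd))
  have point : ∀ x, ‖∫ w, restrictedKernel φ (A (i x))
      (lowAnnulus ε (A (i x)) (r (i x)) (N (i x))) (x - w) * f w‖ₑ ≤
      ‖∫ w, (smoothHilbert (a (i x)) (b (i x)) (x - w) : ℂ) * f w‖ₑ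
        + ∫⁻ z, k x z * ‖f z‖ₑ := fun x => by
    set n := i x
    have i1 := integrable_bdd_conv (measurable_restrictedKernel mφ (A n)
      (measurableSet_lowAnnulus ε (A n) (r n) (N n)))
      (norm_restrictedKernel_le (hr n) fun y hy => hy.1) hfi x
    have i2 := integrable_bdd_conv (M := 1 / a n + 1 / b n) (mS n) (fun y => by
      rw [Complex.norm_real]
      exact (abs_sub _ _).trans (add_le_add (abs_conjPoissonLine_le (ha n) y)
        (abs_conjPoissonLine_le (hb n) y))) hfi x
    have e : ∫ w, restrictedKernel φ (A n) (lowAnnulus ε (A n) (r n) (N n)) (x - w) * f w =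
        (∫ w, (smoothHilbert (a n) (b n) (x - w) : ℂ) * f w) +
        ∫ w, (restrictedKernel φ (A n) (lowAnnulus ε (A n) (r n) (N n)) (x - w)
          - (smoothHilbert (a n) (b n) (x - w) : ℂ)) * f w := by
      simp_rw [sub_mul]
      rw [integral_sub i1 i2]; ring
    rw [e]
    refine (enorm_add_le _ _).trans (add_le_add le_rfl ?_)
    refine (enorm_integral_le_lintegral_enorm _).trans (lintegral_mono_ae ?_)
    have := (Measure.measurePreserving_sub_left volume x).quasiMeasurePreserving.ae (hae n)
    filter_upwards [this] with w hw
    rw [enorm_mul]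
    gcongr
    rw [← ofReal_norm]
    refine (ENNReal.ofReal_le_ofReal (norm_restrictedKernel_sub_le hφ (ha n) (hab n) (hbd n)
      hw)).trans ?_
    exact ENNReal.ofReal_add_le.trans (add_le_add ENNReal.ofReal_add_le ENNReal.ofReal_add_le)
  refine (l2Norm_mono point).trans ((l2Norm_add_le ?_ mk').trans ?_)
  · exact (measurable_linearised (κ := fun n y => (smoothHilbert (a n) (b n) y : ℂ)) mS hi hf).enorm
  · rw [lowConst, add_mul]
    exact add_le_add hH hE

end Low

theorem sum_dyadic_ite (v : ℝ) (c : ℂ) (K : ℕ) :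
    (if v ≤ 1 then c else 0) + ∑ k ∈ Finset.range K, (if 2 ^ k < v ∧ v ≤ 2 * 2 ^ k then c else 0)
      = if v ≤ 2 ^ K then c else 0 := by
  induction K with
  | zero => simp
  | succ K ih =>
    have h2 : (0 : ℝ) < 2 ^ K := by positivity
    rw [Finset.sum_range_succ, ← add_assoc, ih, pow_succ']
    by_cases h1 : v ≤ 2 ^ K
    · rw [if_pos h1, if_neg (fun h => (not_lt.2 h1) h.1), if_pos (by linarith), add_zero]
    · rw [if_neg h1, zero_add]
      by_cases h3 : v ≤ 2 * 2 ^ K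
      · rw [if_pos ⟨not_le.1 h1, h3⟩, if_pos h3]
      · rw [if_neg (fun h => h3 h.2), if_neg h3]

theorem exists_pow_bound {ε A r N : ℝ} (hr : 0 < r) :
    ∃ K : ℕ, ∀ y, r < y → y ≤ N → |A| * y ^ ε ≤ 2 ^ K := by
  obtain ⟨K, hK⟩ := pow_unbounded_of_one_lt (|A| * max (r ^ ε) (N ^ ε)) (by norm_num : (1 : ℝ) < 2)
  refine ⟨K, fun y h1 h2 => le_trans ?_ hK.le⟩
  have hy : 0 < y := hr.trans h1
  gcongr
  rcases le_total 0 ε with h | h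
  · exact (Real.rpow_le_rpow hy.le h2 h).trans (le_max_right _ _)
  · exact (Real.rpow_le_rpow_of_nonpos hr h1.le h).trans (le_max_left _ _)

/-- The kernel on an annulus is the sum of a low part and of dyadic pieces on both half-lines. -/
theorem restrictedKernel_annulus_eq {φ : ℝ → ℝ} {ε σ A r N : ℝ} (hr : 0 < r)
    (hp : ∀ y, 0 < y → φ y = y ^ ε) (hn : ∀ y, 0 < y → φ (-y) = σ * y ^ ε)
    {K : ℕ} (hK : ∀ y, r < y → y ≤ N → |A| * y ^ ε ≤ 2 ^ K) (y : ℝ) :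
    restrictedKernel φ A (annulus r N) y = restrictedKernel φ A (lowAnnulus ε A r N) y +
      ∑ k ∈ Finset.range K, (pieceKernel ε A (dyadicShell ε A r N k) y -
        pieceKernel ε (σ * A) (dyadicShell ε A r N k) (-y)) := by
  classical
  have key : ∀ u, 0 < u → ∀ c : ℂ, (annulus r N).indicator (fun _ => c) u =
      (lowAnnulus ε A r N).indicator (fun _ => c) u +
        ∑ k ∈ Finset.range K, (dyadicShell ε A r N k).indicator (fun _ => c) u := by
    intro u hu c
    simp only [Set.indicator_apply, annulus, lowAnnulus, dyadicShell, Set.mem_ofPred_eq,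
      abs_of_pos hu]
    by_cases h : r < u ∧ u ≤ N
    · simp only [h.1, h.2, true_and]
      rw [sum_dyadic_ite, if_pos (hK u h.1 h.2)]
      simp
    · have h' : ∀ P : Prop, ¬ (r < u ∧ u ≤ N ∧ P) := fun P hP => h ⟨hP.1, hP.2.1⟩
      simp only [h, h', if_false, Finset.sum_const_zero, add_zero]
  have hshell : ∀ k u, u ≤ 0 → u ∉ dyadicShell ε A r N k := fun k u hu h =>
    absurd (hr.trans h.1) (not_lt.2 hu)
  have hann : ∀ u, -u ∈ annulus r N ↔ u ∈ annulus r N := fun u => by simp [annulus]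
  have hlow : ∀ u, -u ∈ lowAnnulus ε A r N ↔ u ∈ lowAnnulus ε A r N := fun u => by
    simp [lowAnnulus]
  unfold restrictedKernel pieceKernel
  rcases lt_trichotomy y 0 with h | h | h
  · have hu : 0 < -y := by linarith
    have k1 := key (-y) hu (Complex.exp (Complex.I * ((A * φ y : ℝ) : ℂ)) / (y : ℂ))
    simp only [Set.indicator_apply, hann, hlow] at k1 ⊢
    rw [k1]
    congr 1
    refine Finset.sum_congr rfl fun k _ => ?_
    rw [if_neg (hshell k y h.le), zero_sub]
    split_ifs
    · have := hn (-y) hu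
      rw [neg_neg] at this
      rw [this, show A * (σ * (-y) ^ ε) = σ * A * (-y) ^ ε by ring, Complex.ofReal_neg, div_neg,
        neg_neg]
    · simp
  · subst h
    have h1 : (0 : ℝ) ∉ annulus r N := fun h => by simp [annulus] at h; linarith
    have h2 : (0 : ℝ) ∉ lowAnnulus ε A r N := fun h => by simp [lowAnnulus] at h; linarith
    have h3 : ∀ k, (0 : ℝ) ∉ dyadicShell ε A r N k := fun k => hshell k 0 le_rfl
    simp [h1, h2, h3]
  · have k1 := key y h (Complex.exp (Complex.I * ((A * φ y : ℝ) : ℂ)) / (y : ℂ))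
    simp only [Set.indicator_apply] at k1 ⊢
    rw [k1]
    congr 1
    refine Finset.sum_congr rfl fun k _ => ?_
    rw [if_neg (hshell k (-y) (by linarith)), sub_zero, hp y h]

/-- The norm bound for the `k`-th dyadic piece of the maximal operator. -/
noncomputable def pieceConst (δ : ℝ) (k : ℕ) : ℝ≥0∞ :=
  (2 * (ENNReal.ofReal (oscConst δ / √(2 ^ k)) * dyadicConst (1 / 2))) ^ (1 / 2 : ℝ)

/-- The norm bound for the truncated maximal operator. -/
noncomputable def totalConst (δ : ℝ) : ℝ≥0∞ :=
  lowConst δ + ∑' k, (pieceConst δ k + pieceConst δ k)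

theorem pieceConst_eq {δ : ℝ} (hδ : 0 < δ) (k : ℕ) :
    pieceConst δ k = pieceConst δ 0 * (ENNReal.ofReal (√2)⁻¹ ^ (1 / 2 : ℝ)) ^ k := by
  have e : oscConst δ / √(2 ^ k) = oscConst δ * (√2)⁻¹ ^ k := by
    have : √((2 : ℝ) ^ k) = √2 ^ k := by
      induction k with
      | zero => simp
      | succ k ih => rw [pow_succ, Real.sqrt_mul (by positivity), ih, pow_succ]
    rw [div_eq_mul_inv, inv_pow, this]
  unfold pieceConst
  rw [e, ENNReal.ofReal_mul (oscConst_nonneg hδ), ENNReal.ofReal_pow (by positivity), pow_zero,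
    Real.sqrt_one, div_one, ← ENNReal.rpow_natCast, ← ENNReal.rpow_natCast, ← ENNReal.rpow_mul,
    mul_comm (1 / 2 : ℝ) (k : ℝ), ENNReal.rpow_mul _ (k : ℝ),
    ← ENNReal.mul_rpow_of_nonneg _ _ (by norm_num)]
  congr 1
  ring

theorem totalConst_ne_top {δ : ℝ} (hδ : 0 < δ) : totalConst δ ≠ ⊤ := by
  have h1 := dyadicConst_ne_top hδ
  have h2 := dyadicConst_ne_top (σ := 1 / 2) (by norm_num)
  have hp : pieceConst δ 0 ≠ ⊤ := by
    unfold pieceConst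
    finiteness
  have hl : lowConst δ ≠ ⊤ := by
    unfold lowConst hilbertConst
    finiteness
  refine ENNReal.add_ne_top.2 ⟨hl, ?_⟩
  rw [ENNReal.tsum_add]
  have hs : ∑' k, pieceConst δ k ≠ ⊤ := by
    rw [tsum_congr (pieceConst_eq hδ), ENNReal.tsum_mul_left, ENNReal.tsum_geometric]
    refine ENNReal.mul_ne_top hp (ENNReal.inv_ne_top.2 ?_)
    refine (tsub_pos_of_lt ?_).ne'
    refine ENNReal.rpow_lt_one ?_ (by norm_num)
    rw [← ENNReal.ofReal_one]
    refine (ENNReal.ofReal_lt_ofReal_iff one_pos).2 (inv_lt_one_of_one_lt₀ ?_)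
    rw [Real.lt_sqrt (by norm_num)]; norm_num
  exact ENNReal.add_ne_top.2 ⟨hs, hs⟩

section Total

variable {ι : Type*} [Finite ι] [MeasurableSpace ι] [MeasurableSingletonClass ι]

theorem l2Norm_annulus_le {φ : ℝ → ℝ} {δ ε σ : ℝ} (hδ : 0 < δ) (h0 : δ < |ε|) (h1 : δ < |ε - 1|)
    (mφ : Measurable φ) (hφ : ∀ y, |φ y| ≤ |y| ^ ε) (hσ : |σ| = 1)
    (hp : ∀ y, 0 < y → φ y = y ^ ε) (hn : ∀ y, 0 < y → φ (-y) = σ * y ^ ε)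
    {A r N : ι → ℝ} (hr : ∀ n, 0 < r n) (hrN : ∀ n, r n ≤ N n)
    {i : ℝ → ι} (hi : Measurable i) {f : ℝ → ℂ} (hf : Measurable f) (hfi : Integrable f) :
    l2Norm (fun x => ‖∫ w, restrictedKernel φ (A (i x)) (annulus (r (i x)) (N (i x))) (x - w)
      * f w‖ₑ) ≤ totalConst δ * l2Norm (fun x => ‖f x‖ₑ) := by
  obtain ⟨K, hK⟩ : ∃ K : ℕ, ∀ n y, r n < y → y ≤ N n → |A n| * y ^ ε ≤ 2 ^ K := by
    cases nonempty_fintype ι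
    choose K hK using fun n => exists_pow_bound (ε := ε) (A := A n) (N := N n) (hr n)
    refine ⟨∑ n, K n, fun n y h2 h3 => (hK n y h2 h3).trans ?_⟩
    gcongr
    · norm_num
    · exact Finset.single_le_sum (fun _ _ => Nat.zero_le _) (Finset.mem_univ n)
  set s : ℕ → ι → Set ℝ := fun k n => dyadicShell ε (A n) (r n) (N n) k
  have ho : ∀ k n, (s k n).OrdConnected := fun k n => ordConnected_dyadicShell (hr n) k
  have hsT : ∀ k n, ∀ y ∈ s k n, 0 < y ∧ 2 ^ k ≤ |A n| * y ^ ε ∧ |A n| * y ^ ε ≤ 2 * 2 ^ k :=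
    fun k n y hy => ⟨(hr n).trans hy.1, hy.2.2.1.le, hy.2.2.2⟩
  have hsT' : ∀ k n, ∀ y ∈ s k n, 0 < y ∧ 2 ^ k ≤ |σ * A n| * y ^ ε ∧
      |σ * A n| * y ^ ε ≤ 2 * 2 ^ k := by
    simpa only [abs_mul, hσ, one_mul] using hsT
  have hsub : ∀ k n, s k n ⊆ Set.Icc (r n) (N n) := fun k n y hy => ⟨hy.1.le, hy.2.1⟩
  set P : ℕ → ℝ → ℝ≥0∞ := fun k x => ‖∫ w, pieceKernel ε (A (i x)) (s k (i x)) (x - w) * f w‖ₑ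
  set Q : ℕ → ℝ → ℝ≥0∞ := fun k x =>
    ‖∫ w, pieceKernel ε (σ * A (i x)) (s k (i x)) (-(x - w)) * f w‖ₑ
  have mP : ∀ k, Measurable (P k) := fun k =>
    (measurable_linearised (κ := fun n => pieceKernel ε (A n) (s k n))
      (fun n => measurable_pieceKernel (ho k n)) hi hf).enorm
  have mQ : ∀ k, Measurable (Q k) := fun k =>
    (measurable_linearised (κ := fun n y => pieceKernel ε (σ * A n) (s k n) (-y))
      (fun n => (measurable_pieceKernel (ho k n)).comp measurable_neg) hi hf).enorm
  have hP : ∀ k, l2Norm (P k) ≤ pieceConst δ k * l2Norm (fun x => ‖f x‖ₑ) := fun k =>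
    le_rpow_half_mul (l2Norm_piece_sq_le hδ h0 h1 (by positivity) (ho k) (hsT k) hi hf hfi).1
  have hQ : ∀ k, l2Norm (Q k) ≤ pieceConst δ k * l2Norm (fun x => ‖f x‖ₑ) := fun k =>
    le_rpow_half_mul (l2Norm_piece_sq_le (A := fun n => σ * A n) hδ h0 h1 (by positivity) (ho k)
      (hsT' k) hi hf hfi).2
  have hL := l2Norm_low_le (A := A) hδ h0 mφ hφ hr hrN hi hf hfi
  have mL : Measurable fun x => ‖∫ w, restrictedKernel φ (A (i x))
      (lowAnnulus ε (A (i x)) (r (i x)) (N (i x))) (x - w) * f w‖ₑ :=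
    (measurable_linearised (κ := fun n => restrictedKernel φ (A n)
      (lowAnnulus ε (A n) (r n) (N n))) (fun n => measurable_restrictedKernel mφ _
        (measurableSet_lowAnnulus _ _ _ _)) hi hf).enorm
  have point : ∀ x, ‖∫ w, restrictedKernel φ (A (i x)) (annulus (r (i x)) (N (i x))) (x - w)
      * f w‖ₑ ≤ ‖∫ w, restrictedKernel φ (A (i x))
      (lowAnnulus ε (A (i x)) (r (i x)) (N (i x))) (x - w) * f w‖ₑ
        + ∑ k ∈ Finset.range K, (P k x + Q k x) := by
    intro x
    set n := i x
    have i1 := integrable_bdd_conv (measurable_restrictedKernel mφ (A n)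
      (measurableSet_lowAnnulus ε (A n) (r n) (N n)))
      (norm_restrictedKernel_le (hr n) fun y hy => hy.1) hfi x
    have i2 : ∀ k, Integrable fun w => pieceKernel ε (A n) (s k n) (x - w) * f w := fun k =>
      integrable_bdd_conv (measurable_pieceKernel (ho k n))
        (norm_pieceKernel_le (hr n) (hsub k n)) hfi x
    have i3 : ∀ k, Integrable fun w => pieceKernel ε (σ * A n) (s k n) (-(x - w)) * f w := fun k =>
      integrable_bdd_conv ((measurable_pieceKernel (ho k n)).comp measurable_neg)
        (fun y => norm_pieceKernel_le (hr n) (hsub k n) (-y)) hfi x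
    have i4 : ∀ k, Integrable fun w => pieceKernel ε (A n) (s k n) (x - w) * f w -
        pieceKernel ε (σ * A n) (s k n) (-(x - w)) * f w := fun k => (i2 k).sub (i3 k)
    have e : ∫ w, restrictedKernel φ (A n) (annulus (r n) (N n)) (x - w) * f w =
        (∫ w, restrictedKernel φ (A n) (lowAnnulus ε (A n) (r n) (N n)) (x - w) * f w) +
        ∑ k ∈ Finset.range K, ((∫ w, pieceKernel ε (A n) (s k n) (x - w) * f w) -
          ∫ w, pieceKernel ε (σ * A n) (s k n) (-(x - w)) * f w) := by
      simp_rw [restrictedKernel_annulus_eq (hr n) hp hn (hK n), add_mul, Finset.sum_mul, sub_mul]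
      rw [integral_add i1 (integrable_finsetSum _ fun k _ => i4 k),
        integral_finsetSum _ fun k _ => i4 k]
      congr 1
      exact Finset.sum_congr rfl fun k _ => integral_sub (i2 k) (i3 k)
    rw [e]
    refine (enorm_add_le _ _).trans (add_le_add le_rfl ((enorm_sum_le _ _).trans ?_))
    exact Finset.sum_le_sum fun k _ => enorm_sub_le
  refine (l2Norm_mono point).trans ((l2Norm_add_le mL (Finset.measurable_sum _ fun k _ =>
    (mP k).add (mQ k))).trans ?_)
  rw [totalConst, add_mul, ← ENNReal.tsum_mul_right]
  refine add_le_add hL (((l2Norm_sum_le _ fun k => (mP k).add (mQ k)).trans ?_).trans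
    (ENNReal.sum_le_tsum (Finset.range K)))
  refine Finset.sum_le_sum fun k _ => (l2Norm_add_le (mP k) (mQ k)).trans ?_
  rw [add_mul]
  exact add_le_add (hP k) (hQ k)

end Total

/-- A bound for all measurable selections from finite subfamilies bounds the supremum. -/
theorem l2Norm_iSup_le_of_selection {F : ℕ → ℝ → ℝ≥0∞} (hF : ∀ n, Measurable (F n)) {B : ℝ≥0∞}
    (h : ∀ n (i : ℝ → Fin (n + 1)), Measurable i → l2Norm (fun x => F (i x) x) ≤ B) :
    l2Norm (fun x => ⨆ n, F n x) ≤ B := by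
  have sel : ∀ n, ∃ i : ℝ → Fin (n + 1), Measurable i ∧ ∀ x, F (i x) x = ⨆ m : Fin (n + 1), F m x := by
    intro n
    induction n with
    | zero => exact ⟨fun _ => 0, measurable_const, fun x => by simp⟩
    | succ n ih =>
      obtain ⟨i, mi, hi⟩ := ih
      have mFi : Measurable fun x => F (i x) x :=
        (measurable_from_prod_countable_right (f := fun q : Fin (n + 1) × ℝ => F q.1 q.2)
          fun m => hF m).comp (f := fun x => (i x, x)) (mi.prodMk measurable_id)
      refine ⟨fun x => if F (i x) x < F (n + 1) x then Fin.last (n + 1) else (i x).castSucc,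
        Measurable.ite (measurableSet_lt mFi (hF _)) measurable_const
          ((measurable_of_finite _).comp mi), fun x => ?_⟩
      have e : ⨆ m : Fin (n + 2), F m x = max (⨆ m : Fin (n + 1), F m x) (F (n + 1) x) := by
        refine le_antisymm (iSup_le fun m => ?_) (max_le (iSup_le fun m => ?_) ?_)
        · refine Fin.lastCases ?_ (fun j => ?_) m
          · simp
          · exact le_max_of_le_left (le_iSup (fun m : Fin (n + 1) => F m x) j)
        · exact le_iSup (fun m : Fin (n + 2) => F m x) m.castSucc
        · exact le_iSup (fun m : Fin (n + 2) => F m x) (Fin.last (n + 1))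
      rw [e, ← hi]
      dsimp only
      split_ifs with hlt
      · rw [max_eq_right hlt.le]; simp
      · rw [max_eq_left (not_lt.1 hlt)]; simp
  have key : ∀ n, l2Norm (fun x => ⨆ m : Fin (n + 1), F m x) ≤ B := fun n => by
    obtain ⟨i, mi, hi⟩ := sel n
    simp_rw [← hi]
    exact h n i mi
  have := l2Norm_iSup (g := fun n x => ⨆ m : Fin (n + 1), F m x)
    (fun n => Measurable.iSup fun m => hF m) (fun a b hab x => ?_) key
  · refine (l2Norm_mono fun x => ?_).trans this
    exact iSup_le fun n => (le_iSup (fun m : Fin (n + 1) => F m x) (Fin.last n)).trans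
      (le_iSup (fun n => ⨆ m : Fin (n + 1), F m x) n)
  · exact iSup_le fun m => le_iSup (fun m : Fin (b + 1) => F m x) (Fin.castLE (by omega) m)

theorem eLpNorm_two_eq_l2Norm {E : Type*} [TopologicalSpace E] [ContinuousENorm E] (g : ℝ → E) :
    eLpNorm g 2 volume = l2Norm fun x => ‖g x‖ₑ := by
  rw [eLpNorm_eq_lintegral_rpow_enorm_toReal (by norm_num) (by norm_num), l2Norm]
  simp

section Limits

variable {φ : ℝ → ℝ} {f : 𝓢(ℝ, ℂ)}

theorem integral_restrictedKernel_sub (A x : ℝ) (s : Set ℝ) :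
    ∫ w, restrictedKernel φ A s (x - w) * f w = ∫ y, restrictedKernel φ A s y * f (x - y) := by
  rw [← integral_sub_left_eq_self _ volume x]
  simp

theorem integrable_schwartz_sub (f : 𝓢(ℝ, ℂ)) (x : ℝ) : Integrable fun y => f (x - y) :=
  f.integrable.comp_sub_left x

theorem tendsto_annulus_integral (mφ : Measurable φ) (A x : ℝ) {r : ℝ} (hr : 0 < r) :
    Tendsto (fun N : ℕ => ∫ w, restrictedKernel φ A (annulus r (N + 1)) (x - w) * f w) atTop
      (𝓝 (truncatedIntegral φ f A x r)) := by
  simp_rw [integral_restrictedKernel_sub]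
  have hm : MeasurableSet {y : ℝ | r < |y|} :=
    measurableSet_lt measurable_const continuous_abs.measurable
  rw [truncatedIntegral, ← integral_indicator hm]
  refine tendsto_integral_of_dominated_convergence (fun y => 1 / r * ‖f (x - y)‖)
    (fun N => ?_) ((integrable_schwartz_sub f x).norm.const_mul _) (fun N => ?_) ?_
  · exact ((measurable_restrictedKernel mφ A (measurableSet_annulus _ _)).mul
      (f.continuous.comp (by fun_prop)).measurable).aestronglyMeasurable
  · refine Eventually.of_forall fun y => ?_
    rw [norm_mul]
    gcongr
    exact norm_restrictedKernel_le hr (fun y hy => hy.1) y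
  · refine Eventually.of_forall fun y => ?_
    refine tendsto_const_nhds.congr' ?_
    obtain ⟨N, hN⟩ := exists_nat_ge |y|
    filter_upwards [eventually_ge_atTop N] with n hn
    have h1 : |y| ≤ n + 1 := hN.trans ((Nat.cast_le.2 hn).trans (by linarith))
    unfold restrictedKernel
    by_cases h : r < |y|
    · rw [Set.indicator_of_mem (show y ∈ annulus r (n + 1) from ⟨h, h1⟩),
        Set.indicator_of_mem (show y ∈ {y : ℝ | r < |y|} from h)]
      ring
    · rw [Set.indicator_of_notMem (show y ∉ annulus r (n + 1) from fun h' => h h'.1),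
        Set.indicator_of_notMem (show y ∉ {y : ℝ | r < |y|} from h), zero_mul]

theorem continuous_annulus_integral (mφ : Measurable φ) (x N : ℝ) {r : ℝ} (hr : 0 < r) :
    Continuous fun A : ℝ => ∫ w, restrictedKernel φ A (annulus r N) (x - w) * f w := by
  refine continuous_of_dominated (bound := fun w => 1 / r * ‖f w‖) (fun A => ?_) (fun A => ?_)
    (f.integrable.norm.const_mul _) ?_
  · exact (((measurable_restrictedKernel mφ A (measurableSet_annulus _ _)).comp
      (by fun_prop)).mul f.continuous.measurable).aestronglyMeasurable
  · refine Eventually.of_forall fun y => ?_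
    rw [norm_mul]
    gcongr
    exact norm_restrictedKernel_le hr (fun y hy => hy.1) _
  · refine Eventually.of_forall fun w => ?_
    refine Continuous.mul ?_ continuous_const
    unfold restrictedKernel
    by_cases h : x - w ∈ annulus r N
    · simp only [Set.indicator_of_mem h]
      fun_prop
    · simp only [Set.indicator_of_notMem h]
      fun_prop

/-- The maximal operator is dominated by a supremum over countably many truncations. -/
theorem maximalOperator_le_iSup (mφ : Measurable φ) (hpv : ∀ A x, PVExists φ f A x)
    (e : ℕ → ℚ × ℕ × ℕ) (he : Function.Surjective e) (x : ℝ) :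
    maximalOperator φ f x ≤ ⨆ n, ‖∫ w, restrictedKernel φ (e n).1
      (annulus (1 / ((e n).2.1 + 1 : ℝ)) ((e n).2.2 + 1)) (x - w) * f w‖ₑ := by
  set C := ⨆ n, ‖∫ w, restrictedKernel φ (e n).1
      (annulus (1 / ((e n).2.1 + 1 : ℝ)) ((e n).2.2 + 1)) (x - w) * f w‖ₑ
  refine iSup_le fun A => ?_
  obtain ⟨l, hl⟩ := hpv A x
  have h1 : ∀ (m N : ℕ) (A : ℝ), ‖∫ w, restrictedKernel φ A
      (annulus (1 / (m + 1 : ℝ)) (N + 1)) (x - w) * f w‖ₑ ≤ C := by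
    intro m N A
    have hc : IsClosed {A : ℝ | ‖∫ w, restrictedKernel φ A
        (annulus (1 / (m + 1 : ℝ)) (N + 1)) (x - w) * f w‖ₑ ≤ C} :=
      isClosed_le (continuous_enorm.comp
        (continuous_annulus_integral mφ x _ (by positivity))) continuous_const
    have hd : Dense {A : ℝ | ‖∫ w, restrictedKernel φ A
        (annulus (1 / (m + 1 : ℝ)) (N + 1)) (x - w) * f w‖ₑ ≤ C} := by
      refine Rat.denseRange_cast.mono ?_
      rintro _ ⟨q, rfl⟩
      obtain ⟨n, hn⟩ := he (q, m, N)
      have := le_iSup (fun n => ‖∫ w, restrictedKernel φ (e n).1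
        (annulus (1 / ((e n).2.1 + 1 : ℝ)) ((e n).2.2 + 1)) (x - w) * f w‖ₑ) n
      rwa [hn] at this
    exact (hc.closure_eq ▸ hd.closure_eq ▸ Set.mem_univ A :)
  have h2 : ∀ m : ℕ, ‖truncatedIntegral φ f A x (1 / (m + 1 : ℝ))‖ₑ ≤ C := fun m =>
    le_of_tendsto ((continuous_enorm.tendsto _).comp
      (tendsto_annulus_integral mφ A x (by positivity))) (Eventually.of_forall fun N => h1 m N A)
  rw [pvIntegral, hl.limUnder_eq]
  have h3 : Tendsto (fun m : ℕ => 1 / (m + 1 : ℝ)) atTop (𝓝[>] 0) :=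
    tendsto_nhdsWithin_iff.2 ⟨tendsto_one_div_add_atTop_nhds_zero_nat,
      Eventually.of_forall fun m => by simp only [Set.mem_Ioi]; positivity⟩
  exact le_of_tendsto ((continuous_enorm.tendsto _).comp (hl.comp h3)) (Eventually.of_forall h2)

theorem eLpNorm_maximalOperator_le {δ ε σ : ℝ} (hδ : 0 < δ) (h0 : δ < |ε|) (h1 : δ < |ε - 1|)
    (mφ : Measurable φ) (hφ : ∀ y, |φ y| ≤ |y| ^ ε) (hσ : |σ| = 1)
    (hp : ∀ y, 0 < y → φ y = y ^ ε) (hn : ∀ y, 0 < y → φ (-y) = σ * y ^ ε)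
    (hpv : ∀ A x, PVExists φ f A x) :
    eLpNorm (maximalOperator φ f) 2 volume ≤ totalConst δ * eLpNorm (fun x => f x) 2 volume := by
  obtain ⟨e, he⟩ := exists_surjective_nat (ℚ × ℕ × ℕ)
  rw [eLpNorm_two_eq_l2Norm, eLpNorm_two_eq_l2Norm]
  simp only [enorm_eq_self]
  refine (l2Norm_mono (maximalOperator_le_iSup mφ hpv e he)).trans ?_
  refine l2Norm_iSup_le_of_selection (fun n => ?_) fun n i mi => ?_
  · exact (measurable_linearised (ι := Unit) (κ := fun _ => restrictedKernel φ (e n).1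
      (annulus (1 / ((e n).2.1 + 1 : ℝ)) ((e n).2.2 + 1))) (fun _ =>
        measurable_restrictedKernel mφ _ (measurableSet_annulus _ _)) (i := fun _ => ())
      measurable_const f.continuous.measurable).enorm
  · exact l2Norm_annulus_le (A := fun m : Fin (n + 1) => (e m).1)
      (r := fun m => 1 / ((e m).2.1 + 1 : ℝ)) (N := fun m => (e m).2.2 + 1) hδ h0 h1 mφ hφ hσ hp hn
      (fun m => by positivity) (fun m => by
        rw [div_le_iff₀ (by positivity)]
        have h2 : (0 : ℝ) ≤ (e m).2.1 := by positivity
        have h3 : (0 : ℝ) ≤ (e m).2.2 := by positivity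
        nlinarith) mi f.continuous.measurable f.integrable

end Limits

section PrincipalValue

theorem tendsto_integral_zero_one {g : ℝ → ℂ} (hg : IntervalIntegrable g volume 0 1) :
    Tendsto (fun r : ℝ => ∫ y in r..1, g y) (𝓝[>] 0) (𝓝 (∫ y in (0 : ℝ)..1, g y)) := by
  have hc := intervalIntegral.continuousOn_primitive_interval_left (f := g) (a := 0) (b := 1)
    (μ := volume) (by rw [← intervalIntegrable_iff' ]; exact hg)
  have h := (hc 0 (by simp)).tendsto
  refine h.mono_left ?_
  rw [← nhdsWithin_Ioc_eq_nhdsGT (zero_lt_one' ℝ)]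
  refine nhdsWithin_mono _ ?_
  rw [Set.uIcc_of_le zero_le_one]
  exact Set.Ioc_subset_Icc_self

theorem tendsto_oscillatory_of_pos {ε : ℝ} (hε : 0 < ε) (B : ℝ) :
    ∃ l, Tendsto (fun r : ℝ => ∫ y in r..1,
      (Complex.exp (Complex.I * ((B * y ^ ε : ℝ) : ℂ)) - 1) / (y : ℂ)) (𝓝[>] 0) (𝓝 l) := by
  refine ⟨_, tendsto_integral_zero_one ?_⟩
  have h := (intervalIntegral.intervalIntegrable_rpow' (a := 0) (b := 1)
    (by linarith : -1 < ε - 1)).const_mul |B|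
  have hm : Measurable fun y : ℝ =>
    (Complex.exp (Complex.I * ((B * y ^ ε : ℝ) : ℂ)) - 1) / (y : ℂ) := by fun_prop
  refine h.mono_fun' hm.aestronglyMeasurable ?_
  rw [Set.uIoc_of_le zero_le_one]
  refine (ae_restrict_mem measurableSet_Ioc).mono fun y hy => ?_
  have hy0 := hy.1
  simp only
  rw [norm_div, Complex.norm_real, Real.norm_of_nonneg hy0.le, div_le_iff₀ hy0, mul_assoc,
    ← Real.rpow_add_one hy0.ne', sub_add_cancel]
  refine Real.norm_exp_I_mul_ofReal_sub_one_le.trans_eq ?_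
  rw [Real.norm_eq_abs, abs_mul, abs_of_nonneg (by positivity : 0 ≤ y ^ ε)]

theorem tendsto_oscillatory_of_neg {ε : ℝ} (hε : ε < 0) {B : ℝ} (hB : B ≠ 0) :
    ∃ l, Tendsto (fun r : ℝ => ∫ y in r..1,
      Complex.exp (Complex.I * ((B * y ^ ε : ℝ) : ℂ)) / (y : ℂ)) (𝓝[>] 0) (𝓝 l) := by
  set E : ℝ → ℂ := fun y => Complex.exp (Complex.I * ((B * y ^ ε : ℝ) : ℂ))
  have nE : ∀ y, ‖E y‖ = 1 := fun y => by
    simp only [E]; rw [mul_comm]; exact Complex.norm_exp_ofReal_mul_I _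
  set V : ℝ → ℂ := fun y => E y * ((y ^ (-ε) : ℝ) : ℂ) / (Complex.I * B * ε)
  set g : ℝ → ℂ := fun y => E y * ((y ^ (-ε - 1) : ℝ) : ℂ) / (Complex.I * B)
  have ig : IntervalIntegrable g volume 0 1 := by
    have h := (intervalIntegral.intervalIntegrable_rpow' (a := 0) (b := 1)
      (by linarith : -1 < -ε - 1)).const_mul |B|⁻¹
    refine h.mono_fun' (by fun_prop) ?_
    rw [Set.uIoc_of_le zero_le_one]
    refine (ae_restrict_mem measurableSet_Ioc).mono fun y hy => ?_
    have hy0 := hy.1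
    simp only [g, norm_div, norm_mul, nE, Complex.norm_real, Complex.norm_I, Real.norm_eq_abs,
      one_mul]
    rw [abs_of_nonneg (by positivity : 0 ≤ y ^ (-ε - 1)), div_eq_inv_mul]
  have hV : Tendsto V (𝓝[>] 0) (𝓝 0) := by
    rw [tendsto_zero_iff_norm_tendsto_zero]
    have h1 : Tendsto (fun y : ℝ => y ^ (-ε) / (|B| * |ε|)) (𝓝[>] 0) (𝓝 (0 ^ (-ε) / (|B| * |ε|))) :=
      (((Real.continuousAt_rpow_const 0 (-ε) (Or.inr (by linarith))).tendsto).mono_left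
        nhdsWithin_le_nhds).div_const _
    rw [Real.zero_rpow (by linarith), zero_div] at h1
    refine h1.congr' ?_
    filter_upwards [self_mem_nhdsWithin] with y hy
    have hy0 : 0 < y := hy
    simp only [V, norm_div, norm_mul, nE, Complex.norm_real, Complex.norm_I, Real.norm_eq_abs,
      one_mul]
    rw [abs_of_nonneg (by positivity : 0 ≤ y ^ (-ε))]
  refine ⟨V 1 - 0 + ∫ y in (0 : ℝ)..1, g y, ?_⟩
  refine ((tendsto_const_nhds.sub hV).add (tendsto_integral_zero_one ig)).congr' ?_
  filter_upwards [Ioo_mem_nhdsGT (zero_lt_one' ℝ)] with r hr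
  have hu : Set.uIcc r 1 = Set.Icc r 1 := Set.uIcc_of_le hr.2.le
  have pos : ∀ y ∈ Set.uIcc r 1, 0 < y := fun y hy => by
    rw [hu] at hy; exact hr.1.trans_le hy.1
  have cp : ∀ s : ℝ, ContinuousOn (fun y : ℝ => y ^ s) (Set.uIcc r 1) := fun s y hy =>
    (Real.continuousAt_rpow_const y s (Or.inl (pos y hy).ne')).continuousWithinAt
  have cE : ContinuousOn E (Set.uIcc r 1) :=
    Complex.continuous_exp.comp_continuousOn (continuousOn_const.mul
      (Complex.continuous_ofReal.comp_continuousOn (continuousOn_const.mul (cp ε))))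
  have i1 : IntervalIntegrable (fun y => E y / (y : ℂ)) volume r 1 :=
    (cE.div (Complex.continuous_ofReal.continuousOn) fun y hy => by
      exact_mod_cast (pos y hy).ne').intervalIntegrable
  have i2 : IntervalIntegrable g volume r 1 :=
    ((cE.mul (Complex.continuous_ofReal.comp_continuousOn (cp _))).div_const _).intervalIntegrable
  have ftc : ∫ y in r..1, (E y / (y : ℂ) - g y) = V 1 - V r := by
    refine intervalIntegral.integral_eq_sub_of_hasDerivAt (fun y hy => ?_) (i1.sub i2)
    have hy0 := pos y hy
    have dp : ∀ s : ℝ, HasDerivAt (fun y => y ^ s) (s * y ^ (s - 1)) y := fun s => by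
      simpa using Real.hasDerivAt_rpow_const (p := s) (Or.inl hy0.ne')
    have dE : HasDerivAt E (E y * (Complex.I * ((B * (ε * y ^ (ε - 1)) : ℝ) : ℂ))) y :=
      (((dp ε).const_mul B).ofReal_comp.const_mul Complex.I).cexp
    refine ((dE.mul (dp (-ε)).ofReal_comp).div_const (Complex.I * B * ε)).congr_deriv ?_
    have hBc : (B : ℂ) ≠ 0 := by exact_mod_cast hB
    have hεc : (ε : ℂ) ≠ 0 := by exact_mod_cast hε.ne
    have hyc : (y : ℂ) ≠ 0 := by exact_mod_cast hy0.ne'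
    have e1 : ((y ^ (ε - 1) : ℝ) : ℂ) * ((y ^ (-ε) : ℝ) : ℂ) = (y : ℂ)⁻¹ := by
      rw [← Complex.ofReal_mul, ← Real.rpow_add hy0, show ε - 1 + -ε = -1 by ring,
        Real.rpow_neg_one, Complex.ofReal_inv]
    simp only [g]
    have hI := Complex.I_ne_zero
    rw [div_eq_mul_inv (E y), ← e1]
    push_cast
    field_simp
    ring
  rw [intervalIntegral.integral_sub i1 i2] at ftc
  rw [← ftc, sub_add_cancel]

/-- The singular part of the principal value converges. -/
theorem exists_tendsto_annulus_one {φ : ℝ → ℝ} {ε σ : ℝ} (hε : ε ≠ 0) (hσ : |σ| = 1)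
    (mφ : Measurable φ) (hp : ∀ y, 0 < y → φ y = y ^ ε) (hn : ∀ y, 0 < y → φ (-y) = σ * y ^ ε)
    (A : ℝ) :
    ∃ l, Tendsto (fun r : ℝ => ∫ y, restrictedKernel φ A (annulus r 1) y) (𝓝[>] 0) (𝓝 l) := by
  set g : ℝ → ℝ → ℂ := fun B y => Complex.exp (Complex.I * ((B * y ^ ε : ℝ) : ℂ)) / (y : ℂ)
  have cg : ∀ B r, 0 < r → ContinuousOn (g B) (Set.Icc r 1) := fun B r hr => by
    refine ContinuousOn.div (Complex.continuous_exp.comp_continuousOn (continuousOn_const.mul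
      (Complex.continuous_ofReal.comp_continuousOn (continuousOn_const.mul ?_))))
      Complex.continuous_ofReal.continuousOn fun y hy => ?_
    · exact fun y hy => (Real.continuousAt_rpow_const y ε
        (Or.inl (hr.trans_le hy.1).ne')).continuousWithinAt
    · exact_mod_cast (hr.trans_le hy.1).ne'
  have ig : ∀ B r, 0 < r → r < 1 → IntervalIntegrable (g B) volume r 1 := fun B r hr h1 =>
    ContinuousOn.intervalIntegrable (by rw [Set.uIcc_of_le h1.le]; exact cg B r hr)
  have main : ∃ l, Tendsto (fun r : ℝ => ∫ y in r..1, (g A y - g (σ * A) y)) (𝓝[>] 0) (𝓝 l) := by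
    rcases eq_or_ne A 0 with rfl | hA
    · exact ⟨0, by simp⟩
    rcases hε.lt_or_gt with h | h
    · have hσA : σ * A ≠ 0 := mul_ne_zero (abs_pos.1 (by rw [hσ]; exact one_pos)) hA
      obtain ⟨l₁, h₁⟩ := tendsto_oscillatory_of_neg h hA
      obtain ⟨l₂, h₂⟩ := tendsto_oscillatory_of_neg h hσA
      refine ⟨l₁ - l₂, (h₁.sub h₂).congr' ?_⟩
      filter_upwards [Ioo_mem_nhdsGT (zero_lt_one' ℝ)] with r hr
      exact (intervalIntegral.integral_sub (ig A r hr.1 hr.2) (ig (σ * A) r hr.1 hr.2)).symm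
    · obtain ⟨l₁, h₁⟩ := tendsto_oscillatory_of_pos h A
      obtain ⟨l₂, h₂⟩ := tendsto_oscillatory_of_pos h (σ * A)
      refine ⟨l₁ - l₂, (h₁.sub h₂).congr' ?_⟩
      filter_upwards [Ioo_mem_nhdsGT (zero_lt_one' ℝ)] with r hr
      have i0 := ig 0 r hr.1 hr.2
      have e0 : ∀ B y, (Complex.exp (Complex.I * ((B * y ^ ε : ℝ) : ℂ)) - 1) / (y : ℂ) =
          g B y - g 0 y := fun B y => by simp [g, sub_div]
      simp_rw [e0]
      rw [intervalIntegral.integral_sub (ig A r hr.1 hr.2) i0,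
        intervalIntegral.integral_sub (ig (σ * A) r hr.1 hr.2) i0,
        intervalIntegral.integral_sub (ig A r hr.1 hr.2) (ig (σ * A) r hr.1 hr.2)]
      ring
  obtain ⟨l, hl⟩ := main
  refine ⟨l, hl.congr' ?_⟩
  filter_upwards [Ioo_mem_nhdsGT (zero_lt_one' ℝ)] with r hr
  have hr0 := hr.1
  set F : ℝ → ℂ := fun y => Complex.exp (Complex.I * ((A * φ y : ℝ) : ℂ)) / (y : ℂ)
  have es : annulus r 1 = Set.Ioc r 1 ∪ Set.Ico (-1) (-r) := by
    ext y
    simp only [annulus, Set.mem_ofPred_eq, Set.mem_union, Set.mem_Ioc, Set.mem_Ico, lt_abs, abs_le]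
    constructor
    · rintro ⟨h | h, h2, h3⟩
      · exact Or.inl ⟨h, h3⟩
      · exact Or.inr ⟨h2, by linarith⟩
    · rintro (⟨h, h2⟩ | ⟨h, h2⟩)
      · exact ⟨Or.inl h, by linarith, h2⟩
      · exact ⟨Or.inr (by linarith), h, by linarith⟩
  have hd : Disjoint (Set.Ioc r 1) (Set.Ico (-1) (-r)) := by
    rw [Set.disjoint_left]
    intro y h1 h2
    linarith [h1.1, h2.2]
  have mF : Measurable F := by fun_prop
  have iF : IntegrableOn F (annulus r 1) := by
    refine Measure.integrableOn_of_bounded (M := 1 / r) ?_ mF.aestronglyMeasurable ?_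
    · refine ne_top_of_le_ne_top (b := volume (Set.Icc (-1 : ℝ) 1)) (by simp) (measure_mono ?_)
      exact fun y hy => abs_le.1 hy.2
    · refine (ae_restrict_mem (measurableSet_annulus r 1)).mono fun y hy => ?_
      have := norm_restrictedKernel_le (φ := φ) (A := A) hr0
        (fun y (hy : y ∈ annulus r 1) => hy.1) y
      rwa [restrictedKernel, Set.indicator_of_mem hy] at this
  have e1 : ∫ y in Set.Ioc r 1, F y = ∫ y in r..1, g A y := by
    rw [← intervalIntegral.integral_of_le hr.2.le]
    refine intervalIntegral.integral_congr fun y hy => ?_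
    rw [Set.uIcc_of_le hr.2.le] at hy
    simp only [F, g, hp y (hr0.trans_le hy.1)]
  have e2 : ∫ y in Set.Ico (-1) (-r), F y = -∫ y in r..1, g (σ * A) y := by
    rw [integral_Ico_eq_integral_Ioc, ← intervalIntegral.integral_of_le (by linarith [hr.2]),
      ← intervalIntegral.integral_comp_neg, ← intervalIntegral.integral_neg]
    refine intervalIntegral.integral_congr fun y hy => ?_
    rw [Set.uIcc_of_le hr.2.le] at hy
    simp only [F, g, hn y (hr0.trans_le hy.1)]
    rw [Complex.ofReal_neg, div_neg, show A * (σ * y ^ ε) = σ * A * y ^ ε by ring]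
  rw [restrictedKernel, integral_indicator (measurableSet_annulus r 1), es,
    setIntegral_union hd measurableSet_Ico (iF.mono_set (by rw [es]; exact Set.subset_union_left))
      (iF.mono_set (by rw [es]; exact Set.subset_union_right)), e1, e2,
    intervalIntegral.integral_sub (ig A r hr0 hr.2) (ig (σ * A) r hr0 hr.2)]
  ring

theorem pvExists_of_homogeneous {φ : ℝ → ℝ} {ε σ : ℝ} (hε : ε ≠ 0) (hσ : |σ| = 1)
    (mφ : Measurable φ) (hp : ∀ y, 0 < y → φ y = y ^ ε) (hn : ∀ y, 0 < y → φ (-y) = σ * y ^ ε)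
    (f : 𝓢(ℝ, ℂ)) (A x : ℝ) : PVExists φ f A x := by
  obtain ⟨l, hl⟩ := exists_tendsto_annulus_one hε hσ mφ hp hn A
  set χ : ℝ → ℂ := (Set.Icc (-1 : ℝ) 1).indicator fun _ => f x
  set h : ℝ → ℂ := fun y =>
    Complex.exp (Complex.I * ((A * φ y : ℝ) : ℂ)) * (f (x - y) - χ y) / (y : ℂ)
  have mh : Measurable h := by
    have m1 : Measurable χ := measurable_const.indicator measurableSet_Icc
    have m2 : Measurable fun y => f (x - y) := (f.continuous.comp (by fun_prop)).measurable
    fun_prop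
  have cd : Continuous fun y => dslope f x (x - y) := by
    have h1 : Continuous (dslope f x) := by
      rw [← continuousOn_univ, continuousOn_dslope univ_mem]
      exact ⟨f.continuous.continuousOn, f.differentiableAt⟩
    exact h1.comp (by fun_prop)
  obtain ⟨D, hD⟩ := (isCompact_Icc (a := (-1 : ℝ)) (b := 1)).exists_bound_of_continuousOn
    cd.continuousOn
  have hD0 : 0 ≤ D := (norm_nonneg _).trans (hD 0 (by simp))
  set bound : ℝ → ℝ := fun y => (Set.Icc (-1 : ℝ) 1).indicator (fun _ => D) y + ‖f (x - y)‖
  have ib : Integrable bound := by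
    refine Integrable.add ?_ (integrable_schwartz_sub f x).norm
    rw [integrable_indicator_iff measurableSet_Icc]
    exact integrableOn_const (by simp)
  have hb : ∀ y, ‖h y‖ ≤ bound y := by
    intro y
    simp only [h, bound]
    rw [norm_div, norm_mul, mul_comm Complex.I, Complex.norm_exp_ofReal_mul_I, one_mul,
      Complex.norm_real, Real.norm_eq_abs]
    by_cases hy : y ∈ Set.Icc (-1 : ℝ) 1
    · rw [Set.indicator_of_mem hy]
      refine le_trans ?_ (le_add_of_nonneg_right (norm_nonneg _))
      rcases eq_or_ne y 0 with rfl | h0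
      · simpa using hD0
      have := hD y hy
      rw [dslope_of_ne _ (by intro h'; apply h0; linarith), slope_def_module, norm_smul,
        norm_inv, Real.norm_eq_abs, show x - y - x = -y by ring, abs_neg] at this
      simp only [χ, Set.indicator_of_mem hy]
      rwa [div_eq_inv_mul]
    · simp only [χ, Set.indicator_of_notMem hy, sub_zero, zero_add]
      have : 1 ≤ |y| := by
        by_contra h'
        exact hy (abs_le.1 (not_le.1 h').le)
      exact div_le_self (norm_nonneg _) this
  have mS : ∀ r : ℝ, MeasurableSet {y : ℝ | r < |y|} := fun r =>
    measurableSet_lt measurable_const continuous_abs.measurable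
  have lim1 : Tendsto (fun r : ℝ => ∫ y, {y : ℝ | r < |y|}.indicator h y) (𝓝[>] 0)
      (𝓝 (∫ y, h y)) := by
    refine tendsto_integral_filter_of_dominated_convergence bound
      (Eventually.of_forall fun r => (mh.indicator (mS r)).aestronglyMeasurable)
      (Eventually.of_forall fun r => Eventually.of_forall fun y =>
        (norm_indicator_le_norm_self _ _).trans (hb y)) ib ?_
    filter_upwards [Measure.ae_ne volume 0] with y hy
    refine tendsto_const_nhds.congr' ?_
    filter_upwards [Ioo_mem_nhdsGT (abs_pos.2 hy)] with r hr
    exact (Set.indicator_of_mem (show y ∈ {y : ℝ | r < |y|} from hr.2) _).symm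
  refine ⟨(∫ y, h y) + l * f x, (lim1.add (hl.mul_const (f x))).congr' ?_⟩
  filter_upwards [Ioo_mem_nhdsGT (zero_lt_one' ℝ)] with r hr
  have i1 : Integrable ({y : ℝ | r < |y|}.indicator h) :=
    (ib.mono' mh.aestronglyMeasurable (Eventually.of_forall hb)).indicator (mS r)
  have i2 : Integrable (restrictedKernel φ A (annulus r 1)) := by
    have mK := measurable_restrictedKernel mφ A (measurableSet_annulus r 1)
    have e : restrictedKernel φ A (annulus r 1) =
        (Set.Icc (-1 : ℝ) 1).indicator (restrictedKernel φ A (annulus r 1)) := by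
      rw [restrictedKernel, Set.indicator_indicator, Set.inter_eq_self_of_subset_right]
      exact fun y hy => abs_le.1 hy.2
    rw [e, integrable_indicator_iff measurableSet_Icc]
    exact Measure.integrableOn_of_bounded (M := 1 / r) (by simp) mK.aestronglyMeasurable
      (Eventually.of_forall fun y => norm_restrictedKernel_le hr.1 (fun y hy => hy.1) y)
  rw [truncatedIntegral, ← integral_indicator (mS r), ← integral_mul_const,
    ← integral_add i1 (i2.mul_const _)]
  congr 1
  ext y
  by_cases h1 : r < |y|
  · rw [Set.indicator_of_mem (show y ∈ {y : ℝ | r < |y|} from h1),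
      Set.indicator_of_mem (show y ∈ {y : ℝ | r < |y|} from h1)]
    simp only [h, χ, restrictedKernel]
    by_cases h2 : |y| ≤ 1
    · rw [Set.indicator_of_mem (show y ∈ Set.Icc (-1 : ℝ) 1 from abs_le.1 h2),
        Set.indicator_of_mem (show y ∈ annulus r 1 from ⟨h1, h2⟩)]
      ring
    · rw [Set.indicator_of_notMem (show y ∉ Set.Icc (-1 : ℝ) 1 from fun h' => h2 (abs_le.2 h')),
        Set.indicator_of_notMem (show y ∉ annulus r 1 from fun h' => h2 h'.2)]
      ring
  · rw [Set.indicator_of_notMem (show y ∉ {y : ℝ | r < |y|} from h1),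
      Set.indicator_of_notMem (show y ∉ {y : ℝ | r < |y|} from h1), restrictedKernel,
      Set.indicator_of_notMem (show y ∉ annulus r 1 from fun h' => h1 h'.1)]
    simp

end PrincipalValue

theorem theorem1p3 (δ : ℝ) (hδ0 : 0 < δ) (hδ1 : δ < 1) :
    ∃ C : ℝ≥0, ∀ ε : ℝ, δ < |ε| → δ < |ε - 1| → ∀ f : 𝓢(ℝ, ℂ),
      (∀ A x : ℝ, PVExists (evenPhase ε) f A x) ∧
      (∀ A x : ℝ, PVExists (oddPhase ε) f A x) ∧
      eLpNorm (carlesonEven ε f) 2 volume ≤ (C : ℝ≥0∞) * eLpNorm (fun x => f x) 2 volume ∧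
      eLpNorm (carlesonOdd ε f) 2 volume ≤ (C : ℝ≥0∞) * eLpNorm (fun x => f x) 2 volume := by
  refine ⟨(totalConst δ).toNNReal, fun ε h0 h1 f => ?_⟩
  rw [ENNReal.coe_toNNReal (totalConst_ne_top hδ0)]
  have hε : ε ≠ 0 := abs_pos.1 (hδ0.trans h0)
  have mE : Measurable (evenPhase ε) := by unfold evenPhase; fun_prop
  have mO : Measurable (oddPhase ε) := by
    have : Measurable Real.sign := by
      unfold Real.sign
      exact Measurable.ite measurableSet_Iio measurable_const
        (Measurable.ite measurableSet_Ioi measurable_const measurable_const)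
    unfold oddPhase
    fun_prop
  have bE : ∀ y, |evenPhase ε y| ≤ |y| ^ ε := fun y => by
    rw [evenPhase, abs_of_nonneg (by positivity)]
  have bO : ∀ y, |oddPhase ε y| ≤ |y| ^ ε := fun y => by
    rw [oddPhase, abs_mul, abs_of_nonneg (by positivity : 0 ≤ |y| ^ ε)]
    refine mul_le_of_le_one_left (by positivity) ?_
    rcases Real.sign_apply_eq y with h | h | h <;> simp [h]
  have pE : ∀ y, 0 < y → evenPhase ε y = y ^ ε := fun y hy => by
    rw [evenPhase, abs_of_pos hy]
  have nE : ∀ y, 0 < y → evenPhase ε (-y) = 1 * y ^ ε := fun y hy => by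
    rw [evenPhase, abs_neg, abs_of_pos hy, one_mul]
  have pO : ∀ y, 0 < y → oddPhase ε y = y ^ ε := fun y hy => by
    rw [oddPhase, abs_of_pos hy, Real.sign_of_pos hy, one_mul]
  have nO : ∀ y, 0 < y → oddPhase ε (-y) = -1 * y ^ ε := fun y hy => by
    rw [oddPhase, abs_neg, abs_of_pos hy, Real.sign_of_neg (neg_lt_zero.2 hy)]
  have pvE := pvExists_of_homogeneous hε (by simp) mE pE nE f
  have pvO := pvExists_of_homogeneous hε (by simp) mO pO nO f
  exact ⟨pvE, pvO, eLpNorm_maximalOperator_le hδ0 h0 h1 mE bE (by simp) pE nE pvE,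
    eLpNorm_maximalOperator_le hδ0 h0 h1 mO bO (by simp) pO nO pvO⟩
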